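/- **Setting.** Let $p\ge1$, let $D\subset\mathbb R^p$ be compact and convex (D1), let $k\ge2$ be an integer with $k>p/2$ (F2), and let $\mathcal F$ be a class of probability densities $f$ on $\mathbb R^p$ with support $D$ (each identified with its distribution) such that (F1): each $f\in\mathcal F$ is $k$ times continuously differentiable on $D$, and for constants $M_0,L$ common to the class, $1/M_0\le f\le M_0$ on $D$ and all derivatives of $f$ of orders $1,\dots,k$ on $D$ are bounded by $L$. Let $\Theta$ be the unit sphere of $\mathbb R^p$ with surface measure. Let $\psi$ be a slicing transform: it maps each $f\in\mathcal F$ to a family $(\psi(f)(\theta))_{\theta\in\Theta}$ of probability densities on $\mathbb R$, square integrable on $\Theta\times\mathbb R$, with all supports in one bounded interval (D2). Families that agree up to null sets are identified. Assume * (T0) $\psi$ is injective on $\mathcal F$; * (T1) there is $C_0$ with $\|\psi(f_1)(\theta)-\psi(f_2)(\theta)\|_{L^2}\le C_0\|f_1-f_2\|_{L^2}$ for all $f_1,f_2\in\mathcal F$, $\theta\in\Theta$; * (T2) there is $\psi^{-1}$ with $\psi^{-1}(\psi(f))=f$ for all $f\in\mathcal F$; * (A1) $\widetilde\psi(\mathcal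 F)$ is closed and convex in $L^2(\Theta\times[0,1])$, where $\widetilde\psi(f)(\theta,s)$ is the $s$-quantile of $\psi(f)(\theta)$. Let $d_{SW}(f_1,f_2)=\|\widetilde\psi(f_1)-\widetilde\psi(f_2)\|_{L^2(\Theta\times[0,1])}$ (the $L^2$ average over the slices of the Wasserstein distances). Let $(X,f)$ be a random pair in $\mathbb R^q\times\mathcal F$ with $E\|X\|^4<\infty$ and $\mathrm{Var}(X)$ positive definite, and let $(X_i,f_i)$, $i\ge1$, be independent copies of it. For $x\in\mathbb R^q$ put $s_G(X,x)=1+(X-EX)^T\mathrm{Var}(X)^{-1}(x-EX)$ and $s_{iG}(x)=1+(X_i-\bar X)^T\hat\Sigma^{-1}(x-\bar X)$, with $\bar X$ the sample mean and $\hat\Sigma$ the sample covariance matrix (with factor $1/n$) of $X_1,\dots,X_n$, and let $$m(x)=\operatorname*{argmin}_{g\in\mathcal F}E\big[s_G(X,x)\,d_{SW}^2(f,g)\big],\qquad \check m(x)=\operatorname*{argmin}_{g\in\mathcal F}\frac1n\sum_{i=1}^n s_{iG}(x)\,d_{SW}^2(f_i,g).$$ **Theorem, fully observed distributions.** The minimizers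 $m(x)$ and $\check m(x)$ exist and are unique, and for every $x\in\mathbb R^q$, $B>0$, $\epsilon>0$, as $n\to\infty$, $$d_{SW}(m(x),\check m(x))=O_p(n^{-1/2}),\qquad \sup_{\|x\|\le B}d_{SW}(m(x),\check m(x))=O_p(n^{-1/(2+\epsilon)}).$$ **Theorem, estimated densities.** Assume in addition the following. * For some $\eta>0$ let $\mathcal F^\eta$ be the set of probability densities with support $D$ that are $k$ times continuously differentiable on $D$ and are within sup distance $\eta$ on $D$ of some member of $\mathcal F$. The transform $\psi$ is a slicing transform that satisfies (T1) on $\mathcal F^\eta$, and (G1): the support of each slice $\psi(g)(\theta)$, $g\in\mathcal F^\eta$, is a compact interval on which $1/M_1\le\psi(g)(\theta)\le M_1$, with $M_1$ independent of $g,\theta$. * (F1′) $f_i=h_i/\int_Dh_i$ on $D$, where $h_i$ is a random probability density on $\mathbb R^p$ that on the $\epsilon_0$-neighbourhood of $D$ (for a fixed $\epsilon_0>0$) takes values in $[1/M,M]$ and is $k$ times continuously differentiable with derivatives bounded by a constant; $M$ and the constant do not depend on $i$ or on the realization. * (P1) For each $n$ and each $i\le n$ one observes $N_i=N_{n,i}$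 points $Z_{i1},\dots,Z_{iN_i}$. Given $(h_i)_i$, all these points are independent and $Z_{ij}$ has density $h_i$. There is $c>0$ with $\min_{i\le n}N_i\ge c\,n^{(p+4)/4}$ for all large $n$. * (K1) The kernel $\kappa$ is a bounded, symmetric probability density on $\mathbb R^p$ with compact support, $k$ times continuously differentiable. * (K2) For some $A,\omega>0$, every probability measure $Q$ on $\mathbb R^p$ and every $r\in(0,1)$, the class $\{\kappa((z-\cdot)/b):z\in\mathbb R^p,\,b>0\}$ with envelope $G$ can be covered by at most $(A/r)^\omega$ $L^2(Q)$-balls of radius $r\|G\|_{L^2(Q)}$ centred in the class. * The bandwidths $b=b(N)>0$ are of exact order $N^{-1/(p+4)}$. Let $\check f_i(z)=\frac1{N_ib^p}\sum_{j}\kappa\big(\frac{z-Z_{ij}}b\big)$ with $b=b(N_i)$, let $\hat f_i=\check f_i/\int_D\check f_i$ on $D$ and $\hat f_i=0$ off $D$, and let $\hat m(x)=\operatorname*{argmin}_{g\in\mathcal F}\frac1n\sum_{i=1}^n s_{iG}(x)\,d_{SW}^2(\hat f_i,g)$. Then, with probability tending to one, $\hat m(x)$ exists and is unique for all $x$, and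 for every $x\in\mathbb R^q$, $B>0$, $\epsilon>0$, $$d_{SW}(m(x),\hat m(x))=O_p(n^{-1/2}),\qquad \sup_{\|x\|\le B}d_{SW}(m(x),\hat m(x))=O_p(n^{-1/(2+\epsilon)}).$$ -/

import Mathlib

open MeasureTheory ProbabilityTheory Filter Topology
open scoped ENNReal

noncomputable section

namespace SAW

/-- Euclidean space of dimension `d`. -/
abbrev Euc (d : ℕ) : Type := EuclideanSpace ℝ (Fin d)

/-- The unit sphere of `ℝ^p`, the set of slicing parameters. -/
abbrev Theta (p : ℕ) : Type := Metric.sphere (0 : Euc p) 1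

/-- Surface measure on the unit sphere. -/
def sphereMeasure (p : ℕ) : Measure (Theta p) := (volume : Measure (Euc p)).toSphere

/-- A map that sends a function on `ℝ^p` to a family, indexed by the unit sphere, of functions
on the real line. -/
abbrev Transform (p : ℕ) : Type := (Euc p → ℝ) → Theta p → ℝ → ℝ

/-! ### Density classes -/

/-- A probability density with support `D` that is `k` times continuously differentiable on `D`. -/
structure IsDensityOn {p : ℕ} (D : Set (Euc p)) (k : ℕ) (f : Euc p → ℝ) : Prop where
  nonneg : ∀ z, 0 ≤ f z
  integrable : Integrable f volume
  integral_one : ∫ z, f z = 1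
  support_eq : Function.support f = D
  contDiffOn : ContDiffOn ℝ (k : WithTop ℕ∞) f D

/-- A class of densities with support `D` that satisfies (F1) with differentiability order `k`:
values on `D` in `[1/M₀, M₀]`, and derivatives up to order `k` on `D` that are uniformly bounded,
with the same constants for the whole class. Each density is continuous on `D` and vanishes off
`D`, so a distribution is identified with its density. -/
def F1 {p : ℕ} (D : Set (Euc p)) (k : ℕ) (F : Set (Euc p → ℝ)) : Prop :=
  2 ≤ k ∧ (∀ f ∈ F, IsDensityOn D k f) ∧
  (∃ M₀ : ℝ, 0 < M₀ ∧ ∀ f ∈ F, ∀ z ∈ D, 1 / M₀ ≤ f z ∧ f z ≤ M₀) ∧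
  (∃ L : ℝ, ∀ f ∈ F, ∀ j : ℕ, 1 ≤ j → j ≤ k → ∀ z ∈ D, ‖iteratedFDerivWithin ℝ j f D z‖ ≤ L)

/-- Densities with support `D`, `k` times continuously differentiable on `D`, whose sup distance
on `D` to some member of `F` is at most `η`. -/
def supNhd {p : ℕ} (D : Set (Euc p)) (k : ℕ) (F : Set (Euc p → ℝ)) (η : ℝ) :
    Set (Euc p → ℝ) :=
  {g | IsDensityOn D k g ∧ ∃ f ∈ F, ∀ z ∈ D, |g z - f z| ≤ η}

/-! ### Slicing transforms -/

/-- `ψ` maps each density of the class `S` to a square integrable family of univariate probability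
densities (slices); the supports of all slices lie in one bounded interval (D2). -/
structure IsSlicingOn {p : ℕ} (ψ : Transform p) (S : Set (Euc p → ℝ)) : Prop where
  nonneg : ∀ f ∈ S, ∀ θ u, 0 ≤ ψ f θ u
  integrable : ∀ f ∈ S, ∀ θ, Integrable (ψ f θ) volume
  integral_one : ∀ f ∈ S, ∀ θ, ∫ u, ψ f θ u = 1
  memLp : ∀ f ∈ S, MemLp (fun y : Theta p × ℝ => ψ f y.1 y.2) 2 ((sphereMeasure p).prod volume)
  bounded : ∃ R : ℝ, ∀ f ∈ S, ∀ θ, Function.support (ψ f θ) ⊆ Set.Icc (-R) R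

/-- The bounds of (G1) on the slices of the class `S`: the support of each slice is a compact
interval on which the slice takes values in `[1/M₁, M₁]`. -/
def G1bounds {p : ℕ} (ψ : Transform p) (S : Set (Euc p → ℝ)) : Prop :=
  ∃ M₁ : ℝ, 0 < M₁ ∧ ∀ f ∈ S, ∀ θ, ∃ a b : ℝ,
    Function.support (ψ f θ) = Set.Icc a b ∧ ∀ u ∈ Set.Icc a b, 1 / M₁ ≤ ψ f θ u ∧ ψ f θ u ≤ M₁

/-- Two slice families are identified if they agree up to null sets. -/
def SameSlices {p : ℕ} (l₁ l₂ : Theta p → ℝ → ℝ) : Prop :=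
  ∀ᵐ θ ∂(sphereMeasure p), l₁ θ =ᵐ[volume] l₂ θ

/-- (T0): `ψ` is injective on `F`. -/
def T0 {p : ℕ} (ψ : Transform p) (F : Set (Euc p → ℝ)) : Prop :=
  ∀ f₁ ∈ F, ∀ f₂ ∈ F, SameSlices (ψ f₁) (ψ f₂) → f₁ = f₂

/-- (T1): each slice map is Lipschitz in `L²`, with one constant for all slices. -/
def T1 {p : ℕ} (ψ : Transform p) (S : Set (Euc p → ℝ)) : Prop :=
  ∃ C₀ : ℝ, ∀ f₁ ∈ S, ∀ f₂ ∈ S, ∀ θ,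
    eLpNorm (ψ f₁ θ - ψ f₂ θ) 2 volume ≤ ENNReal.ofReal C₀ * eLpNorm (f₁ - f₂) 2 volume

/-- (T2): there is an inverse transform on the image of `F`. -/
def T2 {p : ℕ} (ψ : Transform p) (F : Set (Euc p → ℝ)) : Prop :=
  ∃ ψinv : (Theta p → ℝ → ℝ) → (Euc p → ℝ),
    (∀ l₁ l₂, SameSlices l₁ l₂ → ψinv l₁ = ψinv l₂) ∧ ∀ f ∈ F, ψinv (ψ f) = f

/-! ### Slice-averaged Wasserstein distance -/

/-- Quantile function of the distribution on `ℝ` with density `g`. -/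
def quantile (g : ℝ → ℝ) (s : ℝ) : ℝ := sInf {u : ℝ | s ≤ ∫ v in Set.Iic u, g v}

/-- Surface measure on the sphere times Lebesgue measure on `[0,1]`. -/
def quantileMeasure (p : ℕ) : Measure (Theta p × ℝ) :=
  (sphereMeasure p).prod (volume.restrict (Set.Icc 0 1))

/-- The transform into the quantile slicing space: `(θ, s)` is sent to the quantile at level `s`
of the slice in direction `θ`. -/
def psiTilde {p : ℕ} (ψ : Transform p) (f : Euc p → ℝ) : Theta p × ℝ → ℝ :=
  fun y => quantile (ψ f y.1) y.2

/-- Slice-averaged Wasserstein distance. -/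
def dSW {p : ℕ} (ψ : Transform p) (f₁ f₂ : Euc p → ℝ) : ℝ :=
  Real.sqrt (∫ y, (psiTilde ψ f₁ y - psiTilde ψ f₂ y) ^ 2 ∂(quantileMeasure p))

/-- The image of `F` in the Hilbert space `L²(Θ × [0,1])`. -/
def quantileImage {p : ℕ} (ψ : Transform p) (F : Set (Euc p → ℝ)) :
    Set (Lp ℝ 2 (quantileMeasure p)) :=
  {γ | ∃ f ∈ F, (γ : Theta p × ℝ → ℝ) =ᵐ[quantileMeasure p] psiTilde ψ f}

/-- (A1): the image of `F` is closed and convex. -/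
def A1 {p : ℕ} (ψ : Transform p) (F : Set (Euc p → ℝ)) : Prop :=
  IsClosed (quantileImage ψ F) ∧ Convex ℝ (quantileImage ψ F)

/-! ### Global Fréchet regression -/

/-- `g` minimizes `M` over `F`. -/
def IsMinimizer {p : ℕ} (F : Set (Euc p → ℝ)) (M : (Euc p → ℝ) → ℝ) (g : Euc p → ℝ) : Prop :=
  g ∈ F ∧ ∀ g' ∈ F, M g ≤ M g'

/-- The minimizer of `M` over `F` (an arbitrary function if there is none). -/
def argmin {p : ℕ} (F : Set (Euc p → ℝ)) (M : (Euc p → ℝ) → ℝ) : Euc p → ℝ :=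
  Classical.epsilon (IsMinimizer F M)

section population

variable {Ω : Type*} [MeasurableSpace Ω]

/-- Covariance matrix of a random vector. -/
def covMatrix {q : ℕ} (P : Measure Ω) (X : Ω → Euc q) : Matrix (Fin q) (Fin q) ℝ :=
  Matrix.of fun a b => cov[fun ω => X ω a, fun ω => X ω b; P]

/-- Weight `1 + (X - E X)ᵀ Var(X)⁻¹ (x - E X)`. -/
def weight {q : ℕ} (P : Measure Ω) (X : Ω → Euc q) (x : Euc q) (ω : Ω) : ℝ :=
  1 + (fun a => (X ω - P[X]) a) ⬝ᵥ ((covMatrix P X)⁻¹.mulVec fun a => (x - P[X]) a)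

/-- Population objective of global regression with the slice-averaged Wasserstein distance, for a
random predictor `X` and a random density `f`. -/
def popObjective {p q : ℕ} (P : Measure Ω) (ψ : Transform p) (X : Ω → Euc q)
    (f : Ω → Euc p → ℝ) (x : Euc q) (g : Euc p → ℝ) : ℝ :=
  ∫ ω, weight P X x ω * dSW ψ (f ω) g ^ 2 ∂P

end population

/-- Sample mean of the first `n` vectors. -/
def sampleMean {q : ℕ} (n : ℕ) (X : ℕ → Euc q) : Euc q :=
  (n : ℝ)⁻¹ • ∑ i ∈ Finset.range n, X i

/-- Sample covariance matrix (with factor `1/n`) of the first `n` vectors. -/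
def sampleCov {q : ℕ} (n : ℕ) (X : ℕ → Euc q) : Matrix (Fin q) (Fin q) ℝ :=
  Matrix.of fun a b =>
    (n : ℝ)⁻¹ * ∑ i ∈ Finset.range n, (X i - sampleMean n X) a * (X i - sampleMean n X) b

/-- Sample weight of the `i`-th observation. -/
def sampleWeight {q : ℕ} (n : ℕ) (X : ℕ → Euc q) (x : Euc q) (i : ℕ) : ℝ :=
  1 + (fun a => (X i - sampleMean n X) a) ⬝ᵥ
    ((sampleCov n X)⁻¹.mulVec fun a => (x - sampleMean n X) a)

/-- Sample objective built from the first `n` predictors and the densities `f i`. -/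
def sampleObjective {p q : ℕ} (ψ : Transform p) (n : ℕ) (X : ℕ → Euc q) (f : ℕ → Euc p → ℝ)
    (x : Euc q) (g : Euc p → ℝ) : ℝ :=
  (n : ℝ)⁻¹ * ∑ i ∈ Finset.range n, sampleWeight n X x i * dSW ψ (f i) g ^ 2

/-- `Y n = O_p(a n)` for nonnegative `Y`. -/
def IsBigOp {Ω : Type*} [MeasurableSpace Ω] (P : Measure Ω) (Y : ℕ → Ω → ℝ≥0∞) (a : ℕ → ℝ) :
    Prop :=
  ∀ δ : ℝ, 0 < δ → ∃ C : ℝ, 0 < C ∧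
    ∀ᶠ n in atTop, P {ω | ENNReal.ofReal (C * a n) < Y n ω} ≤ ENNReal.ofReal δ

/-! ### Kernel density estimation -/

/-- Untruncated densities in (F1′): densities on `ℝ^p` that, on the `ε`-neighbourhood of `D`, take
values in `[1/M, M]` and are `k` times continuously differentiable with derivatives bounded
by `L`. -/
structure IsUntruncated {p : ℕ} (D : Set (Euc p)) (k : ℕ) (ε M L : ℝ) (h : Euc p → ℝ) : Prop where
  nonneg : ∀ z, 0 ≤ h z
  integrable : Integrable h volume
  integral_one : ∫ z, h z = 1
  bounds : ∀ z ∈ Metric.thickening ε D, 1 / M ≤ h z ∧ h z ≤ M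
  contDiffOn : ContDiffOn ℝ (k : WithTop ℕ∞) h (Metric.thickening ε D)
  deriv_bound : ∀ j : ℕ, 1 ≤ j → j ≤ k → ∀ z ∈ Metric.thickening ε D,
    ‖iteratedFDerivWithin ℝ j h (Metric.thickening ε D) z‖ ≤ L

/-- Truncation to `D`: restrict to `D` and renormalize. -/
def truncate {p : ℕ} (D : Set (Euc p)) (h : Euc p → ℝ) : Euc p → ℝ :=
  D.indicator fun z => h z / ∫ u in D, h u

/-- Kernel density estimate with kernel `κ`, bandwidth `b`, and observations `Z 0, …, Z (N-1)`. -/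
def kde {p : ℕ} (κ : Euc p → ℝ) (b : ℝ) (N : ℕ) (Z : ℕ → Euc p) (z : Euc p) : ℝ :=
  1 / (N * b ^ p) * ∑ j ∈ Finset.range N, κ (b⁻¹ • (z - Z j))

/-- (K1): `κ` is a symmetric bounded probability density with compact support, `k` times
continuously differentiable. -/
structure K1 {p : ℕ} (k : ℕ) (κ : Euc p → ℝ) : Prop where
  nonneg : ∀ z, 0 ≤ κ z
  integrable : Integrable κ volume
  integral_one : ∫ z, κ z = 1
  compactSupport : HasCompactSupport κ
  symmetric : ∀ z, κ (-z) = κ z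
  bounded : ∃ K : ℝ, ∀ z, κ z ≤ K
  contDiff : ContDiff ℝ (k : WithTop ℕ∞) κ

/-- The class of all translates and rescalings of `κ`. -/
def kernelClass {p : ℕ} (κ : Euc p → ℝ) : Set (Euc p → ℝ) :=
  {g | ∃ (z : Euc p) (b : ℝ), 0 < b ∧ g = fun t => κ (b⁻¹ • (z - t))}

/-- Envelope function of a class of functions. -/
def envelope {p : ℕ} (S : Set (Euc p → ℝ)) (t : Euc p) : ℝ :=
  ⨆ g : S, |(g : Euc p → ℝ) t|

/-- (K2): the kernel class has polynomial uniform `L²` covering numbers. -/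
def K2 {p : ℕ} (κ : Euc p → ℝ) : Prop :=
  ∃ A w : ℝ, 0 < A ∧ 0 < w ∧
    ∀ (Q : Measure (Euc p)) [IsProbabilityMeasure Q] (r : ℝ), 0 < r → r < 1 →
      ∃ T : Finset (Euc p → ℝ), (∀ t ∈ T, t ∈ kernelClass κ) ∧ (T.card : ℝ) ≤ (A / r) ^ w ∧
        ∀ g ∈ kernelClass κ, ∃ t ∈ T,
          eLpNorm (g - t) 2 Q ≤ ENNReal.ofReal r * eLpNorm (envelope (kernelClass κ)) 2 Q

/-- The random densities `h i` are measurable with respect to the σ-algebra `𝓐`, and, given `𝓐`,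
the observations `Z n i j` with `i < n`, `j < N n i` of the `n`-th experiment are independent and
`Z n i j` has density `h i`. -/
structure IsSamplingGiven {Ω : Type*} (𝓐 : MeasurableSpace Ω) [mΩ : MeasurableSpace Ω]
    (P : Measure Ω) {p : ℕ} (h : ℕ → Ω → Euc p → ℝ) (N : ℕ → ℕ → ℕ)
    (Z : ℕ → ℕ → ℕ → Ω → Euc p) : Prop where
  le : 𝓐 ≤ mΩ
  measurable_density : ∀ i,
    @Measurable _ _ (𝓐.prod inferInstance) _ (fun y : Ω × Euc p => h i y.1 y.2)
  measurable_obs : ∀ n i j, @Measurable _ _ mΩ _ (Z n i j)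
  condLaw : ∀ (n : ℕ) (A : ℕ → ℕ → Set (Euc p)), (∀ i j, MeasurableSet (A i j)) →
    P[Set.indicator
        (⋂ i ∈ Finset.range n, ⋂ j ∈ Finset.range (N n i), Z n i j ⁻¹' A i j)
        (fun _ => (1 : ℝ)) | 𝓐]
      =ᵐ[P] fun ω => ∏ i ∈ Finset.range n, ∏ j ∈ Finset.range (N n i), ∫ z in A i j, h i ω z

/-- The observations are drawn from the random densities `h i` by a mechanism that is independent
of the one that generates these densities. -/
def IsSampling {Ω : Type*} [mΩ : MeasurableSpace Ω] (P : Measure Ω) {p : ℕ}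
    (h : ℕ → Ω → Euc p → ℝ) (N : ℕ → ℕ → ℕ) (Z : ℕ → ℕ → ℕ → Ω → Euc p) : Prop :=
  ∃ 𝓐 : MeasurableSpace Ω, @IsSamplingGiven Ω 𝓐 mΩ P p h N Z

end SAW

end

noncomputable section

namespace SAW

/-! ### Quantile functions of compactly supported densities -/

/-! The slice quantiles of a density form a vector `quantileEmb ψ f` of the Hilbert space L²(Θ ×
[0,1]), and `dSW` is the norm distance of these vectors (`SlicesIn.dSW_eq_norm`). The regression
weights may be negative, but they average to one, in the population and in the sample. Completing
the square therefore turns each objective into ‖τ − Φ g‖² plus a constant, with τ the weighted mean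
of the embedded densities (`popObjective_eq`, `sampleObjective_eq`). The minimizer is the preimage
of the projection of τ onto the image of the class, which is closed and convex by (A1); the
embedding is injective by (T0). Since projections onto convex sets are nonexpansive
(`IsProj.norm_sub_le`), the error of the minimizers is at most the error of the targets τ.

At x the target is `momentReg`, an explicit function of the means of V, X_a V, X_a and X_a X_b,
where V is the embedded density. It is affine in x and C¹ in the moments wherever the covariance
matrix is nonsingular. The sample moments are root-n consistent in Hilbert space because independent
centred vectors are orthogonal (`isBigOp_mean`), and the Lipschitz bound
`exists_lipschitz_momentReg` carries this rate over to τ, uniformly for x in a ball. The uniform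
rate obtained, n^(-1/2), is better than the one claimed, and no entropy argument enters.

Replacing densities by estimates moves τ by a weighted mean of embedding errors. Cauchy–Schwarz
(`sq_norm_mean_smul_le`) separates weights from errors, so it is enough that each squared error has
an expectation of order 1/n. Under (G1) the embedding is Lipschitz from L²
(`SlicesIn.exists_lipschitz`), truncation to D is stable (`exists_truncate_mem_supNhd`), and the
integrated squared error of the kernel estimate is of order b⁴: the symmetry of the kernel gives a
bias of order b², and the variance 1/(N b^p) is balanced with b⁴ by the bandwidth. The lower bound
on the N_i makes b⁴ = O(1/n).

All estimates must also lie in the sup neighbourhood of F at once, with probability tending to one.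
This comes from an exponential bound at fixed points (`measure_kdeFin_sub_gt_le`), integrated over a
neighbourhood of D: a large error at one point persists on a ball of radius of order b^(p+1), whose
volume is only polynomially small in b (`IsSamplingGiven.tendsto_measure_exists_lt`). Estimates
proved for product measures pass to the conditional sampling scheme through
`lintegral_le_of_forall_pi`. -/

/-- A probability density on the line with support in `[-R, R]`. -/
structure IsSlice (R : ℝ) (g : ℝ → ℝ) : Prop where
  nonneg : ∀ u, 0 ≤ g u
  integrable : Integrable g volume
  integral_one : ∫ u, g u = 1
  support_subset : Function.support g ⊆ Set.Icc (-R) R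

/-- Distribution function of a density on the line. -/
def distFun (g : ℝ → ℝ) (u : ℝ) : ℝ := ∫ v in Set.Iic u, g v

lemma distFun_congr {g₁ g₂ : ℝ → ℝ} (h : g₁ =ᵐ[volume] g₂) (u : ℝ) :
    distFun g₁ u = distFun g₂ u :=
  integral_congr_ae (ae_restrict_of_ae h)

namespace IsSlice

variable {R : ℝ} {g g₁ g₂ : ℝ → ℝ}

lemma distFun_sub (hg : IsSlice R g) {u v : ℝ} (huv : u ≤ v) :
    distFun g v - distFun g u = ∫ w in Set.Ioc u v, g w := by
  have h := intervalIntegral.integral_Iic_sub_Iic (f := g) (μ := volume) (a := u) (b := v)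
    hg.integrable.integrableOn hg.integrable.integrableOn
  rw [distFun, distFun, h, intervalIntegral.integral_of_le huv]

lemma monotone_distFun (hg : IsSlice R g) : Monotone (distFun g) := fun u v huv => by
  have := hg.distFun_sub huv
  have h2 : 0 ≤ ∫ w in Set.Ioc u v, g w := integral_nonneg fun w => hg.nonneg w
  linarith

lemma continuous_distFun (hg : IsSlice R g) : Continuous (distFun g) := by
  have h : ∀ u, distFun g u = distFun g 0 + ∫ w in (0 : ℝ)..u, g w := fun u => by
    rw [← intervalIntegral.integral_Iic_sub_Iic hg.integrable.integrableOn
      hg.integrable.integrableOn]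
    simp [distFun]
  rw [funext h]
  exact continuous_const.add
    (intervalIntegral.continuous_primitive (fun a b => hg.integrable.intervalIntegrable) 0)

lemma distFun_nonneg (hg : IsSlice R g) (u : ℝ) : 0 ≤ distFun g u :=
  integral_nonneg fun w => hg.nonneg w

lemma distFun_of_le (_hg : IsSlice R g) {a u : ℝ} (ha : Function.support g ⊆ Set.Ici a)
    (hu : u ≤ a) : distFun g u = 0 := by
  have h1 : distFun g u = ∫ v in Set.Iio u, g v := integral_Iic_eq_integral_Iio
  rw [h1]
  refine setIntegral_eq_zero_of_forall_eq_zero fun v hv => ?_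
  by_contra h
  exact absurd (ha h) (by simpa using lt_of_lt_of_le hv hu)

lemma distFun_of_ge (hg : IsSlice R g) {b u : ℝ} (hb : Function.support g ⊆ Set.Iic b)
    (hu : b ≤ u) : distFun g u = 1 := by
  rw [distFun, setIntegral_eq_integral_of_forall_compl_eq_zero, hg.integral_one]
  intro v hv
  by_contra h
  exact hv (le_trans (hb h) hu)

lemma distFun_le_one (hg : IsSlice R g) (u : ℝ) : distFun g u ≤ 1 := by
  rw [← hg.integral_one]
  exact setIntegral_le_integral hg.integrable (ae_of_all _ hg.nonneg)

lemma support_Ici (hg : IsSlice R g) : Function.support g ⊆ Set.Ici (-R) :=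
  fun _ hu => (hg.support_subset hu).1

lemma support_Iic (hg : IsSlice R g) : Function.support g ⊆ Set.Iic R :=
  fun _ hu => (hg.support_subset hu).2

lemma radius_nonneg (hg : IsSlice R g) : 0 ≤ R := by
  by_contra h
  have h0 : g = 0 := by
    rw [← Function.support_eq_empty_iff, ← Set.subset_empty_iff]
    exact hg.support_subset.trans (by rw [Set.Icc_eq_empty (by linarith)])
  have := hg.integral_one
  simp [h0] at this

/-- Continuity of `distFun g` makes the superlevel set closed, so its infimum is attained; `0 < s`
bounds that set below and `s ≤ 1` makes it nonempty. -/
lemma quantile_le_iff (hg : IsSlice R g) {s : ℝ} (h0 : 0 < s) (h1 : s ≤ 1) (u : ℝ) :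
    quantile g s ≤ u ↔ s ≤ distFun g u := by
  have hbdd : BddBelow {u : ℝ | s ≤ distFun g u} := by
    refine ⟨-R, fun v hv => ?_⟩
    by_contra hlt
    have := hg.distFun_of_le hg.support_Ici (not_le.1 hlt).le
    have hv' : s ≤ distFun g v := hv
    linarith
  have hne : {u : ℝ | s ≤ distFun g u}.Nonempty :=
    ⟨R, by simpa [hg.distFun_of_ge hg.support_Iic le_rfl] using h1⟩
  have hcl : IsClosed {u : ℝ | s ≤ distFun g u} :=
    isClosed_le continuous_const hg.continuous_distFun
  constructor
  · intro h
    exact le_trans (hcl.csInf_mem hne hbdd) (hg.monotone_distFun h)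
  · intro h
    exact csInf_le hbdd h

lemma quantile_le (hg : IsSlice R g) {s : ℝ} (h0 : 0 < s) (h1 : s ≤ 1) {b : ℝ}
    (hb : Function.support g ⊆ Set.Iic b) : quantile g s ≤ b := by
  rw [hg.quantile_le_iff h0 h1, hg.distFun_of_ge hb le_rfl]
  exact h1

lemma le_quantile (hg : IsSlice R g) {s : ℝ} (h0 : 0 < s) (h1 : s ≤ 1) {a : ℝ}
    (ha : Function.support g ⊆ Set.Ici a) : a ≤ quantile g s := by
  by_contra h
  have h2 := (hg.quantile_le_iff h0 h1 _).1 le_rfl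
  rw [hg.distFun_of_le ha (not_le.1 h).le] at h2
  linarith

lemma abs_quantile_le (hg : IsSlice R g) {s : ℝ} (h0 : 0 < s) (h1 : s ≤ 1) :
    |quantile g s| ≤ R :=
  abs_le.2 ⟨hg.le_quantile h0 h1 hg.support_Ici, hg.quantile_le h0 h1 hg.support_Iic⟩

lemma distFun_quantile (hg : IsSlice R g) {s : ℝ} (h0 : 0 < s) (h1 : s ≤ 1) :
    distFun g (quantile g s) = s := by
  refine le_antisymm ?_ ((hg.quantile_le_iff h0 h1 _).1 le_rfl)
  by_contra h
  have hev : ∀ᶠ u in 𝓝[<] quantile g s, s < distFun g u :=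
    (hg.continuous_distFun.continuousAt.eventually_const_lt (not_le.1 h)).filter_mono
      nhdsWithin_le_nhds
  obtain ⟨u, hu, hlt⟩ := (hev.and self_mem_nhdsWithin).exists
  exact absurd ((hg.quantile_le_iff h0 h1 u).2 hu.le) (not_le.2 hlt)

lemma abs_distFun_sub_le (h₁ : IsSlice R g₁) (h₂ : IsSlice R g₂) (u : ℝ) :
    |distFun g₁ u - distFun g₂ u| ≤ ∫ v, |g₁ v - g₂ v| := by
  rw [distFun, distFun, ← integral_sub h₁.integrable.integrableOn h₂.integrable.integrableOn]
  refine (abs_integral_le_integral_abs).trans ?_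
  exact setIntegral_le_integral (h₁.integrable.sub h₂.integrable).abs
    (ae_of_all _ fun _ => abs_nonneg _)

/-- If the distribution functions differed at u, every level s strictly between the two values would
separate the quantiles: one is at most u, the other exceeds u. Such levels have positive length.
Equal distribution functions then give equal measures, hence densities equal almost everywhere. -/
lemma ae_eq_of_quantile_ae_eq (h₁ : IsSlice R g₁) (h₂ : IsSlice R g₂)
    (h : ∀ᵐ s ∂volume.restrict (Set.Icc (0 : ℝ) 1), quantile g₁ s = quantile g₂ s) :
    g₁ =ᵐ[volume] g₂ := by
  have hD : ∀ u, distFun g₁ u = distFun g₂ u := by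
    have key : ∀ {g₁ g₂ : ℝ → ℝ}, IsSlice R g₁ → IsSlice R g₂ →
        (∀ᵐ s ∂volume.restrict (Set.Icc (0 : ℝ) 1), quantile g₁ s = quantile g₂ s) →
        ∀ u, distFun g₁ u ≤ distFun g₂ u := by
      intro g₁ g₂ h₁ h₂ h u
      by_contra hlt
      rw [not_le] at hlt
      have hsub : Set.Ioc (distFun g₂ u) (distFun g₁ u) ⊆ Set.Icc 0 1 := fun s hs =>
        ⟨(h₂.distFun_nonneg u).trans hs.1.le, hs.2.trans (h₁.distFun_le_one u)⟩
      have h' := ae_restrict_of_ae_restrict_of_subset hsub h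
      have hne : volume.restrict (Set.Ioc (distFun g₂ u) (distFun g₁ u)) ≠ 0 := by
        rw [Ne, Measure.restrict_eq_zero, Real.volume_Ioc]
        simpa using hlt
      have : (ae (volume.restrict (Set.Ioc (distFun g₂ u) (distFun g₁ u)))).NeBot :=
        ae_neBot.2 hne
      obtain ⟨s, hs, hsm⟩ := (h'.and (ae_restrict_mem measurableSet_Ioc)).exists
      have hs0 : 0 < s := (h₂.distFun_nonneg u).trans_lt hsm.1
      have hs1 : s ≤ 1 := (hsub hsm).2
      have h3 := (h₁.quantile_le_iff hs0 hs1 u).2 hsm.2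
      rw [hs, h₂.quantile_le_iff hs0 hs1] at h3
      exact absurd hsm.1 (not_lt.2 h3)
    exact fun u => le_antisymm (key h₁ h₂ h u) (key h₂ h₁ (h.mono fun _ hs => hs.symm) u)
  have hfin : ∀ {g}, IsSlice R g →
      IsFiniteMeasure (volume.withDensity fun v => ENNReal.ofReal (g v)) := fun hg =>
    isFiniteMeasure_withDensity_ofReal hg.integrable.2
  have := hfin h₁
  have := hfin h₂
  have hmeas : (volume.withDensity fun v => ENNReal.ofReal (g₁ v)) =
      volume.withDensity fun v => ENNReal.ofReal (g₂ v) := by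
    refine Measure.ext_of_Iic _ _ fun u => ?_
    have hval : ∀ {g}, IsSlice R g → (volume.withDensity fun v => ENNReal.ofReal (g v)) (Set.Iic u) =
        ENNReal.ofReal (distFun g u) := fun hg => by
      rw [withDensity_apply _ measurableSet_Iic, distFun,
        ofReal_integral_eq_lintegral_ofReal hg.integrable.integrableOn (ae_of_all _ hg.nonneg)]
    rw [hval h₁, hval h₂, hD]
  rw [withDensity_eq_iff_of_sigmaFinite h₁.integrable.1.aemeasurable.ennreal_ofReal
    h₂.integrable.1.aemeasurable.ennreal_ofReal] at hmeas
  filter_upwards [hmeas] with v hv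
  exact (ENNReal.ofReal_eq_ofReal_iff (h₁.nonneg v) (h₂.nonneg v)).1 hv

/-- The `L¹` distance of the quantile functions is bounded through that of the densities. -/
lemma lintegral_quantile_sub_le (h₁ : IsSlice R g₁) (h₂ : IsSlice R g₂) :
    ∫⁻ s in Set.Icc (0 : ℝ) 1, ENNReal.ofReal |quantile g₁ s - quantile g₂ s| ≤
      ENNReal.ofReal (2 * R * ∫ v, |g₁ v - g₂ v|) := by
  set G₁ := distFun g₁
  set G₂ := distFun g₂
  set δ := ∫ v, |g₁ v - g₂ v|
  -- The region between the graphs of the two distribution functions. Its section at level s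
  -- contains an interval as long as the gap between the quantiles; its section at u has length |G₁
  -- u − G₂ u| ≤ δ. Tonelli compares the two.
  let S : Set (ℝ × ℝ) := {y | y.2 ∈ Set.Icc (-R) R ∧
    y.1 ∈ Set.Ioc (min (G₁ y.2) (G₂ y.2)) (max (G₁ y.2) (G₂ y.2))}
  have hc₁ := h₁.continuous_distFun.measurable
  have hc₂ := h₂.continuous_distFun.measurable
  have hS : MeasurableSet S := by
    refine (measurable_snd measurableSet_Icc).inter ?_
    refine MeasurableSet.inter (measurableSet_lt ?_ measurable_fst)
      (measurableSet_le measurable_fst ?_)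
    · exact (hc₁.comp measurable_snd).min (hc₂.comp measurable_snd)
    · exact (hc₁.comp measurable_snd).max (hc₂.comp measurable_snd)
  have h1 : ∀ s ∈ Set.Ioc (0 : ℝ) 1, ENNReal.ofReal |quantile g₁ s - quantile g₂ s| ≤
      ∫⁻ u, S.indicator 1 (s, u) := by
    intro s hs
    have hind : ∀ u, S.indicator (1 : ℝ × ℝ → ℝ≥0∞) (s, u) =
        Set.indicator {u | (s, u) ∈ S} 1 u := fun u => rfl
    simp_rw [hind]
    rw [lintegral_indicator_one (show MeasurableSet {u | (s, u) ∈ S} from measurable_prodMk_left hS)]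
    have hsub : Set.Ico (min (quantile g₁ s) (quantile g₂ s))
        (max (quantile g₁ s) (quantile g₂ s)) ⊆ {u | (s, u) ∈ S} := by
      intro u hu
      obtain ⟨hu1, hu2⟩ := hu
      have hq₁ := abs_le.1 (h₁.abs_quantile_le hs.1 hs.2)
      have hq₂ := abs_le.1 (h₂.abs_quantile_le hs.1 hs.2)
      refine ⟨⟨le_trans (le_min hq₁.1 hq₂.1) hu1, (hu2.le.trans (max_le hq₁.2 hq₂.2))⟩, ?_, ?_⟩
      · rcases lt_max_iff.1 hu2 with h | h
        · exact min_lt_of_left_lt (by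
            by_contra hh
            exact absurd ((h₁.quantile_le_iff hs.1 hs.2 u).2 (not_lt.1 hh)) (not_le.2 h))
        · exact min_lt_of_right_lt (by
            by_contra hh
            exact absurd ((h₂.quantile_le_iff hs.1 hs.2 u).2 (not_lt.1 hh)) (not_le.2 h))
      · rcases min_le_iff.1 hu1 with h | h
        · exact le_max_of_le_left ((h₁.quantile_le_iff hs.1 hs.2 u).1 h)
        · exact le_max_of_le_right ((h₂.quantile_le_iff hs.1 hs.2 u).1 h)
    refine le_trans (le_of_eq ?_) (measure_mono hsub)
    rw [Real.volume_Ico, max_sub_min_eq_abs, abs_sub_comm]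
  calc ∫⁻ s in Set.Icc (0 : ℝ) 1, ENNReal.ofReal |quantile g₁ s - quantile g₂ s|
      = ∫⁻ s in Set.Ioc (0 : ℝ) 1, ENNReal.ofReal |quantile g₁ s - quantile g₂ s| := by
        rw [restrict_Ioc_eq_restrict_Icc]
    _ ≤ ∫⁻ s in Set.Ioc (0 : ℝ) 1, ∫⁻ u, S.indicator 1 (s, u) :=
        setLIntegral_mono' measurableSet_Ioc h1
    _ ≤ ∫⁻ s, ∫⁻ u, S.indicator 1 (s, u) := setLIntegral_le_lintegral _ _
    _ = ∫⁻ u, ∫⁻ s, S.indicator 1 (s, u) :=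
        lintegral_lintegral_swap (measurable_one.indicator hS).aemeasurable
    _ ≤ ∫⁻ u, (Set.Icc (-R) R).indicator (fun _ => ENNReal.ofReal δ) u := by
        refine lintegral_mono fun u => ?_
        by_cases hu : u ∈ Set.Icc (-R) R
        · rw [Set.indicator_of_mem hu]
          have hind : ∀ s, S.indicator (1 : ℝ × ℝ → ℝ≥0∞) (s, u) =
            Set.indicator {s | (s, u) ∈ S} 1 s := fun s => rfl
          simp_rw [hind]
          rw [lintegral_indicator_one (show MeasurableSet {s | (s, u) ∈ S} from measurable_prodMk_right hS)]
          refine (measure_mono (t := Set.Ioc (min (G₁ u) (G₂ u)) (max (G₁ u) (G₂ u)))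
            fun s hs => hs.2).trans ?_
          rw [Real.volume_Ioc, max_sub_min_eq_abs, abs_sub_comm]
          exact ENNReal.ofReal_le_ofReal (h₁.abs_distFun_sub_le h₂ u)
        · have : ∀ s, S.indicator (1 : ℝ × ℝ → ℝ≥0∞) (s, u) = 0 := fun s =>
            Set.indicator_of_notMem (fun h => hu h.1) _
          simp [this]
    _ = ENNReal.ofReal (2 * R * δ) := by
        rw [lintegral_indicator_const measurableSet_Icc, Real.volume_Icc,
          ← ENNReal.ofReal_mul (integral_nonneg fun _ => abs_nonneg _)]
        congr 1
        ring

lemma sub_le_of_bounds {a b M : ℝ} (hM : 0 < M) (hg : IsSlice R g)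
    (hb : ∀ u ∈ Set.Icc a b, 1 / M ≤ g u) {u v : ℝ} (hu : a ≤ u) (huv : u ≤ v) (hv : v ≤ b) :
    v - u ≤ M * (distFun g v - distFun g u) := by
  rw [hg.distFun_sub huv]
  have h1 : ∫ _ in Set.Ioc u v, 1 / M ≤ ∫ w in Set.Ioc u v, g w := by
    refine setIntegral_mono_on (by simp) hg.integrable.integrableOn
      measurableSet_Ioc fun w hw => hb w ⟨hu.trans hw.1.le, hw.2.trans hv⟩
  rw [setIntegral_const, measureReal_def, Real.volume_Ioc, ENNReal.toReal_ofReal (by linarith),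
    smul_eq_mul] at h1
  calc v - u = M * ((v - u) * (1 / M)) := by field_simp
    _ ≤ _ := by gcongr

/-- On a support interval the distribution function increases at rate at least 1/M, so a gap of
quantiles inside one support costs at most M δ. The supports may differ, and the term 2R is needed
only when they are disjoint. -/
lemma quantile_sub_le_of_bounds {a₁ b₁ a₂ b₂ M : ℝ} (hM : 0 < M)
    (h₁ : IsSlice R g₁) (h₂ : IsSlice R g₂)
    (hs₁ : Function.support g₁ = Set.Icc a₁ b₁) (hs₂ : Function.support g₂ = Set.Icc a₂ b₂)
    (hb₁ : ∀ u ∈ Set.Icc a₁ b₁, 1 / M ≤ g₁ u) (hb₂ : ∀ u ∈ Set.Icc a₂ b₂, 1 / M ≤ g₂ u)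
    {s δ : ℝ} (h0 : 0 < s) (h1 : s ≤ 1) (hδ : ∀ u, |distFun g₁ u - distFun g₂ u| ≤ δ) :
    quantile g₁ s - quantile g₂ s ≤ (M + 2 * R) * δ := by
  have hR := h₁.radius_nonneg
  set t := quantile g₁ s with ht
  set u := quantile g₂ s with hu
  have hδ0 : 0 ≤ δ := (abs_nonneg _).trans (hδ 0)
  have ht1 : distFun g₁ t = s := h₁.distFun_quantile h0 h1
  have hu1 : distFun g₂ u = s := h₂.distFun_quantile h0 h1
  have hA₁ : Function.support g₁ ⊆ Set.Ici a₁ := hs₁ ▸ Set.Icc_subset_Ici_self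
  have hB₁ : Function.support g₁ ⊆ Set.Iic b₁ := hs₁ ▸ Set.Icc_subset_Iic_self
  have hA₂ : Function.support g₂ ⊆ Set.Ici a₂ := hs₂ ▸ Set.Icc_subset_Ici_self
  have hB₂ : Function.support g₂ ⊆ Set.Iic b₂ := hs₂ ▸ Set.Icc_subset_Iic_self
  have hta : a₁ ≤ t := h₁.le_quantile h0 h1 hA₁
  have htb : t ≤ b₁ := h₁.quantile_le h0 h1 hB₁
  have hua : a₂ ≤ u := h₂.le_quantile h0 h1 hA₂
  have hub : u ≤ b₂ := h₂.quantile_le h0 h1 hB₂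
  have hMR : M * δ ≤ (M + 2 * R) * δ := by nlinarith [mul_nonneg hR hδ0]
  rcases le_or_gt t u with htu | hut
  · nlinarith [mul_nonneg hR hδ0, mul_nonneg hM.le hδ0]
  by_cases c1 : t ≤ b₂
  · have h3 := h₂.sub_le_of_bounds hM hb₂ hua hut.le c1
    have h4 := abs_le.1 (hδ t)
    have : M * (distFun g₂ t - distFun g₂ u) ≤ M * δ := by gcongr; linarith
    linarith
  by_cases c2 : a₁ ≤ u
  · have h3 := h₁.sub_le_of_bounds hM hb₁ c2 hut.le htb
    have h4 := abs_le.1 (hδ u)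
    have : M * (distFun g₁ t - distFun g₁ u) ≤ M * δ := by gcongr; linarith
    linarith
  push Not at c1 c2
  -- Neither support contains both quantiles: `u < a₁` and `b₂ < t`. If the supports overlap, the
  -- path from u to t is cut at `a₁`; the density `g₂` controls the first piece and `g₁` the second,
  -- and the increments add up to `distFun g₂ a₁`, which is at most δ because `distFun g₁ a₁ = 0`.
  rcases le_or_gt a₁ b₂ with c3 | c3
  · have h3 := h₂.sub_le_of_bounds hM hb₂ hua c2.le c3
    have h4 := h₁.sub_le_of_bounds hM hb₁ le_rfl hta htb
    have h5 := h₁.distFun_of_le hA₁ (le_refl a₁)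
    have h6 := abs_le.1 (hδ a₁)
    have : M * (distFun g₂ a₁ - distFun g₂ u) + M * (distFun g₁ t - distFun g₁ a₁) ≤ M * δ := by
      rw [← mul_add]; gcongr; linarith
    linarith
  -- With disjoint supports the distribution functions differ by 1 at `b₂`, so `1 ≤ δ` and the
  -- trivial bound 2R is enough.
  · have h5 := h₁.distFun_of_le hA₁ c3.le
    have h6 := h₂.distFun_of_ge hB₂ (le_refl b₂)
    have h7 := abs_le.1 (hδ b₂)
    have h8 : 1 ≤ δ := by linarith
    have hq₁ := abs_le.1 (h₁.abs_quantile_le h0 h1)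
    have hq₂ := abs_le.1 (h₂.abs_quantile_le h0 h1)
    nlinarith

lemma abs_quantile_sub_le_of_bounds {a₁ b₁ a₂ b₂ M : ℝ} (hM : 0 < M)
    (h₁ : IsSlice R g₁) (h₂ : IsSlice R g₂)
    (hs₁ : Function.support g₁ = Set.Icc a₁ b₁) (hs₂ : Function.support g₂ = Set.Icc a₂ b₂)
    (hb₁ : ∀ u ∈ Set.Icc a₁ b₁, 1 / M ≤ g₁ u) (hb₂ : ∀ u ∈ Set.Icc a₂ b₂, 1 / M ≤ g₂ u)
    {s : ℝ} (h0 : 0 < s) (h1 : s ≤ 1) :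
    |quantile g₁ s - quantile g₂ s| ≤ (M + 2 * R) * ∫ v, |g₁ v - g₂ v| := by
  have hδ := h₁.abs_distFun_sub_le h₂
  refine abs_le.2 ⟨?_, h₁.quantile_sub_le_of_bounds hM h₂ hs₁ hs₂ hb₁ hb₂ h0 h1 hδ⟩
  have := h₂.quantile_sub_le_of_bounds hM h₁ hs₂ hs₁ hb₂ hb₁ h0 h1
    (fun u => (abs_sub_comm _ _).trans_le (hδ u))
  linarith

/-- Cauchy–Schwarz for two slices. -/
lemma integral_abs_sub_le (h₁ : IsSlice R g₁) (h₂ : IsSlice R g₂) :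
    ENNReal.ofReal (∫ v, |g₁ v - g₂ v|) ≤
      eLpNorm (g₁ - g₂) 2 volume * ENNReal.ofReal (2 * R) ^ (1 / 2 : ℝ) := by
  have hsupp : ∀ v, v ∉ Set.Icc (-R) R → (g₁ - g₂) v = 0 := fun v hv => by
    have e₁ : g₁ v = 0 := by by_contra h; exact hv (h₁.support_subset h)
    have e₂ : g₂ v = 0 := by by_contra h; exact hv (h₂.support_subset h)
    simp [e₁, e₂]
  have hI := h₁.integrable.sub h₂.integrable
  have e1 : ENNReal.ofReal (∫ v, |g₁ v - g₂ v|) = eLpNorm (g₁ - g₂) 1 (volume.restrict (Set.Icc (-R) R)) := by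
    rw [← eLpNorm_indicator_eq_eLpNorm_restrict measurableSet_Icc]
    have : (Set.Icc (-R) R).indicator (g₁ - g₂) = g₁ - g₂ := by
      rw [Set.indicator_eq_self]
      intro v hv
      by_contra h
      exact hv (hsupp v h)
    rw [this, eLpNorm_one_eq_lintegral_enorm]
    refine (ofReal_integral_eq_lintegral_ofReal hI.abs
      (ae_of_all _ fun _ => abs_nonneg _)).trans (lintegral_congr fun v => ?_)
    rw [Real.enorm_eq_ofReal_abs]
  rw [e1]
  refine (eLpNorm_le_eLpNorm_mul_rpow_measure_univ (p := 1) (q := 2) (by norm_num)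
    hI.1.restrict).trans ?_
  rw [Measure.restrict_apply_univ, Real.volume_Icc]
  refine mul_le_mul' (eLpNorm_restrict_le _ _ _ _) (le_of_eq ?_)
  congr 1
  · ring_nf
  · norm_num

end IsSlice

/-! ### The quantile embedding of a class of densities into `L²` -/

instance {p : ℕ} : IsFiniteMeasure (sphereMeasure p) := by
  unfold sphereMeasure; infer_instance

instance {p : ℕ} : IsFiniteMeasure (quantileMeasure p) := by
  unfold quantileMeasure; infer_instance

/-- All slices of the class `S` are probability densities supported in `[-R, R]`, and the slices
depend measurably on the direction. -/
structure SlicesIn {p : ℕ} (ψ : Transform p) (S : Set (Euc p → ℝ)) (R : ℝ) : Prop where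
  isSlice : ∀ f ∈ S, ∀ θ, IsSlice R (ψ f θ)
  aestronglyMeasurable : ∀ f ∈ S, AEStronglyMeasurable (fun y : Theta p × ℝ => ψ f y.1 y.2)
    ((sphereMeasure p).prod volume)

lemma IsSlicingOn.exists_slicesIn {p : ℕ} {ψ : Transform p} {S : Set (Euc p → ℝ)}
    (h : IsSlicingOn ψ S) : ∃ R, 0 ≤ R ∧ SlicesIn ψ S R := by
  obtain ⟨R, hR⟩ := h.bounded
  refine ⟨|R|, abs_nonneg R, fun f hf θ => ⟨h.nonneg f hf θ, h.integrable f hf θ,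
    h.integral_one f hf θ, (hR f hf θ).trans ?_⟩, fun f hf => (h.memLp f hf).1⟩
  exact Set.Icc_subset_Icc (neg_le_neg (le_abs_self R)) (le_abs_self R)

/-- The quantile function family as an element of `L²(Θ × [0,1])`. -/
def quantileEmb {p : ℕ} (ψ : Transform p) (f : Euc p → ℝ) : Lp ℝ 2 (quantileMeasure p) :=
  open Classical in
  -- The value 0 is never met on a class with `SlicesIn`, by `SlicesIn.memLp_psiTilde`.
  if h : MemLp (psiTilde ψ f) 2 (quantileMeasure p) then h.toLp else 0

/-- Level 0 has to be discarded: there the defining set is the whole line and `sInf` takes its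
default value. -/
lemma ae_quantileMeasure {p : ℕ} : ∀ᵐ y ∂quantileMeasure p, 0 < y.2 ∧ y.2 ≤ 1 := by
  have h : ∀ᵐ s ∂(volume.restrict (Set.Icc (0 : ℝ) 1)), 0 < s ∧ s ≤ 1 := by
    rw [← restrict_Ioc_eq_restrict_Icc]
    exact ae_restrict_mem measurableSet_Ioc
  exact Measure.quasiMeasurePreserving_snd.ae h

namespace SlicesIn

variable {p : ℕ} {ψ : Transform p} {S : Set (Euc p → ℝ)} {R : ℝ} {f f₁ f₂ : Euc p → ℝ}

/-- The sublevel set at u is {s ≤ distribution function at u}, so joint measurability of the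
distribution functions suffices. The slices are only almost everywhere equal to a jointly measurable
version, whence null measurability first. -/
lemma aemeasurable_psiTilde (h : SlicesIn ψ S R) (hf : f ∈ S) :
    AEMeasurable (psiTilde ψ f) (quantileMeasure p) := by
  have hm := h.aestronglyMeasurable f hf
  set φ := hm.mk _ with hφ
  have hφm : StronglyMeasurable φ := hm.stronglyMeasurable_mk
  have hae : ∀ᵐ θ ∂sphereMeasure p, ψ f θ =ᵐ[volume] fun u => φ (θ, u) :=
    Measure.ae_ae_of_ae_prod hm.ae_eq_mk
  have hG : Measurable fun y : Theta p × ℝ => ∫ v, (Set.Iic y.2).indicator (fun v => φ (y.1, v)) v := by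
    have h0 : StronglyMeasurable fun x : (Theta p × ℝ) × ℝ =>
        {x : (Theta p × ℝ) × ℝ | x.2 ≤ x.1.2}.indicator (fun x => φ (x.1.1, x.2)) x := by
      refine StronglyMeasurable.indicator ?_ ?_
      · exact hφm.comp_measurable ((measurable_fst.comp measurable_fst).prodMk measurable_snd)
      · exact measurableSet_le measurable_snd (measurable_snd.comp measurable_fst)
    exact (h0.integral_prod_right' (ν := volume)).measurable
  have hGeq : ∀ θ u, ∫ v, (Set.Iic u).indicator (fun v => φ (θ, v)) v =
      distFun (fun v => φ (θ, v)) u := fun θ u => integral_indicator measurableSet_Iic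
  have hnull : NullMeasurable (psiTilde ψ f) (quantileMeasure p) := by
    refine @measurable_of_Iic ℝ (NullMeasurableSpace _ (quantileMeasure p)) _ _ _ _ _ _ _ _
      fun u => ?_
    have hset : MeasurableSet {y : Theta p × ℝ | y.2 ≤
        ∫ v, (Set.Iic u).indicator (fun v => φ (y.1, v)) v} :=
      measurableSet_le measurable_snd
        (hG.comp (measurable_fst.prodMk measurable_const) :)
    refine NullMeasurableSet.congr (μ := quantileMeasure p) hset.nullMeasurableSet ?_
    have hae' : ∀ᵐ y ∂quantileMeasure p, ψ f y.1 =ᵐ[volume] fun u => φ (y.1, u) :=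
      Measure.quasiMeasurePreserving_fst.ae hae
    filter_upwards [hae', ae_quantileMeasure] with y hy hy01
    apply propext
    change y.2 ≤ _ ↔ psiTilde ψ f y ≤ u
    rw [hGeq, ← distFun_congr hy]
    exact ((h.isSlice f hf y.1).quantile_le_iff hy01.1 hy01.2 u).symm
  exact (aestronglyMeasurable_iff_nullMeasurable_separable.2 ⟨hnull, Set.univ,
    .of_separableSpace _, ae_of_all _ fun _ => Set.mem_univ _⟩).aemeasurable

lemma ae_abs_psiTilde_le (h : SlicesIn ψ S R) (hf : f ∈ S) :
    ∀ᵐ y ∂quantileMeasure p, ‖psiTilde ψ f y‖ ≤ R := by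
  filter_upwards [ae_quantileMeasure] with y hy
  exact (h.isSlice f hf y.1).abs_quantile_le hy.1 hy.2

lemma memLp_psiTilde (h : SlicesIn ψ S R) (hf : f ∈ S) :
    MemLp (psiTilde ψ f) 2 (quantileMeasure p) :=
  MemLp.of_bound (h.aemeasurable_psiTilde hf).aestronglyMeasurable R (h.ae_abs_psiTilde_le hf)

lemma coeFn_quantileEmb (h : SlicesIn ψ S R) (hf : f ∈ S) :
    (quantileEmb ψ f : Theta p × ℝ → ℝ) =ᵐ[quantileMeasure p] psiTilde ψ f := by
  rw [quantileEmb, dif_pos (h.memLp_psiTilde hf)]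
  exact MemLp.coeFn_toLp _

lemma quantileImage_eq (h : SlicesIn ψ S R) : quantileImage ψ S = quantileEmb ψ '' S := by
  ext γ
  constructor
  · rintro ⟨f, hf, he⟩
    exact ⟨f, hf, Lp.ext ((h.coeFn_quantileEmb hf).trans he.symm)⟩
  · rintro ⟨f, hf, rfl⟩
    exact ⟨f, hf, h.coeFn_quantileEmb hf⟩

/-- Two classes are allowed because estimated densities lie outside F but are compared with its
members. -/
lemma dSW_eq_norm {S₁ S₂ : Set (Euc p → ℝ)} {R₁ R₂ : ℝ} (h₁ : SlicesIn ψ S₁ R₁)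
    (h₂ : SlicesIn ψ S₂ R₂) (hf₁ : f₁ ∈ S₁) (hf₂ : f₂ ∈ S₂) :
    dSW ψ f₁ f₂ = ‖quantileEmb ψ f₁ - quantileEmb ψ f₂‖ := by
  rw [dSW, ← Real.sqrt_sq (norm_nonneg (quantileEmb ψ f₁ - quantileEmb ψ f₂)),
    ← real_inner_self_eq_norm_sq, L2.inner_def]
  congr 1
  refine integral_congr_ae ?_
  filter_upwards [h₁.coeFn_quantileEmb hf₁, h₂.coeFn_quantileEmb hf₂,
    Lp.coeFn_sub (quantileEmb ψ f₁) (quantileEmb ψ f₂)] with y hy₁ hy₂ hy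
  rw [hy, Pi.sub_apply, hy₁, hy₂, real_inner_self_eq_norm_sq, Real.norm_eq_abs, sq_abs]

lemma exists_norm_quantileEmb_le (h : SlicesIn ψ S R) (hR : 0 ≤ R) :
    ∃ K, 0 ≤ K ∧ ∀ f ∈ S, ‖quantileEmb ψ f‖ ≤ K := by
  refine ⟨(quantileMeasure p).real Set.univ ^ (ENNReal.toReal 2)⁻¹ * R, by positivity,
    fun f hf => ?_⟩
  refine Lp.norm_le_of_ae_bound hR ?_
  filter_upwards [h.coeFn_quantileEmb hf, h.ae_abs_psiTilde_le hf] with y hy hy'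
  rwa [hy]

lemma quantileEmb_injOn (h : SlicesIn ψ S R) (hT0 : T0 ψ S) : Set.InjOn (quantileEmb ψ) S := by
  intro f₁ hf₁ f₂ hf₂ he
  refine hT0 f₁ hf₁ f₂ hf₂ ?_
  have hae : psiTilde ψ f₁ =ᵐ[quantileMeasure p] psiTilde ψ f₂ :=
    (h.coeFn_quantileEmb hf₁).symm.trans (he ▸ h.coeFn_quantileEmb hf₂)
  filter_upwards [Measure.ae_ae_of_ae_prod hae] with θ hθ
  exact (h.isSlice f₁ hf₁ θ).ae_eq_of_quantile_ae_eq (h.isSlice f₂ hf₂ θ) hθ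

/-- A bound valid in every direction is integrated over the sphere, which has finite measure. -/
lemma ofReal_norm_sq_le (h : SlicesIn ψ S R) (hf₁ : f₁ ∈ S) (hf₂ : f₂ ∈ S) {c : ℝ≥0∞}
    (hc : ∀ θ, ∫⁻ s in Set.Icc (0 : ℝ) 1,
      ENNReal.ofReal ((quantile (ψ f₁ θ) s - quantile (ψ f₂ θ) s) ^ 2) ≤ c) :
    ENNReal.ofReal (‖quantileEmb ψ f₁ - quantileEmb ψ f₂‖ ^ 2) ≤
      c * sphereMeasure p Set.univ := by
  rw [← h.dSW_eq_norm h hf₁ hf₂, dSW, Real.sq_sqrt (integral_nonneg fun _ => sq_nonneg _)]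
  have hm := (h.memLp_psiTilde hf₁).sub (h.memLp_psiTilde hf₂)
  rw [ofReal_integral_eq_lintegral_ofReal (by simpa using hm.integrable_sq)
    (ae_of_all _ fun _ => sq_nonneg _), quantileMeasure, lintegral_prod]
  · calc _ ≤ ∫⁻ _, c ∂sphereMeasure p := lintegral_mono hc
      _ = _ := lintegral_const c
  · exact (hm.1.aemeasurable.pow_const 2).ennreal_ofReal

/-- Without lower bounds on the slices only the L¹ distance of quantiles is controlled. Bounding one
factor of the square by 2R gives Hölder continuity of order 1/2, which is all that the measurability
of the embedding requires. -/
lemma exists_holder (h : SlicesIn ψ S R) (hT1 : T1 ψ S) :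
    ∃ K : ℝ, 0 ≤ K ∧ ∀ f₁ ∈ S, ∀ f₂ ∈ S,
      ENNReal.ofReal (‖quantileEmb ψ f₁ - quantileEmb ψ f₂‖ ^ 2) ≤
        ENNReal.ofReal K * eLpNorm (f₁ - f₂) 2 volume := by
  obtain ⟨C₀, hC₀⟩ := hT1
  let K : ℝ≥0∞ := ENNReal.ofReal (2 * R) * (ENNReal.ofReal (2 * R) *
    (ENNReal.ofReal C₀ * ENNReal.ofReal (2 * R) ^ (1 / 2 : ℝ))) * sphereMeasure p Set.univ
  have hK : K ≠ ∞ := by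
    refine ENNReal.mul_ne_top (ENNReal.mul_ne_top ENNReal.ofReal_ne_top (ENNReal.mul_ne_top ENNReal.ofReal_ne_top
      (ENNReal.mul_ne_top ENNReal.ofReal_ne_top ?_))) (measure_ne_top _ _)
    exact ENNReal.rpow_ne_top_of_nonneg (by norm_num) ENNReal.ofReal_ne_top
  refine ⟨K.toReal, ENNReal.toReal_nonneg, fun f₁ hf₁ f₂ hf₂ => ?_⟩
  rw [ENNReal.ofReal_toReal hK]
  refine (h.ofReal_norm_sq_le hf₁ hf₂ (c := ENNReal.ofReal (2 * R) * (ENNReal.ofReal (2 * R) *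
    (ENNReal.ofReal C₀ * eLpNorm (f₁ - f₂) 2 volume * ENNReal.ofReal (2 * R) ^ (1 / 2 : ℝ))))
    fun θ => ?_).trans (le_of_eq (by simp only [K]; ring))
  have h₁ := h.isSlice f₁ hf₁ θ
  have h₂ := h.isSlice f₂ hf₂ θ
  have hR := h₁.radius_nonneg
  calc ∫⁻ s in Set.Icc (0 : ℝ) 1,
        ENNReal.ofReal ((quantile (ψ f₁ θ) s - quantile (ψ f₂ θ) s) ^ 2)
      ≤ ∫⁻ s in Set.Icc (0 : ℝ) 1, ENNReal.ofReal (2 * R) *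
          ENNReal.ofReal |quantile (ψ f₁ θ) s - quantile (ψ f₂ θ) s| := by
        rw [← restrict_Ioc_eq_restrict_Icc]
        refine setLIntegral_mono' measurableSet_Ioc fun s hs => ?_
        rw [← ENNReal.ofReal_mul (by positivity)]
        refine ENNReal.ofReal_le_ofReal ?_
        rw [← sq_abs, sq]
        have q₁ := abs_le.1 (h₁.abs_quantile_le hs.1 hs.2)
        have q₂ := abs_le.1 (h₂.abs_quantile_le hs.1 hs.2)
        gcongr
        exact abs_le.2 ⟨by linarith, by linarith⟩
    _ = ENNReal.ofReal (2 * R) * ∫⁻ s in Set.Icc (0 : ℝ) 1,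
          ENNReal.ofReal |quantile (ψ f₁ θ) s - quantile (ψ f₂ θ) s| :=
        lintegral_const_mul' _ _ ENNReal.ofReal_ne_top
    _ ≤ ENNReal.ofReal (2 * R) * (ENNReal.ofReal (2 * R) *
          ENNReal.ofReal (∫ v, |ψ f₁ θ v - ψ f₂ θ v|)) := by
        rw [← ENNReal.ofReal_mul (p := 2 * R) (q := ∫ v, |ψ f₁ θ v - ψ f₂ θ v|) (by positivity)]
        gcongr
        exact h₁.lintegral_quantile_sub_le h₂
    _ ≤ _ := by
        gcongr
        refine (h₁.integral_abs_sub_le h₂).trans ?_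
        gcongr
        exact hC₀ f₁ hf₁ f₂ hf₂ θ

/-- The bounds (G1) upgrade the Hölder estimate to a Lipschitz one. This is what turns an integrated
squared density error of order 1/n into a squared embedding error of the same order. -/
lemma exists_lipschitz (h : SlicesIn ψ S R) (hT1 : T1 ψ S) (hG1 : G1bounds ψ S) :
    ∃ K : ℝ, 0 ≤ K ∧ ∀ f₁ ∈ S, ∀ f₂ ∈ S,
      ENNReal.ofReal (‖quantileEmb ψ f₁ - quantileEmb ψ f₂‖ ^ 2) ≤
        ENNReal.ofReal K * eLpNorm (f₁ - f₂) 2 volume ^ 2 := by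
  obtain ⟨C₀, hC₀⟩ := hT1
  obtain ⟨M, hM, hM'⟩ := hG1
  let K : ℝ≥0∞ := (ENNReal.ofReal (M + 2 * R) *
    (ENNReal.ofReal C₀ * ENNReal.ofReal (2 * R) ^ (1 / 2 : ℝ))) ^ 2 * sphereMeasure p Set.univ
  have hK : K ≠ ∞ := by
    refine ENNReal.mul_ne_top (ENNReal.pow_ne_top (ENNReal.mul_ne_top ENNReal.ofReal_ne_top
      (ENNReal.mul_ne_top ENNReal.ofReal_ne_top ?_))) (measure_ne_top _ _)
    exact ENNReal.rpow_ne_top_of_nonneg (by norm_num) ENNReal.ofReal_ne_top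
  refine ⟨K.toReal, ENNReal.toReal_nonneg, fun f₁ hf₁ f₂ hf₂ => ?_⟩
  rw [ENNReal.ofReal_toReal hK]
  refine (h.ofReal_norm_sq_le hf₁ hf₂ (c := (ENNReal.ofReal (M + 2 * R) *
    (ENNReal.ofReal C₀ * eLpNorm (f₁ - f₂) 2 volume * ENNReal.ofReal (2 * R) ^ (1 / 2 : ℝ))) ^ 2)
    fun θ => ?_).trans (le_of_eq (by simp only [K]; ring))
  have h₁ := h.isSlice f₁ hf₁ θ
  have h₂ := h.isSlice f₂ hf₂ θ
  have hR := h₁.radius_nonneg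
  obtain ⟨a₁, b₁, hs₁, hb₁⟩ := hM' f₁ hf₁ θ
  obtain ⟨a₂, b₂, hs₂, hb₂⟩ := hM' f₂ hf₂ θ
  calc ∫⁻ s in Set.Icc (0 : ℝ) 1,
        ENNReal.ofReal ((quantile (ψ f₁ θ) s - quantile (ψ f₂ θ) s) ^ 2)
      ≤ ∫⁻ s in Set.Icc (0 : ℝ) 1, (ENNReal.ofReal (M + 2 * R) *
          ENNReal.ofReal (∫ v, |ψ f₁ θ v - ψ f₂ θ v|)) ^ 2 := by
        rw [← restrict_Ioc_eq_restrict_Icc]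
        refine setLIntegral_mono' measurableSet_Ioc fun s hs => ?_
        rw [← ENNReal.ofReal_mul (by positivity), ← sq_abs, ENNReal.ofReal_pow (abs_nonneg _)]
        gcongr
        exact h₁.abs_quantile_sub_le_of_bounds hM h₂ hs₁ hs₂ (fun u hu => (hb₁ u hu).1)
          (fun u hu => (hb₂ u hu).1) hs.1 hs.2
    _ = (ENNReal.ofReal (M + 2 * R) * ENNReal.ofReal (∫ v, |ψ f₁ θ v - ψ f₂ θ v|)) ^ 2 := by
        simp
    _ ≤ _ := by
        gcongr
        refine (h₁.integral_abs_sub_le h₂).trans ?_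
        gcongr
        exact hC₀ f₁ hf₁ f₂ hf₂ θ

end SlicesIn

/-! ### Measurability of the quantile embedding -/

/-- A uniform distance is at most r as soon as it is on a countable dense set, so closed balls have
measurable preimages; open balls and then open sets are countable unions. -/
lemma measurable_of_measurable_eval {α K : Type*} [MeasurableSpace α] [TopologicalSpace K]
    [CompactSpace K] [SecondCountableTopology K] [T2Space K] [MeasurableSpace C(K, ℝ)]
    [BorelSpace C(K, ℝ)]
    {J : α → C(K, ℝ)} (hJ : ∀ z, Measurable fun a => J a z) : Measurable J := by
  have hball : ∀ (φ : C(K, ℝ)) (r : ℝ), 0 ≤ r → MeasurableSet (J ⁻¹' Metric.closedBall φ r) := by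
    intro φ r hr
    obtain ⟨s, hsc, hsd⟩ := TopologicalSpace.exists_countable_dense K
    have : J ⁻¹' Metric.closedBall φ r = ⋂ z ∈ s, {a | dist (J a z) (φ z) ≤ r} := by
      ext a
      simp only [Set.mem_preimage, Metric.mem_closedBall, Set.mem_iInter, Set.mem_ofPred_eq]
      rw [ContinuousMap.dist_le hr]
      refine ⟨fun h z _ => h z, fun h z => ?_⟩
      have hcl : IsClosed {z | dist (J a z) (φ z) ≤ r} :=
        isClosed_le (by fun_prop) continuous_const
      exact hcl.closure_subset_iff.2 (fun z hz => h z hz) (hsd z)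
    rw [this]
    refine MeasurableSet.biInter hsc fun z _ => ?_
    exact measurableSet_le ((hJ z).dist measurable_const) measurable_const
  have hopenball : ∀ (φ : C(K, ℝ)) (r : ℝ), MeasurableSet (J ⁻¹' Metric.ball φ r) := by
    intro φ r
    have : J ⁻¹' Metric.ball φ r = ⋃ n : ℕ, ⋃ (_ : 0 ≤ r - 1 / (n + 1 : ℝ)),
        J ⁻¹' Metric.closedBall φ (r - 1 / (n + 1 : ℝ)) := by
      ext a
      simp only [Set.mem_preimage, Metric.mem_closedBall, Metric.mem_ball, Set.mem_iUnion]
      constructor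
      · intro h
        obtain ⟨n, hn⟩ := exists_nat_one_div_lt (sub_pos.2 h)
        exact ⟨n, by linarith [dist_nonneg (x := J a) (y := φ)], by linarith⟩
      · rintro ⟨n, _, hn⟩
        have : (0 : ℝ) < 1 / (n + 1) := by positivity
        linarith
    rw [this]
    exact MeasurableSet.iUnion fun n => MeasurableSet.iUnion fun h => hball _ _ h
  refine measurable_of_isOpen fun U hU => ?_
  obtain ⟨T, hTc, hTU⟩ := TopologicalSpace.isOpen_biUnion_countable
    {x : C(K, ℝ) × ℝ | Metric.ball x.1 x.2 ⊆ U} (fun x => Metric.ball x.1 x.2)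
    (fun _ _ => Metric.isOpen_ball)
  have hUeq : U = ⋃ x ∈ T, Metric.ball x.1 x.2 := by
    rw [hTU.2]
    refine Set.Subset.antisymm (fun φ hφ => ?_) (Set.iUnion₂_subset fun x hx => hx)
    obtain ⟨r, hr, hrU⟩ := Metric.isOpen_iff.1 hU φ hφ
    exact Set.mem_biUnion (x := (φ, r)) hrU (Metric.mem_ball_self hr)
  rw [hUeq, Set.preimage_iUnion₂]
  exact MeasurableSet.biUnion hTU.1 fun x _ => hopenball _ _

/-- A class of functions that are continuous on a compact set `D` and vanish off `D`. -/
lemma measurable_quantileEmb {p : ℕ} {ψ : Transform p} {S : Set (Euc p → ℝ)} {R : ℝ}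
    (h : SlicesIn ψ S R) (hT1 : T1 ψ S) {D : Set (Euc p)} (hD : IsCompact D)
    (hcont : ∀ f ∈ S, ContinuousOn f D) (hsupp : ∀ f ∈ S, Function.support f ⊆ D)
    [MeasurableSpace (Lp ℝ 2 (quantileMeasure p))] [BorelSpace (Lp ℝ 2 (quantileMeasure p))] :
    Measurable fun f : S => quantileEmb ψ (f : Euc p → ℝ) := by
  have : CompactSpace D := isCompact_iff_compactSpace.1 hD
  borelize C(D, ℝ)
  let J : S → C(D, ℝ) := fun f => ⟨D.domRestrict f.1, (hcont f f.2).domRestrict⟩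
  have hJ : Measurable J := measurable_of_measurable_eval fun z =>
    (measurable_pi_apply (z : Euc p)).comp measurable_subtype_coe
  obtain ⟨K, hK0, hK⟩ := h.exists_holder hT1
  -- The class carries the σ-algebra of pointwise evaluations. In the topology of uniform
  -- convergence on D the Hölder bound makes the embedding continuous, and open sets of this
  -- topology are preimages under the measurable map `J`.
  let : TopologicalSpace S := TopologicalSpace.induced J inferInstance
  have hJc : Continuous J := continuous_induced_dom
  set c : ℝ := (volume D).toReal ^ (1 / 2 : ℝ) with hc
  have hbound : ∀ f₁ f₂ : S, ‖quantileEmb ψ f₁.1 - quantileEmb ψ f₂.1‖ ^ 2 ≤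
      K * (c * dist (J f₁) (J f₂)) := by
    intro f₁ f₂
    have h1 := hK f₁ f₁.2 f₂ f₂.2
    have h2 : eLpNorm (f₁.1 - f₂.1) 2 volume ≤ ENNReal.ofReal (c * dist (J f₁) (J f₂)) := by
      have : D.indicator (f₁.1 - f₂.1) = f₁.1 - f₂.1 := by
        rw [Set.indicator_eq_self]
        exact (Function.support_sub _ _).trans
          (Set.union_subset (hsupp f₁ f₁.2) (hsupp f₂ f₂.2))
      rw [← this, eLpNorm_indicator_eq_eLpNorm_restrict hD.measurableSet]
      refine (eLpNorm_le_of_ae_bound (C := dist (J f₁) (J f₂)) ?_).trans (le_of_eq ?_)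
      · filter_upwards [ae_restrict_mem hD.measurableSet] with z hz
        exact ContinuousMap.dist_apply_le_dist (f := J f₁) (g := J f₂) (⟨z, hz⟩ : D)
      · rw [Measure.restrict_apply_univ, ENNReal.ofReal_mul (by positivity), hc,
          ← ENNReal.ofReal_rpow_of_nonneg ENNReal.toReal_nonneg (by norm_num),
          ENNReal.ofReal_toReal hD.measure_lt_top.ne]
        norm_num
    have h3 := h1.trans (mul_le_mul_right h2 _)
    rw [← ENNReal.ofReal_mul hK0] at h3
    exact (ENNReal.ofReal_le_ofReal_iff (by positivity)).1 h3
  have hΦ : Continuous fun f : S => quantileEmb ψ (f : Euc p → ℝ) := by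
    rw [continuous_iff_continuousAt]
    intro f₀
    rw [ContinuousAt, tendsto_iff_norm_sub_tendsto_zero]
    have hlim : Tendsto (fun f : S => Real.sqrt (K * (c * dist (J f) (J f₀)))) (𝓝 f₀) (𝓝 0) := by
      have : Continuous fun f : S => Real.sqrt (K * (c * dist (J f) (J f₀))) := by fun_prop
      simpa using this.tendsto f₀
    exact squeeze_zero (fun _ => norm_nonneg _) (fun f => Real.le_sqrt_of_sq_le (hbound f f₀)) hlim
  refine measurable_of_isOpen fun U hU => ?_
  obtain ⟨O, hO, hOU⟩ := isOpen_induced_iff.1 (hU.preimage hΦ)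
  rw [← hOU]
  exact hJ hO.measurableSet

/-! ### Stochastic orders of magnitude -/

section BigOp

variable {Ω : Type*} [MeasurableSpace Ω] {P : Measure Ω} {Y A B : ℕ → Ω → ℝ≥0∞} {a b : ℕ → ℝ}

lemma IsBigOp.mono_rate (h : IsBigOp P Y a) (hab : ∀ᶠ n in atTop, a n ≤ b n) : IsBigOp P Y b := by
  intro δ hδ
  obtain ⟨C, hC, hn⟩ := h δ hδ
  refine ⟨C, hC, ?_⟩
  filter_upwards [hn, hab] with n h1 h2
  refine (measure_mono fun ω hω => ?_).trans h1
  exact lt_of_le_of_lt (ENNReal.ofReal_le_ofReal (by gcongr)) hω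

lemma IsBigOp.add (hA : IsBigOp P A a) (hB : IsBigOp P B a) :
    IsBigOp P (fun n ω => A n ω + B n ω) a := by
  intro δ hδ
  obtain ⟨C₁, hC₁, h₁⟩ := hA (δ / 2) (half_pos hδ)
  obtain ⟨C₂, hC₂, h₂⟩ := hB (δ / 2) (half_pos hδ)
  refine ⟨C₁ + C₂, by positivity, ?_⟩
  filter_upwards [h₁, h₂] with n h1 h2
  have hsub : {ω | ENNReal.ofReal ((C₁ + C₂) * a n) < A n ω + B n ω} ⊆
      {ω | ENNReal.ofReal (C₁ * a n) < A n ω} ∪ {ω | ENNReal.ofReal (C₂ * a n) < B n ω} := by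
    intro ω hω
    by_contra hcon
    simp only [Set.mem_union, Set.mem_ofPred_eq, not_or, not_lt] at hcon hω
    -- Rates are not assumed nonnegative; at a nonpositive value the threshold is zero and both
    -- summands vanish.
    rcases le_total 0 (a n) with ha | ha
    · rw [add_mul, ENNReal.ofReal_add (by positivity) (by positivity)] at hω
      exact absurd hω (not_lt.2 (add_le_add hcon.1 hcon.2))
    · rw [ENNReal.ofReal_of_nonpos (mul_nonpos_of_nonneg_of_nonpos hC₁.le ha)] at hcon
      rw [ENNReal.ofReal_of_nonpos (p := C₂ * a n)
        (mul_nonpos_of_nonneg_of_nonpos hC₂.le ha)] at hcon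
      have h1 : A n ω + B n ω = 0 := by
        rw [nonpos_iff_eq_zero.1 hcon.1, nonpos_iff_eq_zero.1 hcon.2, add_zero]
      rw [h1] at hω
      exact absurd hω not_lt_zero
  refine (measure_mono hsub).trans ((measure_union_le _ _).trans ((add_le_add h1 h2).trans ?_))
  rw [← ENNReal.ofReal_add (by positivity) (by positivity), add_halves]

lemma IsBigOp.mul (hA : IsBigOp P A fun _ => 1) (hB : IsBigOp P B a) :
    IsBigOp P (fun n ω => A n ω * B n ω) a := by
  intro δ hδ
  obtain ⟨C₁, hC₁, h₁⟩ := hA (δ / 2) (half_pos hδ)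
  obtain ⟨C₂, hC₂, h₂⟩ := hB (δ / 2) (half_pos hδ)
  refine ⟨C₁ * C₂, by positivity, ?_⟩
  filter_upwards [h₁, h₂] with n h1 h2
  have hsub : {ω | ENNReal.ofReal ((C₁ * C₂) * a n) < A n ω * B n ω} ⊆
      {ω | ENNReal.ofReal (C₁ * 1) < A n ω} ∪ {ω | ENNReal.ofReal (C₂ * a n) < B n ω} := by
    intro ω hω
    by_contra hcon
    simp only [Set.mem_union, Set.mem_ofPred_eq, not_or, not_lt, mul_one] at hcon hω
    rw [mul_assoc, ENNReal.ofReal_mul hC₁.le] at hω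
    exact absurd hω (not_lt.2 (mul_le_mul' hcon.1 hcon.2))
  refine (measure_mono hsub).trans ((measure_union_le _ _).trans ((add_le_add h1 h2).trans ?_))
  rw [← ENNReal.ofReal_add (by positivity) (by positivity), add_halves]

/-- A bound on events with probability tending to one transfers the order of magnitude. -/
lemma IsBigOp.of_le_on (hA : IsBigOp P A a) {G : ℕ → Set Ω}
    (hG : Tendsto (fun n => P (G n)ᶜ) atTop (𝓝 0)) {K : ℝ}
    (hle : ∀ᶠ n in atTop, ∀ ω ∈ G n, Y n ω ≤ ENNReal.ofReal K * A n ω) : IsBigOp P Y a := by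
  intro δ hδ
  obtain ⟨C, hC, h1⟩ := hA (δ / 2) (half_pos hδ)
  have h2 : ∀ᶠ n in atTop, P (G n)ᶜ < ENNReal.ofReal (δ / 2) :=
    hG.eventually_lt_const (by simpa using hδ)
  refine ⟨(|K| + 1) * C, by positivity, ?_⟩
  filter_upwards [h1, h2, hle] with n h1 h2 h3
  have hsub : {ω | ENNReal.ofReal ((|K| + 1) * C * a n) < Y n ω} ⊆
      {ω | ENNReal.ofReal (C * a n) < A n ω} ∪ (G n)ᶜ := by
    intro ω hω
    by_contra hcon
    simp only [Set.mem_union, Set.mem_ofPred_eq, not_or, not_lt, Set.mem_compl_iff,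
      not_not] at hcon hω
    have h4 := (h3 ω hcon.2).trans (mul_le_mul' (ENNReal.ofReal_le_ofReal
      (show K ≤ |K| + 1 by linarith [le_abs_self K])) hcon.1)
    rw [← ENNReal.ofReal_mul (by positivity), ← mul_assoc] at h4
    exact absurd hω (not_lt.2 h4)
  refine (measure_mono hsub).trans ((measure_union_le _ _).trans ((add_le_add h1 h2.le).trans ?_))
  rw [← ENNReal.ofReal_add (by positivity) (by positivity), add_halves]

/-- A vanishing rate yields events of probability tending to one on which local estimates apply, in
the form that `IsBigOp.of_le_on` consumes. -/
lemma IsBigOp.tendsto_measure (hA : IsBigOp P A a) (ha : Tendsto a atTop (𝓝 0)) {r : ℝ}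
    (hr : 0 < r) : Tendsto (fun n => P {ω | A n ω < ENNReal.ofReal r}ᶜ) atTop (𝓝 0) := by
  rw [ENNReal.tendsto_nhds_zero]
  intro e he
  obtain ⟨δ, hδ, hδe⟩ : ∃ δ : ℝ, 0 < δ ∧ ENNReal.ofReal δ ≤ e := by
    rcases eq_or_ne e ∞ with rfl | hne
    · exact ⟨1, one_pos, le_top⟩
    · exact ⟨e.toReal, ENNReal.toReal_pos he.ne' hne, (ENNReal.ofReal_toReal hne).le⟩
  obtain ⟨C, hC, h1⟩ := hA δ hδ
  have h2 : ∀ᶠ n in atTop, C * a n < r := by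
    have := ha.const_mul C
    rw [mul_zero] at this
    exact this.eventually_lt_const hr
  filter_upwards [h1, h2] with n h1 h2
  refine (measure_mono fun ω hω => ?_).trans (h1.trans hδe)
  simp only [Set.mem_compl_iff, Set.mem_ofPred_eq, not_lt] at hω ⊢
  exact ((ENNReal.ofReal_lt_ofReal_iff hr).2 h2).trans_le hω

/-- Chebyshev's inequality as an order of magnitude. -/
lemma isBigOp_of_lintegral_sq (hY : ∀ n, AEMeasurable (Y n) P) {v : ℝ} (hv : 0 ≤ v)
    (ha : ∀ᶠ n in atTop, 0 < a n)
    (h : ∀ᶠ n in atTop, ∫⁻ ω, Y n ω ^ 2 ∂P ≤ ENNReal.ofReal (v * a n ^ 2)) : IsBigOp P Y a := by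
  intro δ hδ
  -- Chosen so that the Chebyshev quotient v/C² is at most δ; the added 1 keeps C positive when v =
  -- 0.
  refine ⟨Real.sqrt ((v + 1) / δ), by positivity, ?_⟩
  filter_upwards [ha, h] with n han hn
  set c := Real.sqrt ((v + 1) / δ) with hc
  have hcpos : 0 < c := by positivity
  have hc2 : c ^ 2 = (v + 1) / δ := Real.sq_sqrt (by positivity)
  have hε : 0 < (c * a n) ^ 2 := by positivity
  calc P {ω | ENNReal.ofReal (c * a n) < Y n ω}
      ≤ P {ω | ENNReal.ofReal ((c * a n) ^ 2) ≤ Y n ω ^ 2} := by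
        refine measure_mono fun ω hω => ?_
        simp only [Set.mem_ofPred_eq] at hω ⊢
        rw [ENNReal.ofReal_pow (by positivity)]
        gcongr
    _ ≤ (∫⁻ ω, Y n ω ^ 2 ∂P) / ENNReal.ofReal ((c * a n) ^ 2) :=
        meas_ge_le_lintegral_div ((hY n).pow_const 2) (by simpa using hε.ne')
          ENNReal.ofReal_ne_top
    _ ≤ ENNReal.ofReal (v * a n ^ 2) / ENNReal.ofReal ((c * a n) ^ 2) := by gcongr
    _ = ENNReal.ofReal (v * a n ^ 2 / (c * a n) ^ 2) := (ENNReal.ofReal_div_of_pos hε).symm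
    _ ≤ ENNReal.ofReal δ := by
        refine ENNReal.ofReal_le_ofReal ?_
        rw [mul_pow, hc2, div_le_iff₀ (by positivity)]
        have : δ * ((v + 1) / δ * a n ^ 2) = (v + 1) * a n ^ 2 := by field_simp
        rw [this]
        gcongr
        linarith

end BigOp

/-! ### Sample means of independent random vectors in a Hilbert space -/

section Mean

variable {Ω : Type*} [MeasurableSpace Ω] {P : Measure Ω}
  {E : Type*} [NormedAddCommGroup E] [InnerProductSpace ℝ E] [CompleteSpace E]
  [MeasurableSpace E] [BorelSpace E]

/-- By independence each cross term integrates to the inner product of two means, which is zero;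
pairwise independence is enough. -/
lemma integral_norm_sum_sq [IsProbabilityMeasure P] {ι : Type*} (s : Finset ι) {W : ι → Ω → E}
    (hW : ∀ i ∈ s, MemLp (W i) 2 P) (h0 : ∀ i ∈ s, ∫ ω, W i ω ∂P = 0)
    (hind : ∀ i ∈ s, ∀ j ∈ s, i ≠ j → IndepFun (W i) (W j) P) :
    ∫ ω, ‖∑ i ∈ s, W i ω‖ ^ 2 ∂P = ∑ i ∈ s, ∫ ω, ‖W i ω‖ ^ 2 ∂P := by
  classical
  have hint : ∀ i ∈ s, ∀ j ∈ s, Integrable (fun ω => (inner ℝ (W i ω) (W j ω) : ℝ)) P := by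
    intro i hi j hj
    refine ((hW i hi).norm.integrable_mul (hW j hj).norm).mono' ((hW i hi).1.inner (hW j hj).1)
      (ae_of_all _ fun ω => ?_)
    exact norm_inner_le_norm _ _
  have h1 : ∀ ω, ‖∑ i ∈ s, W i ω‖ ^ 2 = ∑ i ∈ s, ∑ j ∈ s, (inner ℝ (W i ω) (W j ω) : ℝ) := by
    intro ω
    rw [← real_inner_self_eq_norm_sq, sum_inner]
    simp_rw [inner_sum]
  simp_rw [h1]
  rw [integral_finsetSum _ fun i hi => integrable_finsetSum _ fun j hj => hint i hi j hj]
  refine Finset.sum_congr rfl fun i hi => ?_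
  rw [integral_finsetSum _ fun j hj => hint i hi j hj, Finset.sum_eq_single_of_mem i hi]
  · simp_rw [real_inner_self_eq_norm_sq]
  · intro j hj hij
    have hI : ∀ k ∈ s, Integrable (W k) P := fun k hk => (hW k hk).integrable (by norm_num)
    have : ∫ ω, (inner ℝ (W i ω) (W j ω) : ℝ) ∂P = inner ℝ (∫ ω, W i ω ∂P) (∫ ω, W j ω ∂P) :=
      (hind i hi j hj hij.symm).integral_bilin (hI i hi) (hI j hj) (innerSL ℝ)
    rw [this, h0 i hi, inner_zero_left]

lemma integral_norm_mean_sub_sq_le [IsProbabilityMeasure P] {ι : Type*} (s : Finset ι)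
    (hs : s.Nonempty) {Y : ι → Ω → E} {μ : E} {v : ℝ}
    (hY : ∀ i ∈ s, MemLp (Y i) 2 P) (hμ : ∀ i ∈ s, ∫ ω, Y i ω ∂P = μ)
    (hv : ∀ i ∈ s, ∫ ω, ‖Y i ω - μ‖ ^ 2 ∂P ≤ v)
    (hind : ∀ i ∈ s, ∀ j ∈ s, i ≠ j → IndepFun (Y i) (Y j) P) :
    ∫ ω, ‖(s.card : ℝ)⁻¹ • ∑ i ∈ s, Y i ω - μ‖ ^ 2 ∂P ≤ v / s.card := by
  have hc : (0 : ℝ) < s.card := by exact_mod_cast hs.card_pos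
  have h1 : ∀ ω, ‖(s.card : ℝ)⁻¹ • ∑ i ∈ s, Y i ω - μ‖ ^ 2 =
      ((s.card : ℝ)⁻¹) ^ 2 * ‖∑ i ∈ s, (Y i ω - μ)‖ ^ 2 := by
    intro ω
    rw [← mul_pow, ← Real.norm_of_nonneg (inv_nonneg.2 hc.le), ← norm_smul, Finset.sum_sub_distrib,
      smul_sub, Finset.sum_const, ← Nat.cast_smul_eq_nsmul ℝ, smul_smul,
      Real.norm_of_nonneg (inv_nonneg.2 hc.le), inv_mul_cancel₀ hc.ne', one_smul]
  simp_rw [h1]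
  rw [integral_const_mul, integral_norm_sum_sq s (W := fun i ω => Y i ω - μ)
    (fun i hi => (hY i hi).sub (memLp_const μ))]
  · calc ((s.card : ℝ)⁻¹) ^ 2 * ∑ i ∈ s, ∫ ω, ‖Y i ω - μ‖ ^ 2 ∂P
        ≤ ((s.card : ℝ)⁻¹) ^ 2 * ∑ i ∈ s, v := by gcongr with i hi; exact hv i hi
      _ = v / s.card := by
        rw [Finset.sum_const, nsmul_eq_mul]
        field_simp
  · intro i hi
    rw [integral_sub ((hY i hi).integrable (by norm_num)) (integrable_const _), hμ i hi]
    simp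
  · intro i hi j hj hij
    exact (hind i hi j hj hij).comp (measurable_id.sub_const μ) (measurable_id.sub_const μ)

/-- Root-`n` rate of the sample mean of independent copies of a square integrable vector. -/
lemma isBigOp_mean [IsProbabilityMeasure P] [SecondCountableTopology E] {Y : ℕ → Ω → E}
    {Y₀ : Ω → E} (hY₀ : MemLp Y₀ 2 P) (hident : ∀ i, IdentDistrib (Y i) Y₀ P P)
    (hind : ∀ i j, i ≠ j → IndepFun (Y i) (Y j) P) :
    IsBigOp P (fun (n : ℕ) ω => ENNReal.ofReal
      ‖(n : ℝ)⁻¹ • ∑ i ∈ Finset.range n, Y i ω - ∫ ω, Y₀ ω ∂P‖)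
      (fun n => (n : ℝ) ^ (-(1 / 2) : ℝ)) := by
  set μ := ∫ ω, Y₀ ω ∂P with hμ
  have hY : ∀ i, MemLp (Y i) 2 P := fun i => (hident i).memLp_iff.2 hY₀
  have hmean : ∀ n : ℕ, MemLp (fun ω => (n : ℝ)⁻¹ • ∑ i ∈ Finset.range n, Y i ω - μ) 2 P := by
    intro n
    refine MemLp.sub (MemLp.const_smul ?_ _) (memLp_const μ)
    exact memLp_finsetSum _ fun i _ => hY i
  refine isBigOp_of_lintegral_sq (v := ∫ ω, ‖Y₀ ω - μ‖ ^ 2 ∂P) (fun n => ?_)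
    (integral_nonneg fun _ => by positivity) ?_ ?_
  · exact (hmean n).1.norm.aemeasurable.ennreal_ofReal
  · filter_upwards [eventually_gt_atTop 0] with n hn
    positivity
  · filter_upwards [eventually_gt_atTop 0] with n hn
    have hn' : (0 : ℝ) < n := by exact_mod_cast hn
    have h1 := integral_norm_mean_sub_sq_le (P := P) (Finset.range n) (Finset.nonempty_range_iff.2 hn.ne')
      (Y := Y) (μ := μ) (v := ∫ ω, ‖Y₀ ω - μ‖ ^ 2 ∂P) (fun i _ => hY i)
      (fun i _ => (hident i).integral_eq)
      (fun i _ => le_of_eq ((hident i).comp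
        (u := fun y => ‖y - μ‖ ^ 2) (by fun_prop)).integral_eq)
      (fun i _ j _ hij => hind i j hij)
    rw [Finset.card_range] at h1
    simp_rw [← ENNReal.ofReal_pow (norm_nonneg _)]
    rw [← ofReal_integral_eq_lintegral_ofReal ((hmean n).integrable_norm_pow two_ne_zero)
      (ae_of_all _ fun _ => by positivity)]
    refine ENNReal.ofReal_le_ofReal (h1.trans (le_of_eq ?_))
    rw [← Real.rpow_natCast, ← Real.rpow_mul hn'.le]
    norm_num [Real.rpow_neg_one, div_eq_mul_inv]

end Mean

/-! ### Regression vectors as functions of moments -/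

section Moments

variable {q : ℕ} {E : Type*}

/-- Moments of a pair `(X, V)` of a random vector in `ℝ^q` and a random element of `E`: the
(empirical or population) means of `V`, `X_a V`, `X_a`, and `X_a X_b`. -/
abbrev MomentSpace (q : ℕ) (E : Type*) : Type _ :=
  E × (Fin q → E) × (Fin q → ℝ) × (Fin q → Fin q → ℝ)

/-- Covariance matrix as a function of the moments. -/
def momentCov (w : MomentSpace q E) : Matrix (Fin q) (Fin q) ℝ :=
  Matrix.of fun a b => w.2.2.2 a b - w.2.2.1 a * w.2.2.1 b

/-- Regression weight at `x` of the predictor value `y`, as a function of the moments. -/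
def momentWeight (w : MomentSpace q E) (x y : Euc q) : ℝ :=
  1 + (fun a => y a - w.2.2.1 a) ⬝ᵥ ((momentCov w)⁻¹.mulVec fun a => x a - w.2.2.1 a)

lemma momentWeight_eq (w : MomentSpace q E) (x y : Euc q) : momentWeight w x y =
    1 + ∑ b, (x b - w.2.2.1 b) * ∑ a, (momentCov w)⁻¹ a b * (y a - w.2.2.1 a) := by
  simp only [momentWeight, dotProduct, Matrix.mulVec, Finset.mul_sum]
  rw [Finset.sum_comm]
  congr 1
  refine Finset.sum_congr rfl fun b _ => Finset.sum_congr rfl fun a _ => ?_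
  ring

variable [NormedAddCommGroup E] [NormedSpace ℝ E]

/-- Coefficient of the `b`-th coordinate in the regression vector. -/
def momentSlope (b : Fin q) (w : MomentSpace q E) : E :=
  ∑ a, (momentCov w)⁻¹ a b • (w.2.1 a - w.2.2.1 a • w.1)

/-- Weighted mean of `V` at `x`, as a function of the moments. -/
def momentReg (w : MomentSpace q E) (x : Euc q) : E :=
  w.1 + ∑ b, (x b - w.2.2.1 b) • momentSlope b w

lemma contDiff_momentCov (a b : Fin q) :
    ContDiff ℝ 1 fun w : MomentSpace q E => momentCov w a b := by
  simp only [momentCov, Matrix.of_apply]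
  fun_prop

lemma contDiff_det {n : Type*} [Fintype n] [DecidableEq n] {W : Type*} [NormedAddCommGroup W]
    [NormedSpace ℝ W] {A : W → Matrix n n ℝ} (hA : ∀ a b, ContDiff ℝ 1 fun w => A w a b) :
    ContDiff ℝ 1 fun w => (A w).det := by
  simp only [Matrix.det_apply]
  refine ContDiff.sum fun σ _ => ContDiff.const_smul _ ?_
  exact contDiff_prod fun i _ => hA _ _

/-- Cramer's rule: the entries of the inverse are quotients of polynomials in the entries of the
matrix. -/
lemma contDiffAt_inv_apply {n : Type*} [Fintype n] [DecidableEq n] {W : Type*}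
    [NormedAddCommGroup W] [NormedSpace ℝ W] {A : W → Matrix n n ℝ}
    (hA : ∀ a b, ContDiff ℝ 1 fun w => A w a b) {w₀ : W} (h0 : (A w₀).det ≠ 0) (a b : n) :
    ContDiffAt ℝ 1 (fun w => (A w)⁻¹ a b) w₀ := by
  have h1 : ∀ w, (A w)⁻¹ a b = (A w).det⁻¹ * (A w).adjugate a b := fun w => by
    rw [Matrix.inv_def, Ring.inverse_eq_inv', Matrix.smul_apply, smul_eq_mul]
  simp_rw [h1, Matrix.adjugate_apply]
  refine ((contDiff_det hA).contDiffAt.inv h0).mul (ContDiff.contDiffAt ?_)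
  refine contDiff_det fun i j => ?_
  by_cases hi : i = b
  · subst hi
    simp only [Matrix.updateRow_self]
    exact contDiff_const
  · simp only [Matrix.updateRow_ne hi]
    exact hA i j

lemma contDiffAt_momentSlope {w₀ : MomentSpace q E} (h0 : (momentCov w₀).det ≠ 0) (b : Fin q) :
    ContDiffAt ℝ 1 (momentSlope (E := E) b) w₀ := by
  unfold momentSlope
  refine ContDiffAt.sum fun a _ => ?_
  refine (contDiffAt_inv_apply contDiff_momentCov h0 a b).smul (ContDiff.contDiffAt ?_)
  fun_prop

/-- The regression vector is a locally Lipschitz function of the moments, uniformly on bounded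
sets of predictor values. -/
lemma exists_lipschitz_momentReg {w₀ : MomentSpace q E} (h0 : (momentCov w₀).det ≠ 0) (B : ℝ) :
    ∃ r K : ℝ, 0 < r ∧ 0 ≤ K ∧ ∀ w, ‖w - w₀‖ < r → ∀ x : Euc q, ‖x‖ ≤ B →
      ‖momentReg w₀ x - momentReg w x‖ ≤ K * ‖w - w₀‖ := by
  have hS := fun b => (contDiffAt_momentSlope h0 b).exists_lipschitzOnWith
  choose K t ht hK using hS
  have hI : ContDiffAt ℝ 1 (fun w : MomentSpace q E => w.1 - ∑ b, w.2.2.1 b • momentSlope b w)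
      w₀ := by
    refine ContDiffAt.sub (by fun_prop) (ContDiffAt.sum fun b _ => ?_)
    exact ContDiffAt.smul (by fun_prop) (contDiffAt_momentSlope h0 b)
  obtain ⟨K', t', ht', hK'⟩ := hI.exists_lipschitzOnWith
  have hmem : t' ∩ ⋂ b, t b ∈ 𝓝 w₀ := Filter.inter_mem ht' (Filter.iInter_mem.2 ht)
  obtain ⟨r, hr, hsub⟩ := Metric.mem_nhds_iff.1 hmem
  refine ⟨r, K' + ∑ b, |B| * K b, hr, by positivity, fun w hw x hx => ?_⟩
  have hw' : w ∈ t' ∩ ⋂ b, t b := hsub (by rwa [Metric.mem_ball, dist_eq_norm])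
  have hw₀ : w₀ ∈ t' ∩ ⋂ b, t b := hsub (Metric.mem_ball_self hr)
  -- Intercept and slopes depend on `w` alone, so one neighbourhood of `w₀` serves every x in the
  -- ball.
  have hreg : ∀ w : MomentSpace q E, momentReg w x =
      (w.1 - ∑ b, w.2.2.1 b • momentSlope b w) + ∑ b, x b • momentSlope b w := by
    intro w
    simp only [momentReg, sub_smul, Finset.sum_sub_distrib]
    abel
  rw [hreg, hreg, add_sub_add_comm, ← Finset.sum_sub_distrib, add_mul, Finset.sum_mul]
  have hcomm : ‖w - w₀‖ = ‖w₀ - w‖ := norm_sub_rev _ _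
  refine (norm_add_le _ _).trans (add_le_add ?_ ((norm_sum_le _ _).trans
    (Finset.sum_le_sum fun b _ => ?_)))
  · rw [hcomm]
    exact hK'.norm_sub_le hw₀.1 hw'.1
  · rw [← smul_sub, norm_smul, mul_assoc, hcomm]
    have h1 : ‖x b‖ ≤ |B| := (PiLp.norm_apply_le x b).trans (hx.trans (le_abs_self B))
    have h2 := (hK b).norm_sub_le (Set.mem_iInter.1 hw₀.2 b) (Set.mem_iInter.1 hw'.2 b)
    exact mul_le_mul h1 h2 (norm_nonneg _) (abs_nonneg _)

/-- Near moments with a regular covariance matrix, the weights grow at most linearly. -/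
lemma exists_bound_momentWeight {w₀ : MomentSpace q E} (h0 : (momentCov w₀).det ≠ 0) (B : ℝ) :
    ∃ r K : ℝ, 0 < r ∧ 0 ≤ K ∧ ∀ w, ‖w - w₀‖ < r → ∀ x : Euc q, ‖x‖ ≤ B → ∀ y : Euc q,
      |momentWeight w x y| ≤ K * (1 + ‖y‖) := by
  -- The entries of the inverse are continuous at `w₀`, so nearby they exceed their values there by
  -- less than 1.
  let C : Fin q → Fin q → ℝ := fun a b => |(momentCov w₀)⁻¹ a b| + 1
  have hev : ∀ᶠ w in 𝓝 w₀, ∀ a b, |(momentCov w)⁻¹ a b| < C a b := by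
    refine Filter.eventually_all.2 fun a => Filter.eventually_all.2 fun b => ?_
    have hc := (contDiffAt_inv_apply contDiff_momentCov h0 a b).continuousAt.abs
    exact hc.eventually_lt_const (by simp [C])
  obtain ⟨r, hr, hsub⟩ := Metric.eventually_nhds_iff.1 hev
  set U := ‖w₀‖ + 1 with hU
  have hU0 : 0 < U := by positivity
  refine ⟨min r 1, 1 + ∑ b, (|B| + U) * ∑ a, C a b * (1 + U), by positivity, ?_,
    fun w hw x hx y => ?_⟩
  · have : ∀ a b, 0 ≤ C a b := fun a b => by positivity
    have h2 : ∀ b, 0 ≤ ∑ a, C a b * (1 + U) := fun b =>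
      Finset.sum_nonneg fun a _ => mul_nonneg (this a b) (by positivity)
    have h3 : 0 ≤ ∑ b, (|B| + U) * ∑ a, C a b * (1 + U) :=
      Finset.sum_nonneg fun b _ => mul_nonneg (by positivity) (h2 b)
    positivity
  have hC := hsub (y := w) (by rw [dist_eq_norm]; exact hw.trans_le (min_le_left _ _))
  have hwU : ‖w‖ ≤ U := by
    have h1 := norm_add_le (w - w₀) w₀
    rw [sub_add_cancel] at h1
    linarith [hw.trans_le (min_le_right r 1)]
  have hu : ∀ a, |w.2.2.1 a| ≤ U := fun a =>
    ((norm_le_pi_norm w.2.2.1 a).trans ((norm_fst_le w.2.2).trans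
      ((norm_snd_le w.2).trans (norm_snd_le w)))).trans hwU
  have hy : ∀ a, |y a - w.2.2.1 a| ≤ (1 + U) * (1 + ‖y‖) := fun a => by
    have h1 : |y a| ≤ ‖y‖ := PiLp.norm_apply_le y a
    have h2 := abs_sub (y a) (w.2.2.1 a)
    nlinarith [hu a, norm_nonneg y, mul_nonneg hU0.le (norm_nonneg y)]
  have hxb : ∀ b, |x b - w.2.2.1 b| ≤ |B| + U := fun b => by
    have h1 : |x b| ≤ ‖x‖ := PiLp.norm_apply_le x b
    linarith [abs_sub (x b) (w.2.2.1 b), hu b, le_abs_self B]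
  rw [momentWeight_eq, add_mul, one_mul, Finset.sum_mul]
  refine (abs_add_le _ _).trans (add_le_add (by simp) ((Finset.abs_sum_le_sum_abs _ _).trans
    (Finset.sum_le_sum fun b _ => ?_)))
  rw [abs_mul, mul_assoc, Finset.sum_mul]
  refine mul_le_mul (hxb b) ?_ (abs_nonneg _) (by positivity)
  refine (Finset.abs_sum_le_sum_abs _ _).trans (Finset.sum_le_sum fun a _ => ?_)
  rw [abs_mul, mul_assoc]
  exact mul_le_mul (hC a b).le (hy a) (abs_nonneg _) (by positivity)

/-! ### Sample moments -/

/-- Moments of the first `n` pairs. -/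
def sampleMoment (n : ℕ) (X : ℕ → Euc q) (V : ℕ → E) : MomentSpace q E :=
  ((n : ℝ)⁻¹ • ∑ i ∈ Finset.range n, V i,
    fun a => (n : ℝ)⁻¹ • ∑ i ∈ Finset.range n, X i a • V i,
    fun a => (n : ℝ)⁻¹ • ∑ i ∈ Finset.range n, X i a,
    fun a b => (n : ℝ)⁻¹ • ∑ i ∈ Finset.range n, X i a * X i b)

lemma sampleMean_apply (n : ℕ) (X : ℕ → Euc q) (V : ℕ → E) (a : Fin q) :
    sampleMean n X a = (sampleMoment n X V).2.2.1 a := by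
  simp [sampleMean, sampleMoment]

lemma sampleCov_eq {n : ℕ} (hn : 1 ≤ n) (X : ℕ → Euc q) (V : ℕ → E) :
    sampleCov n X = momentCov (sampleMoment n X V) := by
  have hn' : (n : ℝ) ≠ 0 := by positivity
  ext a b
  simp only [sampleCov, momentCov, Matrix.of_apply, PiLp.sub_apply, sampleMean_apply n X V]
  set u := (sampleMoment n X V).2.2.1 with hu
  have h1 : ∀ a, ∑ i ∈ Finset.range n, X i a = n * u a := fun a => by
    simp only [hu, sampleMoment, smul_eq_mul]
    field_simp
  have h2 : ∑ i ∈ Finset.range n, X i a * X i b = n * (sampleMoment n X V).2.2.2 a b := by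
    simp only [sampleMoment, smul_eq_mul]
    field_simp
  have h3 : ∀ i, (X i a - u a) * (X i b - u b) =
      X i a * X i b - X i a * u b - u a * X i b + u a * u b := fun i => by ring
  simp_rw [h3]
  rw [Finset.sum_add_distrib, Finset.sum_sub_distrib, Finset.sum_sub_distrib, ← Finset.sum_mul,
    ← Finset.mul_sum, h1, h1, h2, Finset.sum_const, Finset.card_range, nsmul_eq_mul]
  field_simp
  ring

lemma sampleWeight_eq {n : ℕ} (hn : 1 ≤ n) (X : ℕ → Euc q) (V : ℕ → E) (x : Euc q) (i : ℕ) :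
    sampleWeight n X x i = momentWeight (sampleMoment n X V) x (X i) := by
  rw [sampleWeight, momentWeight, sampleCov_eq hn X V]
  simp only [PiLp.sub_apply, sampleMean_apply n X V]

/-- The centred predictors sum to zero, whatever matrix multiplies them. This holds even for a
singular sample covariance, so the sample problem is well posed for every `n ≥ 1`. -/
lemma mean_sampleWeight {n : ℕ} (hn : 1 ≤ n) (X : ℕ → Euc q) (x : Euc q) :
    (n : ℝ)⁻¹ * ∑ i ∈ Finset.range n, sampleWeight n X x i = 1 := by
  have hn' : (n : ℝ) ≠ 0 := by positivity
  -- The weights involve only the moments of X, so the zero vectors serve as a dummy second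
  -- component.
  have h0 : ∀ a, ∑ i ∈ Finset.range n, (X i a - (sampleMoment n X fun _ => (0 : ℝ)).2.2.1 a) = 0 := by
    intro a
    rw [Finset.sum_sub_distrib, Finset.sum_const, Finset.card_range, nsmul_eq_mul]
    simp only [sampleMoment, smul_eq_mul]
    field_simp
    simp
  simp_rw [sampleWeight_eq hn X (fun _ => (0 : ℝ)), momentWeight_eq]
  rw [Finset.sum_add_distrib, Finset.sum_comm]
  have h1 : ∀ b, ∑ i ∈ Finset.range n, (x b - (sampleMoment n X fun _ => (0 : ℝ)).2.2.1 b) *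
      ∑ a, (momentCov (sampleMoment n X fun _ => (0 : ℝ)))⁻¹ a b *
        (X i a - (sampleMoment n X fun _ => (0 : ℝ)).2.2.1 a) = 0 := by
    intro b
    rw [← Finset.mul_sum, Finset.sum_comm]
    simp_rw [← Finset.mul_sum, h0]
    simp
  simp_rw [h1]
  simp [hn']

/-- Sample counterpart of `integrable_weight_smul`: both targets are the same function `momentReg`,
evaluated at sample and at population moments. -/
lemma mean_sampleWeight_smul {n : ℕ} (hn : 1 ≤ n) (X : ℕ → Euc q) (V : ℕ → E) (x : Euc q) :
    (n : ℝ)⁻¹ • ∑ i ∈ Finset.range n, sampleWeight n X x i • V i =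
      momentReg (sampleMoment n X V) x := by
  simp_rw [sampleWeight_eq hn X V, momentWeight_eq]
  set w := sampleMoment n X V with hw
  simp_rw [add_smul, one_smul, Finset.sum_smul, mul_smul, Finset.sum_smul]
  rw [Finset.sum_add_distrib, smul_add, momentReg]
  congr 1
  rw [Finset.sum_comm, Finset.smul_sum]
  refine Finset.sum_congr rfl fun b _ => ?_
  rw [← Finset.smul_sum, smul_comm, momentSlope, Finset.sum_comm, Finset.smul_sum]
  congr 1
  refine Finset.sum_congr rfl fun a _ => ?_
  simp_rw [mul_smul]
  rw [← Finset.smul_sum, smul_comm]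
  congr 1
  simp_rw [sub_smul]
  rw [Finset.sum_sub_distrib, smul_sub, ← Finset.smul_sum, smul_comm]
  rfl

/-! ### Population moments -/

section Population

variable {Ω : Type*} [MeasurableSpace Ω] (P : Measure Ω)

/-- Population moments of the pair `(X, V)`. -/
def popMoment (X : Ω → Euc q) (V : Ω → E) : MomentSpace q E :=
  (∫ ω, V ω ∂P, fun a => ∫ ω, X ω a • V ω ∂P, fun a => ∫ ω, X ω a ∂P,
    fun a b => ∫ ω, X ω a * X ω b ∂P)

variable {P} {X : Ω → Euc q} {V : Ω → E}

lemma memLp_apply {r : ℝ≥0∞} (hX : MemLp X r P) (a : Fin q) : MemLp (fun ω => X ω a) r P :=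
  hX.mono ((EuclideanSpace.proj (𝕜 := ℝ) a).continuous.comp_aestronglyMeasurable hX.1)
    (ae_of_all _ fun ω => PiLp.norm_apply_le (X ω) a)

lemma integral_apply (hX : Integrable X P) (a : Fin q) :
    (∫ ω, X ω ∂P) a = ∫ ω, X ω a ∂P :=
  ((EuclideanSpace.proj (𝕜 := ℝ) a).integral_comp_comm hX).symm

variable [IsProbabilityMeasure P]

lemma covMatrix_eq (hX : MemLp X 2 P) : covMatrix P X = momentCov (popMoment P X V) := by
  ext a b
  simp only [covMatrix, momentCov, popMoment, Matrix.of_apply]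
  rw [covariance_eq_sub (memLp_apply hX a) (memLp_apply hX b)]
  rfl

lemma weight_eq (hX : MemLp X 2 P) (x : Euc q) (ω : Ω) :
    weight P X x ω = momentWeight (popMoment P X V) x (X ω) := by
  rw [weight, momentWeight, covMatrix_eq (V := V) hX]
  simp only [PiLp.sub_apply, integral_apply (hX.integrable (by norm_num))]
  rfl

lemma integrable_weight_smul (hX : MemLp X 2 P) (x : Euc q) (hV : Integrable V P)
    (hXV : ∀ a, Integrable (fun ω => X ω a • V ω) P) :
    Integrable (fun ω => weight P X x ω • V ω) P ∧
      ∫ ω, weight P X x ω • V ω ∂P = momentReg (popMoment P X V) x := by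
  simp_rw [weight_eq (V := V) hX, momentWeight_eq]
  set w := popMoment P X V with hw
  simp_rw [add_smul, one_smul, Finset.sum_smul, mul_smul, Finset.sum_smul]
  have hI1 : ∀ a b, Integrable (fun ω => ((momentCov w)⁻¹ a b * (X ω a - w.2.2.1 a)) • V ω) P := by
    intro a b
    simp_rw [mul_smul, sub_smul]
    exact ((hXV a).sub (hV.smul (w.2.2.1 a))).smul ((momentCov w)⁻¹ a b)
  have hI2 : ∀ b, Integrable (fun ω => (x b - w.2.2.1 b) •
      ∑ a, ((momentCov w)⁻¹ a b * (X ω a - w.2.2.1 a)) • V ω) P := fun b =>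
    (integrable_finsetSum _ fun a _ => hI1 a b).smul (x b - w.2.2.1 b)
  refine ⟨hV.add (integrable_finsetSum _ fun b _ => hI2 b), ?_⟩
  rw [integral_add hV (integrable_finsetSum _ fun b _ => hI2 b), momentReg,
    integral_finsetSum _ fun b _ => hI2 b]
  congr 1
  refine Finset.sum_congr rfl fun b _ => ?_
  rw [integral_smul, integral_finsetSum _ fun a _ => hI1 a b, momentSlope]
  congr 1
  refine Finset.sum_congr rfl fun a _ => ?_
  simp_rw [mul_smul, sub_smul]
  have hVs : Integrable (fun ω => w.2.2.1 a • V ω) P := hV.smul _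
  rw [integral_smul, integral_sub (hXV a) hVs, integral_smul]
  rfl

/-- The case V = 1, in which every slope vanishes because E(X_a V) = E X_a · E V. -/
lemma integrable_weight (hX : MemLp X 2 P) (x : Euc q) :
    Integrable (weight P X x) P ∧ ∫ ω, weight P X x ω ∂P = 1 := by
  have hXI : ∀ a, Integrable (fun ω => X ω a) P := fun a =>
    (memLp_apply hX a).integrable (by norm_num)
  have h := integrable_weight_smul (V := fun _ => (1 : ℝ)) hX x (integrable_const _)
    (fun a => by simpa using hXI a)
  simp only [smul_eq_mul, mul_one] at h
  refine ⟨h.1, h.2.trans ?_⟩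
  simp [momentReg, momentSlope, popMoment]

end Population

end Moments

/-! ### Projection onto the quantile image -/

section Minimizer

variable {p : ℕ} {H : Type*} [NormedAddCommGroup H] [InnerProductSpace ℝ H]
  {F : Set (Euc p → ℝ)} {Φ : (Euc p → ℝ) → H}

/-- `Φ g` is the projection of `τ` onto `Φ '' F`. -/
def IsProj (F : Set (Euc p → ℝ)) (Φ : (Euc p → ℝ) → H) (τ : H) (g : Euc p → ℝ) : Prop :=
  g ∈ F ∧ ∀ g' ∈ F, (inner ℝ (τ - Φ g) (Φ g' - Φ g) : ℝ) ≤ 0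

/-- The objective differs from a squared distance by a constant on F, and over a convex set nearest
points are characterized by the variational inequality. -/
lemma isMinimizer_iff_isProj (hconv : Convex ℝ (Φ '' F)) {M : (Euc p → ℝ) → ℝ} {τ : H} {c : ℝ}
    (hM : ∀ g ∈ F, M g = ‖τ - Φ g‖ ^ 2 + c) (g : Euc p → ℝ) :
    IsMinimizer F M g ↔ IsProj F Φ τ g := by
  refine and_congr_right fun hg => ?_
  constructor
  · intro h
    have : Nonempty (Φ '' F) := ⟨⟨Φ g, g, hg, rfl⟩⟩
    have h1 : ‖τ - Φ g‖ = ⨅ w : Φ '' F, ‖τ - w‖ := by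
      refine le_antisymm (le_ciInf ?_) ?_
      · rintro ⟨_, g', hg', rfl⟩
        have := h g' hg'
        rw [hM g hg, hM g' hg'] at this
        exact (sq_le_sq₀ (norm_nonneg _) (norm_nonneg _)).1 (by linarith)
      · exact ciInf_le ⟨0, by rintro _ ⟨w, rfl⟩; exact norm_nonneg _⟩
          (⟨Φ g, g, hg, rfl⟩ : Φ '' F)
    exact fun g' hg' => (norm_eq_iInf_iff_real_inner_le_zero hconv ⟨g, hg, rfl⟩).1 h1 _
      ⟨g', hg', rfl⟩
  · intro h g' hg'
    rw [hM g hg, hM g' hg']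
    have h1 : τ - Φ g' = (τ - Φ g) - (Φ g' - Φ g) := by abel
    rw [h1, norm_sub_sq_real (τ - Φ g)]
    nlinarith [h g' hg', sq_nonneg ‖Φ g' - Φ g‖]

/-- Test each variational inequality with the other projection and add: the squared distance of the
projections is at most its inner product with `τ₁ - τ₂`. Cauchy–Schwarz finishes. -/
lemma IsProj.norm_sub_le {τ₁ τ₂ : H} {g₁ g₂ : Euc p → ℝ} (h₁ : IsProj F Φ τ₁ g₁)
    (h₂ : IsProj F Φ τ₂ g₂) : ‖Φ g₁ - Φ g₂‖ ≤ ‖τ₁ - τ₂‖ := by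
  have e₁ := h₁.2 g₂ h₂.1
  have e₂ := h₂.2 g₁ h₁.1
  have h3 : ‖Φ g₁ - Φ g₂‖ ^ 2 ≤ ‖τ₁ - τ₂‖ * ‖Φ g₁ - Φ g₂‖ := by
    refine le_trans ?_ (real_inner_le_norm (τ₁ - τ₂) (Φ g₁ - Φ g₂))
    rw [← real_inner_self_eq_norm_sq]
    simp only [inner_sub_left, inner_sub_right] at e₁ e₂ ⊢
    linarith
  rcases (norm_nonneg (Φ g₁ - Φ g₂)).eq_or_lt with h | h
  · rw [← h]; exact norm_nonneg _
  · nlinarith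

variable [CompleteSpace H]

/-- Existence is the projection theorem; two minimizers have equal images by nonexpansiveness at the
same τ, and injectivity identifies them. -/
lemma existsUnique_isMinimizer (hinj : Set.InjOn Φ F) (hcl : IsClosed (Φ '' F))
    (hconv : Convex ℝ (Φ '' F)) (hne : F.Nonempty) {M : (Euc p → ℝ) → ℝ} {τ : H} {c : ℝ}
    (hM : ∀ g ∈ F, M g = ‖τ - Φ g‖ ^ 2 + c) : ∃! g, IsMinimizer F M g := by
  obtain ⟨_, ⟨g, hg, rfl⟩, hmin⟩ := exists_norm_eq_iInf_of_complete_convex (hne.image Φ)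
    hcl.isComplete hconv τ
  have hproj : IsProj F Φ τ g := ⟨hg, fun g' hg' =>
    (norm_eq_iInf_iff_real_inner_le_zero hconv ⟨g, hg, rfl⟩).1 hmin _ ⟨g', hg', rfl⟩⟩
  refine ⟨g, (isMinimizer_iff_isProj hconv hM g).2 hproj, fun g' hg' => ?_⟩
  have hp' := (isMinimizer_iff_isProj hconv hM g').1 hg'
  have := hp'.norm_sub_le hproj
  rw [sub_self, norm_zero, norm_le_zero_iff, sub_eq_zero] at this
  exact hinj hp'.1 hg this

lemma isProj_argmin (hinj : Set.InjOn Φ F) (hcl : IsClosed (Φ '' F))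
    (hconv : Convex ℝ (Φ '' F)) (hne : F.Nonempty) {M : (Euc p → ℝ) → ℝ} {τ : H} {c : ℝ}
    (hM : ∀ g ∈ F, M g = ‖τ - Φ g‖ ^ 2 + c) : IsProj F Φ τ (argmin F M) :=
  (isMinimizer_iff_isProj hconv hM _).1
    (Classical.epsilon_spec (existsUnique_isMinimizer hinj hcl hconv hne hM).exists)

end Minimizer

/-! ### Objectives as squared distances -/

section Objectives

variable {p q : ℕ} {H : Type*} [NormedAddCommGroup H] [InnerProductSpace ℝ H]

/-- Completing the square. The coefficient of ‖Φ g‖² is the mean weight, which is one, so the signs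
of the individual weights do not matter. -/
lemma sampleObjective_eq {ψ : Transform p} {Φ : (Euc p → ℝ) → H} {n : ℕ} (hn : 1 ≤ n)
    (X : ℕ → Euc q) (f : ℕ → Euc p → ℝ) (x : Euc q) {F : Set (Euc p → ℝ)}
    (hd : ∀ i < n, ∀ g ∈ F, dSW ψ (f i) g = ‖Φ (f i) - Φ g‖) :
    ∃ c, ∀ g ∈ F, sampleObjective ψ n X f x g =
      ‖(n : ℝ)⁻¹ • ∑ i ∈ Finset.range n, sampleWeight n X x i • Φ (f i) - Φ g‖ ^ 2 + c := by
  set s := sampleWeight n X x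
  set τ := (n : ℝ)⁻¹ • ∑ i ∈ Finset.range n, s i • Φ (f i)
  refine ⟨(n : ℝ)⁻¹ * ∑ i ∈ Finset.range n, s i * ‖Φ (f i)‖ ^ 2 - ‖τ‖ ^ 2, fun g hg => ?_⟩
  have h1 : ∀ i ∈ Finset.range n, s i * dSW ψ (f i) g ^ 2 =
      s i * ‖Φ (f i)‖ ^ 2 - 2 * (inner ℝ (s i • Φ (f i)) (Φ g) : ℝ) + s i * ‖Φ g‖ ^ 2 := by
    intro i hi
    rw [hd i (Finset.mem_range.1 hi) g hg, norm_sub_sq_real, real_inner_smul_left]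
    ring
  have hτ : (n : ℝ)⁻¹ * ∑ i ∈ Finset.range n, (inner ℝ (s i • Φ (f i)) (Φ g) : ℝ) =
      inner ℝ τ (Φ g) := by
    rw [real_inner_smul_left, sum_inner]
  have hs : (n : ℝ)⁻¹ * ∑ i ∈ Finset.range n, s i = 1 := mean_sampleWeight hn X x
  rw [sampleObjective, Finset.sum_congr rfl h1, Finset.sum_add_distrib, Finset.sum_sub_distrib,
    ← Finset.mul_sum, ← Finset.sum_mul, norm_sub_sq_real, ← hτ]
  linear_combination ‖Φ g‖ ^ 2 * hs

variable {Ω : Type*} [MeasurableSpace Ω] {P : Measure Ω} [IsProbabilityMeasure P] [CompleteSpace H]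

/-- The population version of the same completion of the square; boundedness of the embedded
densities makes every term integrable. -/
lemma popObjective_eq {ψ : Transform p} {Φ : (Euc p → ℝ) → H} {X : Ω → Euc q}
    {f : Ω → Euc p → ℝ} {F : Set (Euc p → ℝ)} {K : ℝ} (hX : MemLp X 2 P)
    (hV : AEStronglyMeasurable (fun ω => Φ (f ω)) P) (hK : ∀ ω, ‖Φ (f ω)‖ ≤ K)
    (hd : ∀ ω, ∀ g ∈ F, dSW ψ (f ω) g = ‖Φ (f ω) - Φ g‖) (x : Euc q) :
    ∃ c, ∀ g ∈ F, popObjective P ψ X f x g =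
      ‖momentReg (popMoment P X fun ω => Φ (f ω)) x - Φ g‖ ^ 2 + c := by
  have hXI : ∀ a, Integrable (fun ω => X ω a) P := fun a =>
    (memLp_apply hX a).integrable (by norm_num)
  have hVI : Integrable (fun ω => Φ (f ω)) P := Integrable.of_bound hV K (ae_of_all _ hK)
  have hV2 : Integrable (fun ω => ‖Φ (f ω)‖ ^ 2) P := by
    refine Integrable.of_bound (hV.norm.pow 2) (K ^ 2) (ae_of_all _ fun ω => ?_)
    rw [norm_pow, norm_norm]
    exact pow_le_pow_left₀ (norm_nonneg _) (hK ω) 2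
  obtain ⟨hI1, hτ⟩ := integrable_weight_smul (V := fun ω => Φ (f ω)) hX x hVI
    (fun a => (hXI a).smul_bdd K hV (ae_of_all _ hK))
  obtain ⟨hI2, -⟩ := integrable_weight_smul (V := fun ω => ‖Φ (f ω)‖ ^ 2) hX x hV2
    (fun a => (hXI a).smul_bdd (K ^ 2) hV2.1 (ae_of_all _ fun ω => by
      rw [norm_pow, norm_norm]
      exact pow_le_pow_left₀ (norm_nonneg _) (hK ω) 2))
  obtain ⟨hI3, h1⟩ := integrable_weight hX x
  set τ := momentReg (popMoment P X fun ω => Φ (f ω)) x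
  refine ⟨∫ ω, weight P X x ω • ‖Φ (f ω)‖ ^ 2 ∂P - ‖τ‖ ^ 2, fun g hg => ?_⟩
  have h2 : ∀ ω, weight P X x ω * dSW ψ (f ω) g ^ 2 =
      weight P X x ω • ‖Φ (f ω)‖ ^ 2 - 2 * (inner ℝ (weight P X x ω • Φ (f ω)) (Φ g) : ℝ) +
        weight P X x ω * ‖Φ g‖ ^ 2 := by
    intro ω
    rw [hd ω g hg, norm_sub_sq_real, real_inner_smul_left, smul_eq_mul]
    ring
  have hI4 : Integrable (fun ω => (inner ℝ (weight P X x ω • Φ (f ω)) (Φ g) : ℝ)) P :=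
    hI1.inner_const (Φ g)
  have h3 : ∫ ω, (inner ℝ (weight P X x ω • Φ (f ω)) (Φ g) : ℝ) ∂P = inner ℝ τ (Φ g) := by
    rw [← hτ, real_inner_comm, ← integral_inner hI1]
    exact integral_congr_ae (ae_of_all _ fun ω => real_inner_comm _ _)
  have hI5 : Integrable (fun ω => weight P X x ω • ‖Φ (f ω)‖ ^ 2 -
      2 * (inner ℝ (weight P X x ω • Φ (f ω)) (Φ g) : ℝ)) P := hI2.sub (hI4.const_mul 2)
  rw [popObjective, integral_congr_ae (ae_of_all _ h2),
    integral_add hI5 (hI3.mul_const _), integral_sub hI2 (hI4.const_mul 2), integral_const_mul, integral_mul_const, h1, h3,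
    norm_sub_sq_real]
  ring

end Objectives

/-! ### Rate of the sample moments -/

section SampleMoments

variable {Ω : Type*} [MeasurableSpace Ω] {P : Measure Ω}

lemma IsBigOp.sum {ι : Type*} (s : Finset ι) {A : ι → ℕ → Ω → ℝ≥0∞} {a : ℕ → ℝ}
    (h : ∀ i ∈ s, IsBigOp P (A i) a) : IsBigOp P (fun n ω => ∑ i ∈ s, A i n ω) a := by
  classical
  induction s using Finset.induction_on with
  | empty => exact fun δ _ => ⟨1, one_pos, by simp⟩
  | insert i s hi ih =>
    simp_rw [Finset.sum_insert hi]
    exact (h i (Finset.mem_insert_self i s)).add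
      (ih fun j hj => h j (Finset.mem_insert_of_mem hj))

lemma IsBigOp.mono {A B : ℕ → Ω → ℝ≥0∞} {a : ℕ → ℝ} (hA : IsBigOp P A a)
    (h : ∀ n ω, B n ω ≤ A n ω) : IsBigOp P B a := by
  intro δ hδ
  obtain ⟨C, hC, hn⟩ := hA δ hδ
  refine ⟨C, hC, hn.mono fun n h1 => (measure_mono fun ω hω => ?_).trans h1⟩
  exact lt_of_lt_of_le hω (h n ω)

variable {W₁ W₂ : Type*} [NormedAddCommGroup W₁] [NormedAddCommGroup W₂] {a : ℕ → ℝ}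

lemma IsBigOp.prodMk {w₁ : ℕ → Ω → W₁} {w₂ : ℕ → Ω → W₂}
    (h₁ : IsBigOp P (fun n ω => ENNReal.ofReal ‖w₁ n ω‖) a)
    (h₂ : IsBigOp P (fun n ω => ENNReal.ofReal ‖w₂ n ω‖) a) :
    IsBigOp P (fun n ω => ENNReal.ofReal ‖(w₁ n ω, w₂ n ω)‖) a := by
  refine (h₁.add h₂).mono fun n ω => ?_
  rw [← ENNReal.ofReal_add (norm_nonneg _) (norm_nonneg _)]
  refine ENNReal.ofReal_le_ofReal ?_
  rw [Prod.norm_def]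
  exact max_le_add_of_nonneg (norm_nonneg _) (norm_nonneg _)

lemma IsBigOp.pi {ι : Type*} [Fintype ι] {w : ι → ℕ → Ω → W₁}
    (h : ∀ i, IsBigOp P (fun n ω => ENNReal.ofReal ‖w i n ω‖) a) :
    IsBigOp P (fun n ω => ENNReal.ofReal ‖fun i => w i n ω‖) a := by
  refine (IsBigOp.sum Finset.univ fun i _ => h i).mono fun n ω => ?_
  rw [← ENNReal.ofReal_sum_of_nonneg fun _ _ => norm_nonneg _]
  refine ENNReal.ofReal_le_ofReal ?_
  refine (pi_norm_le_iff_of_nonneg (Finset.sum_nonneg fun _ _ => norm_nonneg _)).2 fun i => ?_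
  exact Finset.single_le_sum (f := fun i => ‖w i n ω‖) (fun _ _ => norm_nonneg _)
    (Finset.mem_univ i)

variable [IsProbabilityMeasure P] {q : ℕ}
  {β : Type*} [MeasurableSpace β] {H : Type*} [NormedAddCommGroup H] [InnerProductSpace ℝ H]
  [CompleteSpace H] [SecondCountableTopology H] [MeasurableSpace H] [BorelSpace H]
  {X : Ω → Euc q} {f : Ω → β} {Xs : ℕ → Ω → Euc q} {fs : ℕ → Ω → β} {φ : β → H} {K : ℝ}

lemma isBigOp_mean_comp {β E : Type*} [MeasurableSpace β] [NormedAddCommGroup E]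
    [InnerProductSpace ℝ E] [CompleteSpace E] [SecondCountableTopology E] [MeasurableSpace E]
    [BorelSpace E] {Y : Ω → β} {Ys : ℕ → Ω → β}
    (hident : ∀ i, IdentDistrib (Ys i) Y P P) (hindep : iIndepFun Ys P) {g : β → E}
    (hg : Measurable g) (hgL : MemLp (fun ω => g (Y ω)) 2 P) :
    IsBigOp P (fun (n : ℕ) ω => ENNReal.ofReal
      ‖(n : ℝ)⁻¹ • ∑ i ∈ Finset.range n, g (Ys i ω) - ∫ ω, g (Y ω) ∂P‖)
      (fun n => (n : ℝ) ^ (-(1 / 2) : ℝ)) :=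
  isBigOp_mean (Y := fun i ω => g (Ys i ω)) hgL (fun i => (hident i).comp hg)
    (fun _ _ hij => (hindep.indepFun hij).comp hg hg)

/-- Each component is a sample mean of a square integrable vector. The embedded density is bounded,
so only X_a X_b calls for four moments of X. -/
lemma isBigOp_sampleMoment
    (hident : ∀ i, IdentDistrib (fun ω => (Xs i ω, fs i ω)) (fun ω => (X ω, f ω)) P P)
    (hindep : iIndepFun (fun i ω => (Xs i ω, fs i ω)) P) (hX : MemLp X 4 P)
    (hφ : Measurable φ) (hK : ∀ y, ‖φ y‖ ≤ K) :
    IsBigOp P (fun n ω => ENNReal.ofReal ‖sampleMoment n (fun i => Xs i ω) (fun i => φ (fs i ω)) -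
      popMoment P X fun ω => φ (f ω)‖) (fun n => (n : ℝ) ^ (-(1 / 2) : ℝ)) := by
  have hf : AEMeasurable f P := (hident 0).aemeasurable_snd.snd
  have hV : AEStronglyMeasurable (fun ω => φ (f ω)) P :=
    (hφ.comp_aemeasurable hf).aestronglyMeasurable
  have hX2 : MemLp X 2 P := hX.mono_exponent (by norm_num)
  have hcoord : ∀ a, Measurable fun y : Euc q × β => y.1 a := fun a =>
    ((EuclideanSpace.proj (𝕜 := ℝ) a).continuous.measurable).comp measurable_fst
  have hφ2 : Measurable fun y : Euc q × β => φ y.2 := hφ.comp measurable_snd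
  have hVb : MemLp (fun ω => φ (f ω)) ∞ P := memLp_top_of_bound hV K (ae_of_all _ fun _ => hK _)
  refine IsBigOp.prodMk ?_ (IsBigOp.prodMk (IsBigOp.pi fun a => ?_)
    (IsBigOp.prodMk (IsBigOp.pi fun a => ?_) (IsBigOp.pi fun a => IsBigOp.pi fun b => ?_)))
  · exact isBigOp_mean_comp hident hindep (g := fun y => φ y.2) hφ2 (hVb.mono_exponent le_top)
  · exact isBigOp_mean_comp hident hindep (g := fun y => y.1 a • φ y.2) ((hcoord a).smul hφ2) (hVb.smul (memLp_apply hX2 a))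
  · exact isBigOp_mean_comp hident hindep (g := fun y => y.1 a) (hcoord a) (memLp_apply hX2 a)
  · have : ENNReal.HolderTriple 4 4 2 := ⟨by
      rw [← two_mul, show (4 : ℝ≥0∞) = 2 * 2 by norm_num, ENNReal.mul_inv (by simp) (by simp),
        ← mul_assoc, ENNReal.mul_inv_cancel (by simp) (by simp), one_mul]⟩
    exact isBigOp_mean_comp hident hindep (g := fun y => y.1 a * y.1 b) ((hcoord a).mul (hcoord b))
      ((memLp_apply hX b).mul (memLp_apply hX a))

/-- The weight factor in Cauchy–Schwarz, the weights being at most linear in the norm of the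
predictor near the population moments. -/
lemma isBigOp_mean_sq (hX : MemLp X 2 P) (hident : ∀ i, IdentDistrib (Xs i) X P P) :
    IsBigOp P (fun (n : ℕ) ω => ENNReal.ofReal
      (((n : ℝ)⁻¹ * ∑ i ∈ Finset.range n, (1 + ‖Xs i ω‖) ^ 2)) ^ (1 / 2 : ℝ)) (fun _ => 1) := by
  have hI : Integrable (fun ω => (1 + ‖X ω‖) ^ 2) P := by
    have h1 : MemLp (fun ω => 1 + ‖X ω‖) 2 P := (memLp_const (1 : ℝ)).add hX.norm
    exact h1.integrable_sq
  have hId : ∀ i, IdentDistrib (fun ω => (1 + ‖Xs i ω‖) ^ 2) (fun ω => (1 + ‖X ω‖) ^ 2) P P :=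
    fun i => (hident i).comp (u := fun y => (1 + ‖y‖) ^ 2) (by fun_prop)
  have hIi : ∀ i, Integrable (fun ω => (1 + ‖Xs i ω‖) ^ 2) P := fun i => (hId i).integrable_iff.2 hI
  have hM : ∀ n : ℕ, Integrable
      (fun ω => (n : ℝ)⁻¹ * ∑ i ∈ Finset.range n, (1 + ‖Xs i ω‖) ^ 2) P := fun n =>
    (integrable_finsetSum _ fun i _ => hIi i).const_mul _
  refine isBigOp_of_lintegral_sq (v := ∫ ω, (1 + ‖X ω‖) ^ 2 ∂P) (fun n => ?_)
    (integral_nonneg fun _ => by positivity) (Eventually.of_forall fun _ => one_pos) ?_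
  · exact (hM n).1.aemeasurable.ennreal_ofReal.pow_const _
  · filter_upwards [eventually_gt_atTop 0] with n hn
    have hn' : (n : ℝ) ≠ 0 := by positivity
    have h2 : ∀ y : ℝ≥0∞, (y ^ (1 / 2 : ℝ)) ^ 2 = y := fun y => by
      rw [← ENNReal.rpow_natCast, ← ENNReal.rpow_mul]; norm_num
    simp_rw [h2]
    rw [← ofReal_integral_eq_lintegral_ofReal (hM n) (ae_of_all _ fun ω => by positivity),
      integral_const_mul, integral_finsetSum _ fun i _ => hIi i]
    simp_rw [(hId _).integral_eq]
    simp [hn']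

end SampleMoments

/-! ### Rates for the regression estimators -/

/-- The quantile embedding maps the class `F` injectively onto a nonempty closed convex set. -/
structure IsFrechetClass {p : ℕ} (ψ : Transform p) (F : Set (Euc p → ℝ)) (R : ℝ) : Prop where
  radius_nonneg : 0 ≤ R
  slices : SlicesIn ψ F R
  injOn : Set.InjOn (quantileEmb ψ) F
  isClosed : IsClosed (quantileEmb ψ '' F)
  convex : Convex ℝ (quantileEmb ψ '' F)
  nonempty : F.Nonempty

namespace IsFrechetClass

variable {p q : ℕ} {ψ : Transform p} {F S : Set (Euc p → ℝ)} {R R' : ℝ}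

lemma sample (hF : IsFrechetClass ψ F R) (hS : SlicesIn ψ S R') {n : ℕ} (hn : 1 ≤ n)
    (X : ℕ → Euc q) {f : ℕ → Euc p → ℝ} (hf : ∀ i < n, f i ∈ S) (x : Euc q) :
    (∃! g, IsMinimizer F (sampleObjective ψ n X f x) g) ∧
    IsProj F (quantileEmb ψ)
      ((n : ℝ)⁻¹ • ∑ i ∈ Finset.range n, sampleWeight n X x i • quantileEmb ψ (f i))
      (argmin F (sampleObjective ψ n X f x)) := by
  obtain ⟨c, hc⟩ := sampleObjective_eq hn X f x
    (fun i hi g hg => hS.dSW_eq_norm hF.slices (hf i hi) hg)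
  exact ⟨existsUnique_isMinimizer hF.injOn hF.isClosed hF.convex hF.nonempty hc,
    isProj_argmin hF.injOn hF.isClosed hF.convex hF.nonempty hc⟩

variable {Ω : Type*} [MeasurableSpace Ω] {P : Measure Ω} [IsProbabilityMeasure P]

lemma population (hF : IsFrechetClass ψ F R) {X : Ω → Euc q} {f : Ω → F} (hX : MemLp X 2 P)
    (hV : AEStronglyMeasurable (fun ω => quantileEmb ψ (f ω : Euc p → ℝ)) P) (x : Euc q) :
    (∃! g, IsMinimizer F (popObjective P ψ X (fun ω => (f ω : Euc p → ℝ)) x) g) ∧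
    IsProj F (quantileEmb ψ)
      (momentReg (popMoment P X fun ω => quantileEmb ψ (f ω : Euc p → ℝ)) x)
      (argmin F (popObjective P ψ X (fun ω => (f ω : Euc p → ℝ)) x)) := by
  obtain ⟨K, -, hK⟩ := hF.slices.exists_norm_quantileEmb_le hF.radius_nonneg
  obtain ⟨c, hc⟩ := popObjective_eq (ψ := ψ) (F := F) hX hV (fun ω => hK _ (f ω).2)
    (fun ω g hg => hF.slices.dSW_eq_norm hF.slices (f ω).2 hg) x
  exact ⟨existsUnique_isMinimizer hF.injOn hF.isClosed hF.convex hF.nonempty hc,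
    isProj_argmin hF.injOn hF.isClosed hF.convex hF.nonempty hc⟩

end IsFrechetClass

/-- Cauchy–Schwarz over the sample decouples unbounded weights from approximation errors, so no
joint behaviour of the two has to be controlled. -/
lemma sq_norm_mean_smul_le {E : Type*} [NormedAddCommGroup E] [NormedSpace ℝ E] {n : ℕ}
    (s u : ℕ → ℝ) (v : ℕ → E) {K : ℝ} (hs : ∀ i, |s i| ≤ K * u i) :
    ‖(n : ℝ)⁻¹ • ∑ i ∈ Finset.range n, s i • v i‖ ^ 2 ≤
      K ^ 2 * (((n : ℝ)⁻¹ * ∑ i ∈ Finset.range n, u i ^ 2) *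
        ((n : ℝ)⁻¹ * ∑ i ∈ Finset.range n, ‖v i‖ ^ 2)) := by
  have h1 : ‖∑ i ∈ Finset.range n, s i • v i‖ ≤ K * ∑ i ∈ Finset.range n, u i * ‖v i‖ := by
    rw [Finset.mul_sum]
    refine (norm_sum_le _ _).trans (Finset.sum_le_sum fun i _ => ?_)
    rw [norm_smul, ← mul_assoc]
    gcongr
    exact hs i
  have h2 := Finset.sum_mul_sq_le_sq_mul_sq (Finset.range n) u fun i => ‖v i‖
  rw [norm_smul, mul_pow, Real.norm_of_nonneg (by positivity)]
  calc ((n : ℝ)⁻¹) ^ 2 * ‖∑ i ∈ Finset.range n, s i • v i‖ ^ 2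
      ≤ ((n : ℝ)⁻¹) ^ 2 * (K * ∑ i ∈ Finset.range n, u i * ‖v i‖) ^ 2 := by gcongr
    _ = ((n : ℝ)⁻¹) ^ 2 * (K ^ 2 * (∑ i ∈ Finset.range n, u i * ‖v i‖) ^ 2) := by ring
    _ ≤ ((n : ℝ)⁻¹) ^ 2 * (K ^ 2 * ((∑ i ∈ Finset.range n, u i ^ 2) *
          ∑ i ∈ Finset.range n, ‖v i‖ ^ 2)) := by gcongr
    _ = _ := by ring

lemma ENNReal.sq_sqrt (y : ℝ≥0∞) : (y ^ (1 / 2 : ℝ)) ^ 2 = y := by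
  rw [← ENNReal.rpow_natCast, ← ENNReal.rpow_mul]
  norm_num

lemma ofReal_le_of_sq_le {d K C U V : ℝ} {T : ℝ≥0∞} (hd : 0 ≤ d) (hK : 0 ≤ K) (hC : 0 ≤ C)
    (hU : 0 ≤ U) (h : d ^ 2 ≤ K ^ 2 * (U * V)) (hV : ENNReal.ofReal V ≤ ENNReal.ofReal C * T) :
    ENNReal.ofReal d ≤
      ENNReal.ofReal (K * Real.sqrt C) * (ENNReal.ofReal U ^ (1 / 2 : ℝ) * T ^ (1 / 2 : ℝ)) := by
  have h1 : ENNReal.ofReal d ^ 2 ≤ (ENNReal.ofReal (K * Real.sqrt C) *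
      (ENNReal.ofReal U ^ (1 / 2 : ℝ) * T ^ (1 / 2 : ℝ))) ^ 2 := by
    rw [mul_pow, mul_pow, ENNReal.sq_sqrt, ENNReal.sq_sqrt, ← ENNReal.ofReal_pow hd,
      ← ENNReal.ofReal_pow (by positivity), mul_pow, Real.sq_sqrt hC]
    refine (ENNReal.ofReal_le_ofReal h).trans ?_
    rw [ENNReal.ofReal_mul (by positivity), ENNReal.ofReal_mul hU,
      ENNReal.ofReal_mul (p := K ^ 2) (by positivity), mul_assoc,
      mul_left_comm (ENNReal.ofReal C)]
    gcongr
  exact (ENNReal.pow_le_pow_left_iff two_ne_zero).1 h1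

/-- Deterministic bound for the weighted mean of approximations `v'` of the vectors `v`. -/
lemma ofReal_norm_momentReg_sub_le {q : ℕ} {E : Type*} [NormedAddCommGroup E] [NormedSpace ℝ E]
    {w₀ : MomentSpace q E} {r₁ r₂ K₁ K₂ B C : ℝ} (hK₁ : 0 ≤ K₁) (hK₂ : 0 ≤ K₂) (hC : 0 ≤ C)
    (hlip : ∀ w, ‖w - w₀‖ < r₁ → ∀ x : Euc q, ‖x‖ ≤ B →
      ‖momentReg w₀ x - momentReg w x‖ ≤ K₁ * ‖w - w₀‖)
    (hbd : ∀ w, ‖w - w₀‖ < r₂ → ∀ x : Euc q, ‖x‖ ≤ B → ∀ y : Euc q,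
      |momentWeight w x y| ≤ K₂ * (1 + ‖y‖))
    {n : ℕ} (hn : 1 ≤ n) (X : ℕ → Euc q) (v v' : ℕ → E) (Q : ℕ → ℝ≥0∞)
    (hQ : ∀ i < n, ENNReal.ofReal (‖v i - v' i‖ ^ 2) ≤ ENNReal.ofReal C * Q i)
    (hr : ‖sampleMoment n X v - w₀‖ < min r₁ r₂) {x : Euc q} (hx : ‖x‖ ≤ B) :
    ENNReal.ofReal ‖momentReg w₀ x -
        (n : ℝ)⁻¹ • ∑ i ∈ Finset.range n, sampleWeight n X x i • v' i‖ ≤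
      ENNReal.ofReal (max K₁ (K₂ * Real.sqrt C)) * (ENNReal.ofReal ‖sampleMoment n X v - w₀‖ +
        ENNReal.ofReal ((n : ℝ)⁻¹ * ∑ i ∈ Finset.range n, (1 + ‖X i‖) ^ 2) ^ (1 / 2 : ℝ) *
        (ENNReal.ofReal (n : ℝ)⁻¹ * ∑ i ∈ Finset.range n, Q i) ^ (1 / 2 : ℝ)) := by
  set w := sampleMoment n X v with hw
  set τ := (n : ℝ)⁻¹ • ∑ i ∈ Finset.range n, sampleWeight n X x i • v' i with hτ
  set U := (n : ℝ)⁻¹ * ∑ i ∈ Finset.range n, (1 + ‖X i‖) ^ 2 with hU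
  set T := ENNReal.ofReal (n : ℝ)⁻¹ * ∑ i ∈ Finset.range n, Q i with hT
  have h2 := hlip w (hr.trans_le (min_le_left _ _)) x hx
  -- The error splits in two: the moments move from `w₀` to `w` (bounded by `h2`), and then `v` is
  -- replaced by `v'` under the same sample weights.
  have h3 : momentReg w x - τ = (n : ℝ)⁻¹ • ∑ i ∈ Finset.range n,
      sampleWeight n X x i • (v i - v' i) := by
    rw [hτ, hw, ← mean_sampleWeight_smul hn, ← smul_sub, ← Finset.sum_sub_distrib]
    simp_rw [smul_sub]
  have h4 := sq_norm_mean_smul_le (n := n) (sampleWeight n X x)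
    (fun i => 1 + ‖X i‖) (fun i => v i - v' i) (fun i => by
      rw [sampleWeight_eq hn _ v]
      exact hbd w (hr.trans_le (min_le_right _ _)) x hx _)
  rw [← h3] at h4
  have h5 : ENNReal.ofReal ((n : ℝ)⁻¹ * ∑ i ∈ Finset.range n, ‖v i - v' i‖ ^ 2) ≤
      ENNReal.ofReal C * T := by
    rw [ENNReal.ofReal_mul (by positivity), ENNReal.ofReal_sum_of_nonneg fun _ _ => by positivity,
      hT, mul_left_comm, Finset.mul_sum (Finset.range n) Q]
    gcongr with i hi
    exact hQ i (Finset.mem_range.1 hi)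
  have h6 := ofReal_le_of_sq_le (norm_nonneg _) hK₂ hC (by positivity) h4 h5
  calc ENNReal.ofReal ‖momentReg w₀ x - τ‖
      ≤ ENNReal.ofReal (K₁ * ‖w - w₀‖ + ‖momentReg w x - τ‖) := by
        refine ENNReal.ofReal_le_ofReal ?_
        refine (norm_sub_le_norm_sub_add_norm_sub _ (momentReg w x) _).trans ?_
        gcongr
    _ ≤ ENNReal.ofReal K₁ * ENNReal.ofReal ‖w - w₀‖ + ENNReal.ofReal (K₂ * Real.sqrt C) *
          (ENNReal.ofReal U ^ (1 / 2 : ℝ) * T ^ (1 / 2 : ℝ)) := by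
        rw [ENNReal.ofReal_add (by positivity) (by positivity), ENNReal.ofReal_mul hK₁]
        gcongr
    _ ≤ _ := by
        rw [mul_add]
        gcongr
        · exact le_max_left _ _
        · exact le_max_right _ _

/-- Separability makes Borel measurable maps into L² strongly measurable, as Bochner integration of
the embedded densities requires. -/
instance {p : ℕ} : SecondCountableTopology (Lp ℝ 2 (quantileMeasure p)) := by
  have : Fact ((2 : ℝ≥0∞) ≠ ∞) := ⟨by simp⟩
  have : MeasurableSpace.CountablyGenerated (Theta p × ℝ) := inferInstance
  have := isSeparable_of_sigmaFinite (quantileMeasure p)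
  exact Lp.SecondCountableTopology

/-- Only expectations are averaged, so the errors of different densities need not be independent. -/
lemma isBigOp_sqrt_mean {Ω : Type*} [MeasurableSpace Ω] {P : Measure Ω} {Q : ℕ → ℕ → Ω → ℝ≥0∞}
    (hQm : ∀ n i, AEMeasurable (Q n i) P) {v : ℝ} (hv : 0 ≤ v)
    (hQ : ∀ᶠ n : ℕ in atTop, ∀ i < n, ∫⁻ ω, Q n i ω ∂P ≤ ENNReal.ofReal (v / n)) :
    IsBigOp P (fun (n : ℕ) ω => (ENNReal.ofReal (n : ℝ)⁻¹ *
      ∑ i ∈ Finset.range n, Q n i ω) ^ (1 / 2 : ℝ)) (fun n => (n : ℝ) ^ (-(1 / 2) : ℝ)) := by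
  have hsum : ∀ n : ℕ, AEMeasurable (fun ω => ∑ i ∈ Finset.range n, Q n i ω) P := fun n =>
    Finset.aemeasurable_fun_sum _ fun i _ => hQm n i
  refine isBigOp_of_lintegral_sq (v := v) (fun n => ((hsum n).const_mul _).pow_const _) hv ?_ ?_
  · filter_upwards [eventually_gt_atTop 0] with n hn
    positivity
  · filter_upwards [eventually_gt_atTop 0, hQ] with n hn hQn
    have hn' : (0 : ℝ) < n := by exact_mod_cast hn
    simp_rw [ENNReal.sq_sqrt]
    rw [lintegral_const_mul' _ _ ENNReal.ofReal_ne_top, lintegral_finsetSum' _ fun i _ => hQm n i]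
    calc ENNReal.ofReal (n : ℝ)⁻¹ * ∑ i ∈ Finset.range n, ∫⁻ ω, Q n i ω ∂P
        ≤ ENNReal.ofReal (n : ℝ)⁻¹ * ∑ _i ∈ Finset.range n, ENNReal.ofReal (v / n) := by
          gcongr with i hi
          exact hQn i (Finset.mem_range.1 hi)
      _ = ENNReal.ofReal ((n : ℝ)⁻¹ * (n * (v / n))) := by
          rw [Finset.sum_const, Finset.card_range, nsmul_eq_mul, ENNReal.ofReal_mul (by positivity),
            ENNReal.ofReal_mul (by positivity), ENNReal.ofReal_natCast]
      _ = _ := by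
          congr 1
          rw [← Real.rpow_natCast, ← Real.rpow_mul hn'.le]
          norm_num [Real.rpow_neg_one]
          field_simp

lemma tendsto_rpow_neg_half : Tendsto (fun n : ℕ => (n : ℝ) ^ (-(1 / 2) : ℝ)) atTop (𝓝 0) :=
  (tendsto_rpow_neg_atTop (by norm_num : (0 : ℝ) < 1 / 2)).comp tendsto_natCast_atTop_atTop

lemma tendsto_measure_compl_inter {Ω : Type*} [MeasurableSpace Ω] {P : Measure Ω}
    {A B : ℕ → Set Ω} (hA : Tendsto (fun n => P (A n)ᶜ) atTop (𝓝 0))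
    (hB : Tendsto (fun n => P (B n)ᶜ) atTop (𝓝 0)) :
    Tendsto (fun n => P (A n ∩ B n)ᶜ) atTop (𝓝 0) := by
  refine tendsto_of_tendsto_of_tendsto_of_le_of_le tendsto_const_nhds
    (by simpa using hA.add hB) (fun _ => zero_le) fun n => ?_
  dsimp only
  rw [Set.compl_inter]
  exact measure_union_le _ _

namespace IsFrechetClass

variable {p q : ℕ} {ψ : Transform p} {F S : Set (Euc p → ℝ)} {R R' : ℝ}
  {Ω : Type*} [MeasurableSpace Ω] {P : Measure Ω} [IsProbabilityMeasure P]

/-- Root-`n` rate, uniform over balls, of the regression estimator computed from densities `fhat`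
that approximate the observed random densities. -/
theorem isBigOp_dSW_argmin (hF : IsFrechetClass ψ F R) (hS : SlicesIn ψ S R')
    [MeasurableSpace (Lp ℝ 2 (quantileMeasure p))] [BorelSpace (Lp ℝ 2 (quantileMeasure p))]
    (hΦ : Measurable fun f : F => quantileEmb ψ (f : Euc p → ℝ))
    {X : Ω → Euc q} {f : Ω → F} {Xs : ℕ → Ω → Euc q} {fs : ℕ → Ω → F}
    (hident : ∀ i, IdentDistrib (fun ω => (Xs i ω, fs i ω)) (fun ω => (X ω, f ω)) P P)
    (hindep : iIndepFun (fun i ω => (Xs i ω, fs i ω)) P)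
    (hX : MemLp X 4 P) (hVar : (covMatrix P X).PosDef)
    {fhat : ℕ → ℕ → Ω → Euc p → ℝ} {G : ℕ → Set Ω}
    (hG : Tendsto (fun n => P (G n)ᶜ) atTop (𝓝 0)) {Q : ℕ → ℕ → Ω → ℝ≥0∞} {C v : ℝ} (hC : 0 ≤ C)
    (hfhat : ∀ᶠ n in atTop, ∀ ω ∈ G n, ∀ i < n, fhat n i ω ∈ S ∧
      ENNReal.ofReal (‖quantileEmb ψ (fs i ω : Euc p → ℝ) - quantileEmb ψ (fhat n i ω)‖ ^ 2) ≤
        ENNReal.ofReal C * Q n i ω)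
    (hQm : ∀ n i, AEMeasurable (Q n i) P) (hv : 0 ≤ v)
    (hQ : ∀ᶠ n : ℕ in atTop, ∀ i < n, ∫⁻ ω, Q n i ω ∂P ≤ ENNReal.ofReal (v / n)) (B : ℝ) :
    IsBigOp P (fun n ω => ⨆ x ∈ Metric.closedBall (0 : Euc q) B,
      ENNReal.ofReal (dSW ψ (argmin F (popObjective P ψ X (fun ω => (f ω : Euc p → ℝ)) x))
        (argmin F (sampleObjective ψ n (fun i => Xs i ω) (fun i => fhat n i ω) x))))
      (fun n => (n : ℝ) ^ (-(1 / 2) : ℝ)) := by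
  obtain ⟨K₀, -, hK₀⟩ := hF.slices.exists_norm_quantileEmb_le hF.radius_nonneg
  have hX2 : MemLp X 2 P := hX.mono_exponent (by norm_num)
  have hfm : AEMeasurable f P := (hident 0).aemeasurable_snd.snd
  have hV : AEStronglyMeasurable (fun ω => quantileEmb ψ (f ω : Euc p → ℝ)) P :=
    (hΦ.comp_aemeasurable hfm).aestronglyMeasurable
  set w₀ := popMoment P X fun ω => quantileEmb ψ (f ω : Euc p → ℝ) with hw₀
  set w : ℕ → Ω → MomentSpace q (Lp ℝ 2 (quantileMeasure p)) := fun n ω =>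
    sampleMoment n (fun i => Xs i ω) (fun i => quantileEmb ψ (fs i ω : Euc p → ℝ)) with hw
  have hdet : (momentCov w₀).det ≠ 0 := by
    rw [hw₀, ← covMatrix_eq hX2]
    exact hVar.det_pos.ne'
  have hD : IsBigOp P (fun n ω => ENNReal.ofReal ‖w n ω - w₀‖)
      (fun n => (n : ℝ) ^ (-(1 / 2) : ℝ)) :=
    isBigOp_sampleMoment (β := F) (φ := fun y => quantileEmb ψ (y : Euc p → ℝ)) hident hindep hX hΦ
      (fun y => hK₀ _ y.2)
  obtain ⟨r₁, K₁, hr₁, hK₁, hlip⟩ := exists_lipschitz_momentReg hdet B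
  obtain ⟨r₂, K₂, hr₂, hK₂, hbd⟩ := exists_bound_momentWeight hdet B
  have hr : 0 < min r₁ r₂ := lt_min hr₁ hr₂
  have hA := isBigOp_mean_sq (P := P) (Xs := Xs) hX2 fun i => (hident i).comp measurable_fst
  have hB := isBigOp_sqrt_mean hQm hv hQ
  -- The good event intersects `G n` with the event that the sample moments lie where both the
  -- Lipschitz bound and the weight bound are valid.
  refine IsBigOp.of_le_on (hD.add (hA.mul hB))
    (tendsto_measure_compl_inter (hD.tendsto_measure tendsto_rpow_neg_half hr) hG)
    (K := max K₁ (K₂ * Real.sqrt C)) ?_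
  filter_upwards [hfhat, eventually_ge_atTop 1] with n hfn hn ω hω
  have hωr : ‖w n ω - w₀‖ < min r₁ r₂ := (ENNReal.ofReal_lt_ofReal_iff hr).1 hω.1
  refine iSup₂_le fun x hx => ?_
  rw [mem_closedBall_zero_iff] at hx
  have hm := (hF.population hX2 hV x).2
  have hmh := (hF.sample hS hn (fun i => Xs i ω) (fun i hi => (hfn ω hω.2 i hi).1) x).2
  rw [hF.slices.dSW_eq_norm hF.slices hm.1 hmh.1]
  exact (ENNReal.ofReal_le_ofReal (hm.norm_sub_le hmh)).trans
    (ofReal_norm_momentReg_sub_le hK₁ hK₂ hC hlip hbd hn (fun i => Xs i ω)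
      (fun i => quantileEmb ψ (fs i ω : Euc p → ℝ)) (fun i => quantileEmb ψ (fhat n i ω))
      (fun i => Q n i ω) (fun i hi => (hfn ω hω.2 i hi).2) hωr hx)

end IsFrechetClass

/-! ### Transfer from conditional sampling to product measures -/

section Transfer

/-- If the vector `Z` is, conditionally on `T`, a sample from `μ (T ω)`, bounds for product measures
transfer to `Z`. -/
theorem lintegral_le_of_forall_pi {Ω Ω₀ E : Type*} [MeasurableSpace Ω] [MeasurableSpace Ω₀]
    [MeasurableSpace E] {P : Measure Ω} [IsProbabilityMeasure P] {T : Ω → Ω₀} (hT : Measurable T)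
    {N : ℕ} {Z : Fin N → Ω → E} (hZ : ∀ j, Measurable (Z j)) {μ : Ω₀ → Measure E}
    [∀ a, IsProbabilityMeasure (μ a)] (hμ : ∀ B, MeasurableSet B → Measurable fun a => μ a B)
    (hrect : ∀ A, MeasurableSet A → ∀ B : Fin N → Set E, (∀ j, MeasurableSet (B j)) →
      P (T ⁻¹' A ∩ ⋂ j, Z j ⁻¹' B j) = ∫⁻ ω in T ⁻¹' A, ∏ j, μ (T ω) (B j) ∂P)
    {G : Ω₀ × (Fin N → E) → ℝ≥0∞} (hG : Measurable G) {c : ℝ≥0∞}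
    (hc : ∀ a, ∫⁻ y, G (a, y) ∂Measure.pi (fun _ => μ a) ≤ c) :
    ∫⁻ ω, G (T ω, fun j => Z j ω) ∂P ≤ c := by
  -- Measurability of the product measure in its parameter is checked on boxes, where it is a finite
  -- product of measurable functions.
  let κ : Kernel Ω₀ (Fin N → E) := ⟨fun a => Measure.pi fun _ => μ a, by
    refine Measurable.measure_of_isPiSystem_of_isProbabilityMeasure generateFrom_pi.symm
      isPiSystem_pi ?_
    rintro _ ⟨B, hB, rfl⟩
    simp_rw [Measure.pi_pi]
    exact Finset.measurable_prod _ fun j _ => hμ _ (hB j (Set.mem_univ j))⟩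
  have hκ : ∀ a, κ a = Measure.pi fun _ => μ a := fun a => rfl
  have : IsMarkovKernel κ := ⟨fun a => by rw [hκ]; infer_instance⟩
  have hZ' : Measurable fun ω => fun j => Z j ω := measurable_pi_lambda _ hZ
  have := Measure.isProbabilityMeasure_map (μ := P) hT.aemeasurable
  have := Measure.isProbabilityMeasure_map (μ := P) (hT.prodMk hZ').aemeasurable
  -- The rectangle identity says that κ disintegrates the joint law: both sides agree on a
  -- generating π-system.
  have hlaw : P.map (fun ω => (T ω, fun j => Z j ω)) = (P.map T) ⊗ₘ κ := by
    refine ext_of_generate_finite _ (generateFrom_eq_prod MeasurableSpace.generateFrom_measurableSet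
      (generateFrom_pi (α := fun _ : Fin N => E)) isCountablySpanning_measurableSet
      (.pi fun _ => isCountablySpanning_measurableSet)).symm
      (MeasurableSpace.isPiSystem_measurableSet.prod isPiSystem_pi) ?_ (by simp)
    rintro _ ⟨A, hA, _, ⟨B, hB, rfl⟩, rfl⟩
    have hB' : ∀ j, MeasurableSet (B j) := fun j => hB j (Set.mem_univ j)
    have hpre : (fun ω => (T ω, fun j => Z j ω)) ⁻¹' (A ×ˢ Set.univ.pi B) =
        T ⁻¹' A ∩ ⋂ j, Z j ⁻¹' B j := by
      ext ω
      simp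
    rw [Measure.map_apply (hT.prodMk hZ') (hA.prod (.univ_pi hB')), hpre, hrect A hA B hB',
      Measure.compProd_apply_prod hA (.univ_pi hB')]
    simp_rw [hκ, Measure.pi_pi]
    rw [setLIntegral_map hA (Finset.measurable_prod _ fun j _ => hμ _ (hB' j)) hT]
  calc ∫⁻ ω, G (T ω, fun j => Z j ω) ∂P
      = ∫⁻ y, G y ∂(P.map fun ω => (T ω, fun j => Z j ω)) := (lintegral_map hG (hT.prodMk hZ')).symm
    _ = ∫⁻ a, ∫⁻ y, G (a, y) ∂κ a ∂(P.map T) := by rw [hlaw, Measure.lintegral_compProd hG]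
    _ ≤ ∫⁻ _, c ∂(P.map T) := lintegral_mono fun a => hc a
    _ = c := by simp

variable {Ω : Type*} {p : ℕ}

/-- The distribution with density `h`. -/
def densityMeasure (h : Euc p → ℝ) : Measure (Euc p) :=
  volume.withDensity fun z => ENNReal.ofReal (h z)

lemma densityMeasure_apply {h : Euc p → ℝ} (h0 : ∀ z, 0 ≤ h z) (hi : Integrable h volume)
    {B : Set (Euc p)} (hB : MeasurableSet B) :
    densityMeasure h B = ENNReal.ofReal (∫ z in B, h z) := by
  rw [densityMeasure, withDensity_apply _ hB,
    ofReal_integral_eq_lintegral_ofReal hi.integrableOn (ae_of_all _ h0)]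

lemma isProbabilityMeasure_densityMeasure {h : Euc p → ℝ} (h0 : ∀ z, 0 ≤ h z)
    (hi : Integrable h volume) (h1 : ∫ z, h z = 1) : IsProbabilityMeasure (densityMeasure h) :=
  ⟨by rw [densityMeasure_apply h0 hi .univ, setIntegral_univ, h1, ENNReal.ofReal_one]⟩

/-- The marginal statement for the i-th sample: all other observations are left unconstrained, and
their factors equal one because the densities integrate to one. -/
lemma IsSamplingGiven.measure_inter {𝓐 : MeasurableSpace Ω} [mΩ : MeasurableSpace Ω]
    {P : Measure Ω} [IsProbabilityMeasure P] {h : ℕ → Ω → Euc p → ℝ} {N : ℕ → ℕ → ℕ}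
    {Z : ℕ → ℕ → ℕ → Ω → Euc p} (hS : IsSamplingGiven 𝓐 P h N Z) (h0 : ∀ i ω z, 0 ≤ h i ω z)
    (hi : ∀ i ω, Integrable (h i ω) volume) (h1 : ∀ i ω, ∫ z, h i ω z = 1) {n i : ℕ} (hin : i < n)
    {A : Set Ω} (hA : MeasurableSet[𝓐] A) {B : Fin (N n i) → Set (Euc p)}
    (hB : ∀ j, MeasurableSet (B j)) :
    P (A ∩ ⋂ j : Fin (N n i), Z n i j ⁻¹' B j) =
      ∫⁻ ω in A, ∏ j, densityMeasure (h i ω) (B j) ∂P := by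
  classical
  let B' : ℕ → ℕ → Set (Euc p) := fun i' j =>
    if hj : i' = i ∧ j < N n i then B ⟨j, hj.2⟩ else Set.univ
  have hB' : ∀ i' j, MeasurableSet (B' i' j) := by
    intro i' j
    by_cases hj : i' = i ∧ j < N n i
    · simp only [B', dif_pos hj]; exact hB _
    · simp only [B', dif_neg hj]; exact .univ
  have hBj : ∀ j : Fin (N n i), B' i j = B j := fun j => by simp [B']
  set E := ⋂ i ∈ Finset.range n, ⋂ j ∈ Finset.range (N n i), Z n i j ⁻¹' B' i j with hE
  have hEeq : E = ⋂ j : Fin (N n i), Z n i j ⁻¹' B j := by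
    ext ω
    simp only [hE, Set.mem_iInter, Finset.mem_range, Set.mem_preimage]
    constructor
    · intro H j
      rw [← hBj]
      exact H i hin j j.2
    · intro H i' _ j _
      by_cases hj : i' = i ∧ j < N n i
      · obtain ⟨rfl, hj2⟩ := hj
        exact (hBj ⟨j, hj2⟩) ▸ H ⟨j, hj2⟩
      · simp [B', dif_neg hj]
  have hEm : MeasurableSet E :=
    Finset.measurableSet_biInter _ fun i _ => Finset.measurableSet_biInter _ fun j _ =>
      hS.measurable_obs n i j (hB' i j)
  have hprod : ∀ ω, ∏ i ∈ Finset.range n, ∏ j ∈ Finset.range (N n i), ∫ z in B' i j, h i ω z =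
      ∏ j : Fin (N n i), ∫ z in B j, h i ω z := by
    intro ω
    rw [Finset.prod_eq_single_of_mem i (Finset.mem_range.2 hin), Finset.prod_range]
    · simp_rw [hBj]
    · intro i' _ hne
      refine Finset.prod_eq_one fun j _ => ?_
      have : B' i' j = Set.univ := by simp [B', hne]
      rw [this, setIntegral_univ, h1]
  have hcond := hS.condLaw n B' hB'
  simp_rw [hprod] at hcond
  have hint : Integrable (fun ω => ∏ j : Fin (N n i), ∫ z in B j, h i ω z) P :=
    integrable_condExp.congr hcond
  have hindI : Integrable (E.indicator fun _ => (1 : ℝ)) P := (integrable_const 1).indicator hEm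
  have h2 : ∫ ω in A, E.indicator (fun _ => (1 : ℝ)) ω ∂P =
      ∫ ω in A, (∏ j : Fin (N n i), ∫ z in B j, h i ω z) ∂P := by
    rw [← setIntegral_condExp hS.le hindI hA]
    exact integral_congr_ae (ae_restrict_of_ae hcond)
  rw [← hEeq]
  have h3 : ∫ ω in A, E.indicator (fun _ => (1 : ℝ)) ω ∂P = (P (A ∩ E)).toReal := by
    rw [setIntegral_indicator hEm]
    simp [measureReal_def]
  rw [← ENNReal.ofReal_toReal (measure_ne_top P (A ∩ E)), ← h3, h2,
    ofReal_integral_eq_lintegral_ofReal hint.integrableOn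
      (ae_of_all _ fun ω => Finset.prod_nonneg fun j _ => integral_nonneg (h0 i ω))]
  refine lintegral_congr fun ω => ?_
  rw [ENNReal.ofReal_prod_of_nonneg fun j _ => integral_nonneg (h0 i ω)]
  exact Finset.prod_congr rfl fun j _ => (densityMeasure_apply (h0 i ω) (hi i ω) (hB j)).symm

/-- At a fixed point z the error involves the random density only through the number `h i ω z`, so Γ
takes a real argument and no σ-algebra on densities is needed. -/
theorem IsSamplingGiven.lintegral_le {𝓐 : MeasurableSpace Ω} [mΩ : MeasurableSpace Ω]
    {P : Measure Ω} [IsProbabilityMeasure P] {h : ℕ → Ω → Euc p → ℝ} {N : ℕ → ℕ → ℕ}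
    {Z : ℕ → ℕ → ℕ → Ω → Euc p} (hS : IsSamplingGiven 𝓐 P h N Z) (h0 : ∀ i ω z, 0 ≤ h i ω z)
    (hi : ∀ i ω, Integrable (h i ω) volume) (h1 : ∀ i ω, ∫ z, h i ω z = 1) {n i : ℕ} (hin : i < n)
    (z : Euc p) {Γ : ℝ × (Fin (N n i) → Euc p) → ℝ≥0∞} (hΓ : Measurable Γ) {c : ℝ≥0∞}
    (hc : ∀ ω, ∫⁻ y, Γ (h i ω z, y) ∂Measure.pi (fun _ => densityMeasure (h i ω)) ≤ c) :
    ∫⁻ ω, Γ (h i ω z, fun j => Z n i j ω) ∂P ≤ c := by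
  have hprob : ∀ ω, IsProbabilityMeasure (densityMeasure (h i ω)) := fun ω =>
    isProbabilityMeasure_densityMeasure (h0 i ω) (hi i ω) (h1 i ω)
  have hm := hS.measurable_density i
  -- Conditioning on 𝓐 is expressed by letting T be the identity from Ω with its full σ-algebra to Ω
  -- with 𝓐.
  refine @lintegral_le_of_forall_pi Ω Ω (Euc p) mΩ 𝓐 _ P _ id (measurable_id'' hS.le) (N n i)
    (fun j => Z n i j) (fun j => hS.measurable_obs n i j) (fun ω => densityMeasure (h i ω)) hprob
    ?_ ?_ (fun y => Γ (h i y.1 z, y.2)) ?_ c hc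
  · intro B hB
    simp_rw [densityMeasure, withDensity_apply _ hB]
    exact @Measurable.lintegral_prod_right' Ω (Euc p) 𝓐 _ (volume.restrict B) _ _
      hm.ennreal_ofReal
  · intro A hA B hB
    exact hS.measure_inter h0 hi h1 hin hA hB
  · have hz : Measurable[𝓐] fun ω => h i ω z :=
      hm.comp (@measurable_prodMk_right _ _ 𝓐 _ z)
    exact hΓ.comp ((hz.comp (@measurable_fst _ _ 𝓐 _)).prodMk (@measurable_snd _ _ 𝓐 _))

end Transfer

/-! ### Bias and variance of kernel density estimates -/

section Kernel

variable {p k : ℕ} {D : Set (Euc p)} {ε M L : ℝ} {h κ : Euc p → ℝ}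

lemma integral_scaled_kernel_mul (φ h : Euc p → ℝ) {b : ℝ} (hb : 0 < b) (z : Euc p) :
    ∫ y, φ (b⁻¹ • (z - y)) * h y = b ^ p * ∫ u, φ u * h (z - b • u) := by
  have h1 : ∫ y, φ (b⁻¹ • (z - y)) * h y = ∫ w, φ (b⁻¹ • w) * h (z - w) := by
    rw [← integral_sub_left_eq_self (fun w => φ (b⁻¹ • w) * h (z - w)) volume z]
    simp
  have h2 : ∀ w, φ (b⁻¹ • w) * h (z - w) = (fun u => φ u * h (z - b • u)) (b⁻¹ • w) := by
    intro w
    simp [smul_smul, hb.ne']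
  rw [h1, integral_congr_ae (ae_of_all _ h2)]
  refine (Measure.integral_comp_smul volume (fun u => φ u * h (z - b • u)) b⁻¹).trans ?_
  simp [abs_of_pos hb]

namespace IsUntruncated

lemma norm_fderiv_le (hh : IsUntruncated D k ε M L h) (hk : 1 ≤ k) {x : Euc p}
    (hx : x ∈ Metric.thickening ε D) : ‖fderiv ℝ h x‖ ≤ L := by
  have h1 := hh.deriv_bound 1 le_rfl hk x hx
  rwa [iteratedFDerivWithin_of_isOpen 1 Metric.isOpen_thickening hx, norm_iteratedFDeriv_one] at h1

lemma norm_fderiv_fderiv_le (hh : IsUntruncated D k ε M L h) (hk : 2 ≤ k) {x : Euc p}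
    (hx : x ∈ Metric.thickening ε D) : ‖fderiv ℝ (fderiv ℝ h) x‖ ≤ L := by
  have h1 := hh.deriv_bound 2 one_le_two hk x hx
  rwa [iteratedFDerivWithin_of_isOpen 2 Metric.isOpen_thickening hx,
    ← norm_iteratedFDeriv_fderiv, norm_iteratedFDeriv_one] at h1

lemma contDiffAt (hh : IsUntruncated D k ε M L h) {x : Euc p}
    (hx : x ∈ Metric.thickening ε D) : ContDiffAt ℝ k h x :=
  hh.contDiffOn.contDiffAt (Metric.isOpen_thickening.mem_nhds hx)

lemma nonneg_const (hh : IsUntruncated D k ε M L h) (hk : 1 ≤ k) {x : Euc p}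
    (hx : x ∈ Metric.thickening ε D) : 0 ≤ L :=
  (norm_nonneg _).trans (hh.norm_fderiv_le hk hx)

/-- Second order Taylor bound. -/
lemma abs_sub_sub_fderiv_le (hh : IsUntruncated D k ε M L h) (hk : 2 ≤ k) {z w : Euc p}
    (hball : Metric.closedBall z ‖w‖ ⊆ Metric.thickening ε D) :
    |h (z + w) - h z - fderiv ℝ h z w| ≤ L * ‖w‖ ^ 2 := by
  set s := Metric.closedBall z ‖w‖ with hs
  have hz : z ∈ s := Metric.mem_closedBall_self (norm_nonneg w)
  have hk1 : (1 : WithTop ℕ∞) ≤ (k : WithTop ℕ∞) := by exact_mod_cast one_le_two.trans hk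
  have hk2 : (2 : WithTop ℕ∞) ≤ (k : WithTop ℕ∞) := by exact_mod_cast hk
  have hconv : Convex ℝ s := convex_closedBall _ _
  have hL := hh.nonneg_const (one_le_two.trans hk) (hball hz)
  have hd : ∀ x ∈ s, ‖fderiv ℝ h x - fderiv ℝ h z‖ ≤ L * ‖w‖ := by
    intro x hx
    have h1 := hconv.norm_image_sub_le_of_norm_fderiv_le (𝕜 := ℝ) (f := fderiv ℝ h) (C := L)
      (fun y hy => (((hh.contDiffAt (hball hy)).of_le hk2).fderiv_right (m := 1)
        (by norm_num)).differentiableAt (by norm_num))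
      (fun y hy => hh.norm_fderiv_fderiv_le hk (hball hy)) hz hx
    refine h1.trans ?_
    gcongr
    simpa [hs, dist_eq_norm] using hx
  have hw : z + w ∈ s := by simp [hs]
  have h2 := hconv.norm_image_sub_le_of_norm_hasFDerivWithin_le' (f := h) (f' := fderiv ℝ h)
    (φ := fderiv ℝ h z) (C := L * ‖w‖)
    (fun y hy => (((hh.contDiffAt (hball hy)).differentiableAt
      (ne_of_gt (lt_of_lt_of_le (by norm_num) hk1))).hasFDerivAt).hasFDerivWithinAt)
    hd hz hw
  simp only [add_sub_cancel_left, Real.norm_eq_abs] at h2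
  refine h2.trans (le_of_eq (by ring))

lemma abs_sub_le (hh : IsUntruncated D k ε M L h) (hk : 1 ≤ k) {z w : Euc p} {r : ℝ}
    (hball : Metric.ball z r ⊆ Metric.thickening ε D) (hw : w ∈ Metric.ball z r) :
    |h w - h z| ≤ L * ‖w - z‖ := by
  have hk1 : (1 : WithTop ℕ∞) ≤ (k : WithTop ℕ∞) := by exact_mod_cast hk
  exact (convex_ball z r).norm_image_sub_le_of_norm_fderiv_le (𝕜 := ℝ) (f := h) (C := L)
      (fun y hy => (hh.contDiffAt (hball hy)).differentiableAt
        (ne_of_gt (lt_of_lt_of_le (by norm_num) hk1)))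
      (fun y hy => hh.norm_fderiv_le hk (hball hy))
      (Metric.mem_ball_self (Metric.pos_of_mem_ball hw)) hw

end IsUntruncated

lemma closedBall_subset_thickening {z : Euc p} (hz : z ∈ Metric.thickening (ε / 2) D) {r : ℝ}
    (hr : r ≤ ε / 2) : Metric.closedBall z r ⊆ Metric.thickening ε D := by
  intro x hx
  rw [Metric.mem_thickening_iff] at hz ⊢
  obtain ⟨d, hd, hzd⟩ := hz
  exact ⟨d, hd, by linarith [dist_triangle x z d, Metric.mem_closedBall.1 hx]⟩

/-- Bounds for a kernel that all constants of the estimates depend on. -/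
structure KernelBound (κ : Euc p → ℝ) (K ρ : ℝ) : Prop where
  pos : 0 < K
  le : ∀ u, κ u ≤ K
  radius_pos : 0 < ρ
  support : ∀ u, ρ < ‖u‖ → κ u = 0

lemma K1.exists_kernelBound (hκ : K1 k κ) : ∃ K ρ, KernelBound κ K ρ := by
  obtain ⟨K, hK⟩ := hκ.bounded
  obtain ⟨r, hr⟩ := hκ.compactSupport.isCompact.isBounded.subset_closedBall (0 : Euc p)
  refine ⟨max K 1, max r 1, by positivity, fun u => (hK u).trans (le_max_left _ _), by positivity,
    fun u hu => ?_⟩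
  by_contra h
  have := hr (subset_tsupport κ h)
  rw [mem_closedBall_zero_iff] at this
  linarith [le_max_left r 1]

/-- Integral of the kernel centred at `z` against the density `h`. -/
def kernelMean (κ h : Euc p → ℝ) (b : ℝ) (z : Euc p) : ℝ := ∫ y, κ (b⁻¹ • (z - y)) * h y

section Bounds

variable {K ρ b : ℝ} {z : Euc p}

/-- Nothing bounds h away from D. The kernel vanishes beyond radius ρ, and `b * ρ ≤ ε / 2` keeps all
relevant arguments where h is at most M. -/
lemma integrable_kernel_mul_shift (hκ : K1 k κ) (hB : KernelBound κ K ρ)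
    (hh : IsUntruncated D k ε M L h) (hb : 0 < b) (hbρ : b * ρ ≤ ε / 2)
    (hz : z ∈ Metric.thickening (ε / 2) D) :
    Integrable (fun u => κ u * h (z - b • u)) volume ∧
      ∀ u, κ u * h (z - b • u) ≤ κ u * M := by
  have hle : ∀ u, κ u * h (z - b • u) ≤ κ u * M := by
    intro u
    rcases lt_or_ge ρ ‖u‖ with hu | hu
    · simp [hB.support u hu]
    · refine mul_le_mul_of_nonneg_left (hh.bounds _ (closedBall_subset_thickening hz hbρ ?_)).2
        (hκ.nonneg u)
      rw [Metric.mem_closedBall, dist_eq_norm]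
      simp only [sub_sub_cancel_left, norm_neg, norm_smul, Real.norm_of_nonneg hb.le]
      gcongr
  refine ⟨(hκ.integrable.mul_const M).mono' ?_ (ae_of_all _ fun u => ?_), hle⟩
  · have hmeas : AEStronglyMeasurable (fun u => h (z - b • u)) volume := by
      have h1 : Integrable (fun u => h (z - u)) volume := hh.integrable.comp_sub_left z
      exact ((integrable_comp_smul_iff volume (fun u => h (z - u)) hb.ne').2 h1).1
    exact hκ.integrable.1.mul hmeas
  · rw [Real.norm_of_nonneg (mul_nonneg (hκ.nonneg u) (hh.nonneg _))]
    exact hle u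

lemma kernelMean_le (hκ : K1 k κ) (hB : KernelBound κ K ρ)
    (hh : IsUntruncated D k ε M L h) (hb : 0 < b) (hbρ : b * ρ ≤ ε / 2)
    (hz : z ∈ Metric.thickening (ε / 2) D) : kernelMean κ h b z ≤ M * b ^ p := by
  obtain ⟨hI, hle⟩ := integrable_kernel_mul_shift hκ hB hh hb hbρ hz
  rw [kernelMean, integral_scaled_kernel_mul κ h hb, mul_comm M]
  have h1 := integral_mono hI (hκ.integrable.mul_const M) hle
  rw [integral_mul_const, hκ.integral_one, one_mul] at h1
  gcongr

/-- Reflection changes the sign of the integrand by symmetry of the kernel. -/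
lemma integral_kernel_mul_linear (hκ : K1 k κ) (ℓ : Euc p →L[ℝ] ℝ) : ∫ u, κ u * ℓ u = 0 := by
  have h1 := integral_neg_eq_self (fun u => κ u * ℓ u) volume
  simp only [hκ.symmetric, map_neg, mul_neg, integral_neg] at h1
  linarith

/-- Bias of order b². The first-order Taylor term can be inserted for free because its kernel
integral vanishes, and the remainder is quadratic. -/
lemma abs_kernelMean_sub_le (hκ : K1 k κ) (hB : KernelBound κ K ρ)
    (hh : IsUntruncated D k ε M L h) (hk : 2 ≤ k) (hb : 0 < b) (hbρ : b * ρ ≤ ε / 2)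
    (hz : z ∈ Metric.thickening (ε / 2) D) :
    |kernelMean κ h b z / b ^ p - h z| ≤ L * ρ ^ 2 * b ^ 2 := by
  obtain ⟨hI, -⟩ := integrable_kernel_mul_shift hκ hB hh hb hbρ hz
  have hL : 0 ≤ L := hh.nonneg_const (one_le_two.trans hk)
    (closedBall_subset_thickening hz hbρ
      (Metric.mem_closedBall_self (mul_nonneg hb.le hB.radius_pos.le)))
  have hbp : b ^ p ≠ 0 := by positivity
  set ℓ := fderiv ℝ h z
  have hκℓ : Integrable (fun u => κ u * ℓ u) volume := by
    have hcont : Continuous fun u => κ u * ℓ u := hκ.contDiff.continuous.mul ℓ.continuous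
    exact hcont.integrable_of_hasCompactSupport hκ.compactSupport.mul_right
  have h1 : kernelMean κ h b z / b ^ p - h z =
      ∫ u, (κ u * h (z - b • u) - κ u * h z + b * (κ u * ℓ u)) := by
    have hI2 := hκ.integrable.mul_const (h z)
    have hI3 : Integrable (fun u => κ u * h (z - b • u) - κ u * h z) volume := hI.sub hI2
    rw [integral_add hI3 (hκℓ.const_mul b), integral_sub hI hI2, integral_const_mul,
      integral_kernel_mul_linear hκ, integral_mul_const, hκ.integral_one, kernelMean,
      integral_scaled_kernel_mul κ h hb]
    field_simp
    ring
  rw [h1, ← Real.norm_eq_abs]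
  calc ‖∫ u, (κ u * h (z - b • u) - κ u * h z + b * (κ u * ℓ u))‖
      ≤ ∫ u, κ u * (L * ρ ^ 2 * b ^ 2) := by
        refine norm_integral_le_of_norm_le (hκ.integrable.mul_const _) (ae_of_all _ fun u => ?_)
        rcases lt_or_ge ρ ‖u‖ with hu | hu
        · simp [hB.support u hu]
        · have hnorm : ‖-(b • u)‖ ≤ b * ρ := by
            rw [norm_neg, norm_smul, Real.norm_of_nonneg hb.le]
            gcongr
          have h2 := hh.abs_sub_sub_fderiv_le hk (z := z) (w := -(b • u))
            (closedBall_subset_thickening hz (hnorm.trans hbρ))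
          rw [← sub_eq_add_neg, map_neg, map_smul, smul_eq_mul, sub_neg_eq_add] at h2
          have h3 : κ u * h (z - b • u) - κ u * h z + b * (κ u * ℓ u) =
              κ u * (h (z - b • u) - h z + b * ℓ u) := by ring
          rw [h3, norm_mul, Real.norm_of_nonneg (hκ.nonneg u), Real.norm_eq_abs]
          refine mul_le_mul_of_nonneg_left (h2.trans ?_) (hκ.nonneg u)
          calc L * ‖-(b • u)‖ ^ 2 ≤ L * (b * ρ) ^ 2 := by gcongr
            _ = L * ρ ^ 2 * b ^ 2 := by ring
    _ = L * ρ ^ 2 * b ^ 2 := by rw [integral_mul_const, hκ.integral_one, one_mul]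

end Bounds

/-! ### Product-measure bounds for kernel density estimates -/

section Product

variable {K ρ b : ℝ} {z : Euc p}

lemma IsUntruncated.isProbabilityMeasure (hh : IsUntruncated D k ε M L h) :
    IsProbabilityMeasure (densityMeasure h) :=
  isProbabilityMeasure_densityMeasure hh.nonneg hh.integrable hh.integral_one

lemma integral_densityMeasure (hh : IsUntruncated D k ε M L h) (φ : Euc p → ℝ) :
    ∫ y, φ y ∂densityMeasure h = ∫ y, φ y * h y := by
  rw [densityMeasure, integral_withDensity_eq_integral_toReal_smul₀
    hh.integrable.1.aemeasurable.ennreal_ofReal (ae_of_all _ fun _ => ENNReal.ofReal_lt_top)]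
  refine integral_congr_ae (ae_of_all _ fun y => ?_)
  simp [ENNReal.toReal_ofReal (hh.nonneg y), mul_comm]

lemma continuous_kernel_comp (hκ : K1 k κ) : Continuous fun y => κ (b⁻¹ • (z - y)) :=
  hκ.contDiff.continuous.comp (by fun_prop)

lemma abs_kernel_le (hκ : K1 k κ) (hB : KernelBound κ K ρ) (u : Euc p) : |κ u| ≤ K := by
  rw [abs_of_nonneg (hκ.nonneg u)]
  exact hB.le u

lemma integrable_kernel_comp (hκ : K1 k κ) (hB : KernelBound κ K ρ)
    (hh : IsUntruncated D k ε M L h) :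
    Integrable (fun y => κ (b⁻¹ • (z - y))) (densityMeasure h) := by
  have := hh.isProbabilityMeasure
  exact Integrable.of_bound (continuous_kernel_comp hκ).aestronglyMeasurable K
    (ae_of_all _ fun y => abs_kernel_le hκ hB _)

/-- Since κ² ≤ K κ, the second moment inherits the factor b^p of the mean. -/
lemma integral_kernel_sq_le (hκ : K1 k κ) (hB : KernelBound κ K ρ)
    (hh : IsUntruncated D k ε M L h) (hb : 0 < b) (hbρ : b * ρ ≤ ε / 2)
    (hz : z ∈ Metric.thickening (ε / 2) D) :
    ∫ y, κ (b⁻¹ • (z - y)) ^ 2 ∂densityMeasure h ≤ K * M * b ^ p := by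
  have := hh.isProbabilityMeasure
  have hI := integrable_kernel_comp (b := b) (z := z) hκ hB hh
  have h1 : ∫ y, κ (b⁻¹ • (z - y)) ^ 2 ∂densityMeasure h ≤
      ∫ y, K * κ (b⁻¹ • (z - y)) ∂densityMeasure h := by
    refine integral_mono_of_nonneg (ae_of_all _ fun _ => sq_nonneg _) (hI.const_mul K)
      (ae_of_all _ fun y => ?_)
    dsimp only
    rw [sq]
    exact mul_le_mul_of_nonneg_right (hB.le _) (hκ.nonneg _)
  have h3 : ∫ y, κ (b⁻¹ • (z - y)) ∂densityMeasure h = kernelMean κ h b z :=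
    integral_densityMeasure hh _
  rw [integral_const_mul, h3] at h1
  have h2 := kernelMean_le hκ hB hh hb hbρ hz
  calc _ ≤ K * kernelMean κ h b z := h1
    _ ≤ K * (M * b ^ p) := mul_le_mul_of_nonneg_left h2 hB.pos.le
    _ = _ := by ring

/-- The estimate at `z` as a function of the vector of observations. -/
def kdeFin (κ : Euc p → ℝ) (b : ℝ) {N : ℕ} (y : Fin N → Euc p) (z : Euc p) : ℝ :=
  1 / (N * b ^ p) * ∑ j, κ (b⁻¹ • (z - y j))

lemma kde_eq_kdeFin (κ : Euc p → ℝ) (b : ℝ) (N : ℕ) (Z : ℕ → Euc p) (z : Euc p) :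
    kde κ b N Z z = kdeFin κ b (fun j : Fin N => Z j) z := by
  rw [kde, kdeFin, Finset.sum_range]

/-- Mean squared error under independent sampling. -/
lemma lintegral_kdeFin_sub_sq_le (hκ : K1 k κ) (hB : KernelBound κ K ρ)
    (hh : IsUntruncated D k ε M L h) (hk : 2 ≤ k) (hb : 0 < b) (hbρ : b * ρ ≤ ε / 2)
    (hz : z ∈ Metric.thickening (ε / 2) D) {N : ℕ} (hN : 1 ≤ N) :
    ∫⁻ y, ENNReal.ofReal ((kdeFin κ b y z - h z) ^ 2)
        ∂Measure.pi (fun _ : Fin N => densityMeasure h) ≤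
      ENNReal.ofReal (2 * (K * M) / (N * b ^ p) + 2 * (L * ρ ^ 2) ^ 2 * b ^ 4) := by
  have := hh.isProbabilityMeasure
  have : NeZero N := ⟨by omega⟩
  set μ := densityMeasure h
  set Pp := Measure.pi (fun _ : Fin N => μ)
  set φ : Euc p → ℝ := fun y => κ (b⁻¹ • (z - y)) with hφ
  set m := kernelMean κ h b z with hm
  have hφc : Continuous φ := continuous_kernel_comp hκ
  have hφL : MemLp φ 2 μ := MemLp.of_bound hφc.aestronglyMeasurable K
    (ae_of_all _ fun y => abs_kernel_le hκ hB _)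
  have hmp : ∀ j, MeasurePreserving (Function.eval j) Pp μ := fun j => measurePreserving_eval _ j
  have hφm : ∫ y, φ y ∂μ = m := integral_densityMeasure hh φ
  have hYL : ∀ j : Fin N, MemLp (fun y : Fin N → Euc p => φ (y j)) 2 Pp := fun j =>
    hφL.comp_measurePreserving (hmp j)
  have hcomp : ∀ (j : Fin N) (g : Euc p → ℝ), AEStronglyMeasurable g μ →
      ∫ y : Fin N → Euc p, g (y j) ∂Pp = ∫ y, g y ∂μ := by
    intro j g hg
    rw [← (hmp j).map_eq, integral_map (hmp j).measurable.aemeasurable (by rwa [(hmp j).map_eq])]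
  have hvar : ∫ y, ‖φ y - m‖ ^ 2 ∂μ ≤ K * M * b ^ p := by
    have h1 : ∀ y, ‖φ y - m‖ ^ 2 = φ y ^ 2 - 2 * m * φ y + m ^ 2 := fun y => by
      rw [Real.norm_eq_abs, sq_abs]; ring
    simp_rw [h1]
    have hI := hφL.integrable one_le_two
    have hI3 : Integrable (fun y => φ y ^ 2 - 2 * m * φ y) μ :=
      hφL.integrable_sq.sub (hI.const_mul _)
    rw [integral_add hI3 (integrable_const _),
      integral_sub hφL.integrable_sq (hI.const_mul _), integral_const_mul, hφm]
    simp only [integral_const, measureReal_def, measure_univ, ENNReal.toReal_one, one_smul]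
    nlinarith [integral_kernel_sq_le hκ hB hh hb hbρ hz, sq_nonneg m]
  have hind : iIndepFun (fun (j : Fin N) (y : Fin N → Euc p) => φ (y j)) Pp :=
    iIndepFun_pi (X := fun _ => φ) fun _ => hφc.measurable.aemeasurable
  have hmean := integral_norm_mean_sub_sq_le (P := Pp) (Finset.univ : Finset (Fin N))
    Finset.univ_nonempty (Y := fun j y => φ (y j)) (μ := m) (v := K * M * b ^ p)
    (fun j _ => hYL j) (fun j _ => (hcomp j φ hφc.aestronglyMeasurable).trans hφm)
    (fun j _ => (hcomp j (fun y => ‖φ y - m‖ ^ 2) (by fun_prop)).trans_le hvar)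
    (fun i _ j _ hij => hind.indepFun hij)
  rw [Finset.card_univ, Fintype.card_fin] at hmean
  have hN' : (0 : ℝ) < N := by exact_mod_cast hN
  have hbp : 0 < b ^ p := by positivity
  have hbias := abs_kernelMean_sub_le hκ hB hh hk hb hbρ hz
  set A : (Fin N → Euc p) → ℝ := fun y => (N : ℝ)⁻¹ • ∑ j, φ (y j) - m with hA
  have hAI : Integrable (fun y => ‖A y‖ ^ 2) Pp := by
    have h1 : MemLp (fun y : Fin N → Euc p => ∑ j, φ (y j)) 2 Pp :=
      memLp_finsetSum _ fun j _ => hYL j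
    have h2 : MemLp A 2 Pp := (h1.const_smul (N : ℝ)⁻¹).sub (memLp_const m)
    exact h2.integrable_norm_pow two_ne_zero
  -- Stochastic error plus bias, combined by (s + t)² ≤ 2s² + 2t².
  have hpt : ∀ y, (kdeFin κ b y z - h z) ^ 2 ≤
      2 / (b ^ p) ^ 2 * ‖A y‖ ^ 2 + 2 * (L * ρ ^ 2) ^ 2 * b ^ 4 := by
    intro y
    have h1 : kdeFin κ b y z - h z = A y / b ^ p + (m / b ^ p - h z) := by
      simp only [kdeFin, hA, hφ, smul_eq_mul]
      field_simp
      ring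
    have h2 : (m / b ^ p - h z) ^ 2 ≤ (L * ρ ^ 2 * b ^ 2) ^ 2 := sq_le_sq' (by
      linarith [(abs_le.1 hbias).1]) (abs_le.1 hbias).2
    have h3 : 2 / (b ^ p) ^ 2 * ‖A y‖ ^ 2 = 2 * (A y / b ^ p) ^ 2 := by
      rw [Real.norm_eq_abs, sq_abs]; ring
    rw [h1, h3]
    nlinarith [sq_nonneg (A y / b ^ p - (m / b ^ p - h z))]
  have hbound : Integrable (fun y => 2 / (b ^ p) ^ 2 * ‖A y‖ ^ 2 + 2 * (L * ρ ^ 2) ^ 2 * b ^ 4) Pp :=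
    (hAI.const_mul _).add (integrable_const _)
  calc ∫⁻ y, ENNReal.ofReal ((kdeFin κ b y z - h z) ^ 2) ∂Pp
      ≤ ∫⁻ y, ENNReal.ofReal (2 / (b ^ p) ^ 2 * ‖A y‖ ^ 2 + 2 * (L * ρ ^ 2) ^ 2 * b ^ 4) ∂Pp :=
        lintegral_mono fun y => ENNReal.ofReal_le_ofReal (hpt y)
    _ = ENNReal.ofReal (∫ y, (2 / (b ^ p) ^ 2 * ‖A y‖ ^ 2 + 2 * (L * ρ ^ 2) ^ 2 * b ^ 4) ∂Pp) :=
        (ofReal_integral_eq_lintegral_ofReal hbound (ae_of_all _ fun y => by positivity)).symm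
    _ ≤ _ := by
        refine ENNReal.ofReal_le_ofReal ?_
        rw [integral_add (hAI.const_mul _) (integrable_const _), integral_const_mul]
        simp only [integral_const, measureReal_def, measure_univ, ENNReal.toReal_one, one_smul]
        gcongr
        calc 2 / (b ^ p) ^ 2 * ∫ y, ‖A y‖ ^ 2 ∂Pp ≤ 2 / (b ^ p) ^ 2 * (K * M * b ^ p / N) := by
              gcongr
          _ = 2 * (K * M) / (N * b ^ p) := by field_simp

/-- For |x| ≤ 1 one has exp x ≤ 1 + x + x². Hence the quadratic term carries a factor b^p, as in
Bernstein's inequality, which the bound K alone would not give. -/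
lemma mgf_kernel_le (hκ : K1 k κ) (hB : KernelBound κ K ρ)
    (hh : IsUntruncated D k ε M L h) (hb : 0 < b) (hbρ : b * ρ ≤ ε / 2)
    (hz : z ∈ Metric.thickening (ε / 2) D) {t : ℝ} (ht : |t| * K ≤ 1) :
    mgf (fun y => κ (b⁻¹ • (z - y))) (densityMeasure h) t ≤
      Real.exp (t * kernelMean κ h b z + t ^ 2 * (K * M * b ^ p)) := by
  have := hh.isProbabilityMeasure
  set μ := densityMeasure h
  set φ : Euc p → ℝ := fun y => κ (b⁻¹ • (z - y)) with hφ
  have hφc : Continuous φ := continuous_kernel_comp hκ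
  have hφL : MemLp φ 2 μ := MemLp.of_bound hφc.aestronglyMeasurable K
    (ae_of_all _ fun y => abs_kernel_le hκ hB _)
  have hφm : ∫ y, φ y ∂μ = kernelMean κ h b z := integral_densityMeasure hh φ
  have hI := hφL.integrable one_le_two
  have hI2 : Integrable (fun y => 1 + t * φ y + t ^ 2 * φ y ^ 2) μ :=
    ((integrable_const 1).add (hI.const_mul t)).add (hφL.integrable_sq.const_mul _)
  have h1 : mgf φ μ t ≤ ∫ y, (1 + t * φ y + t ^ 2 * φ y ^ 2) ∂μ := by
    refine integral_mono_of_nonneg (ae_of_all _ fun _ => (Real.exp_pos _).le) hI2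
      (ae_of_all _ fun y => ?_)
    have habs : |t * φ y| ≤ 1 := by
      rw [abs_mul]
      exact (mul_le_mul_of_nonneg_left (abs_kernel_le hκ hB _) (abs_nonneg t)).trans ht
    have := (abs_le.1 (Real.abs_exp_sub_one_sub_id_le habs)).2
    dsimp only
    nlinarith
  have h2 : ∫ y, (1 + t * φ y + t ^ 2 * φ y ^ 2) ∂μ =
      1 + t * kernelMean κ h b z + t ^ 2 * ∫ y, φ y ^ 2 ∂μ := by
    have hI3 : Integrable (fun y => 1 + t * φ y) μ := (integrable_const 1).add (hI.const_mul t)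
    rw [integral_add hI3 (hφL.integrable_sq.const_mul _),
      integral_add (integrable_const 1) (hI.const_mul t), integral_const_mul, integral_const_mul,
      hφm]
    simp
  refine (h1.trans_eq h2).trans (le_trans ?_ (Real.add_one_le_exp _))
  have h3 := integral_kernel_sq_le hκ hB hh hb hbρ hz
  nlinarith [mul_le_mul_of_nonneg_left h3 (sq_nonneg t)]

/-- Exponential bound for the pointwise error under independent sampling. -/
lemma measure_kdeFin_sub_gt_le (hκ : K1 k κ) (hB : KernelBound κ K ρ) (hM : 0 < M)
    (hh : IsUntruncated D k ε M L h) (hk : 2 ≤ k) (hb : 0 < b) (hbρ : b * ρ ≤ ε / 2)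
    (hz : z ∈ Metric.thickening (ε / 2) D) {N : ℕ} (hN : 1 ≤ N) {τ : ℝ} (hτ : 0 < τ)
    (hbτ : L * ρ ^ 2 * b ^ 2 ≤ τ / 2) :
    Measure.pi (fun _ : Fin N => densityMeasure h) {y | τ < |kdeFin κ b y z - h z|} ≤
      ENNReal.ofReal (2 * Real.exp (-(min (1 / K) (τ / (4 * (K * M))) * τ / 4) * (N * b ^ p))) := by
  have := hh.isProbabilityMeasure
  set μ := densityMeasure h
  set Pp := Measure.pi (fun _ : Fin N => μ)
  set φ : Euc p → ℝ := fun y => κ (b⁻¹ • (z - y)) with hφ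
  set m := kernelMean κ h b z with hm
  have hK := hB.pos
  -- The first bound makes `mgf_kernel_le` applicable; the second keeps the quadratic term below
  -- half of the linear gain t τ / 2. The other half of τ absorbs the bias.
  set t := min (1 / K) (τ / (4 * (K * M))) with ht
  have ht0 : 0 < t := by positivity
  have htK : t * K ≤ 1 := by
    calc t * K ≤ 1 / K * K := by gcongr; exact min_le_left _ _
      _ = 1 := by field_simp
  have htM : t * (K * M) ≤ τ / 4 := by
    calc t * (K * M) ≤ τ / (4 * (K * M)) * (K * M) := by gcongr; exact min_le_right _ _
      _ = τ / 4 := by field_simp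
  have hN' : (0 : ℝ) < N := by exact_mod_cast hN
  have hbp : 0 < b ^ p := by positivity
  have hφc : Continuous φ := continuous_kernel_comp hκ
  have hind : iIndepFun (fun (j : Fin N) (y : Fin N → Euc p) => φ (y j)) Pp :=
    iIndepFun_pi (X := fun _ => φ) fun _ => hφc.measurable.aemeasurable
  have hmp : ∀ j, MeasurePreserving (Function.eval j) Pp μ := fun j => measurePreserving_eval _ j
  set Sm : (Fin N → Euc p) → ℝ := ∑ j : Fin N, fun y => φ (y j) with hSm
  have hSmA : ∀ y, Sm y = ∑ j, φ (y j) := fun y => by simp [hSm]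
  have hSmc : Continuous Sm := by
    have : Sm = fun y => ∑ j, φ (y j) := funext hSmA
    rw [this]
    fun_prop
  have hmgf : ∀ s : ℝ, |s| * K ≤ 1 →
      mgf Sm Pp s ≤ Real.exp (N * (s * m + s ^ 2 * (K * M * b ^ p))) := by
    intro s hs
    have h1 : ∀ j : Fin N, mgf (fun y : Fin N → Euc p => φ (y j)) Pp s = mgf φ μ s := by
      intro j
      simp only [mgf]
      rw [← (hmp j).map_eq, integral_map (hmp j).measurable.aemeasurable (by fun_prop)]
    rw [hSm, hind.mgf_sum₀
      (fun j => (hφc.measurable.comp (measurable_pi_apply j)).aemeasurable)]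
    simp_rw [h1]
    rw [Finset.prod_const, Finset.card_univ, Fintype.card_fin, Real.exp_nat_mul]
    exact pow_le_pow_left₀ mgf_nonneg (mgf_kernel_le hκ hB hh hb hbρ hz hs) N
  have hexpI : ∀ s : ℝ, Integrable (fun y => Real.exp (s * Sm y)) Pp := by
    intro s
    refine Integrable.of_bound (by fun_prop) (Real.exp (|s| * (N * K))) (ae_of_all _ fun y => ?_)
    rw [Real.norm_of_nonneg (Real.exp_pos _).le]
    refine Real.exp_le_exp.2 ((le_abs_self _).trans ?_)
    rw [abs_mul, hSmA]
    gcongr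
    refine (Finset.abs_sum_le_sum_abs _ _).trans ?_
    calc ∑ j, |φ (y j)| ≤ ∑ _j : Fin N, K := Finset.sum_le_sum fun j _ => abs_kernel_le hκ hB _
      _ = N * K := by simp
  have hexp : ∀ e : ℝ, e ≤ -(t * τ / 4) * (N * b ^ p) →
      Real.exp e ≤ Real.exp (-(t * τ / 4) * (N * b ^ p)) := fun e he => Real.exp_le_exp.2 he
  have hkey : t ^ 2 * (K * M * b ^ p) ≤ t * τ / 4 * b ^ p := by
    nlinarith [mul_le_mul_of_nonneg_left htM (mul_pos ht0 hbp).le]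
  have hup : Pp.real {y | N * m + N * b ^ p * (τ / 2) ≤ Sm y} ≤
      Real.exp (-(t * τ / 4) * (N * b ^ p)) := by
    refine (measure_ge_le_exp_mul_mgf _ ht0.le (hexpI t)).trans ?_
    refine (mul_le_mul_of_nonneg_left (hmgf t (by rwa [abs_of_pos ht0]))
      (Real.exp_pos _).le).trans ?_
    rw [← Real.exp_add]
    refine hexp _ ?_
    nlinarith [mul_le_mul_of_nonneg_left hkey hN'.le]
  have hlow : Pp.real {y | Sm y ≤ N * m - N * b ^ p * (τ / 2)} ≤
      Real.exp (-(t * τ / 4) * (N * b ^ p)) := by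
    refine (measure_le_le_exp_mul_mgf _ (neg_nonpos.2 ht0.le) (hexpI (-t))).trans ?_
    refine (mul_le_mul_of_nonneg_left (hmgf (-t) (by rwa [abs_neg, abs_of_pos ht0]))
      (Real.exp_pos _).le).trans ?_
    rw [← Real.exp_add]
    refine hexp _ ?_
    nlinarith [mul_le_mul_of_nonneg_left hkey hN'.le]
  have hbias := abs_le.1 ((abs_kernelMean_sub_le hκ hB hh hk hb hbρ hz).trans hbτ)
  have hsub : {y : Fin N → Euc p | τ < |kdeFin κ b y z - h z|} ⊆
      {y | N * m + N * b ^ p * (τ / 2) ≤ Sm y} ∪ {y | Sm y ≤ N * m - N * b ^ p * (τ / 2)} := by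
    intro y hy
    have hNb : 0 < N * b ^ p := by positivity
    have h1 : Sm y = N * b ^ p * kdeFin κ b y z := by
      rw [hSmA, kdeFin, ← mul_assoc, mul_one_div_cancel hNb.ne', one_mul]
    have h2 : N * m = N * b ^ p * (m / b ^ p) := by field_simp
    have hy' : τ < |kdeFin κ b y z - h z| := hy
    rcases lt_abs.1 hy' with h3 | h3
    · left
      rw [Set.mem_ofPred_eq, h1, h2, ← mul_add]
      exact mul_le_mul_of_nonneg_left (by linarith) hNb.le
    · right
      rw [Set.mem_ofPred_eq, h1, h2, ← mul_sub]
      exact mul_le_mul_of_nonneg_left (by linarith) hNb.le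
  refine (measure_mono hsub).trans ((measure_union_le _ _).trans ?_)
  rw [two_mul, ENNReal.ofReal_add (Real.exp_pos _).le (Real.exp_pos _).le]
  refine add_le_add ?_ ?_
  · rw [← ENNReal.ofReal_toReal (measure_ne_top Pp _)]
    exact ENNReal.ofReal_le_ofReal hup
  · rw [← ENNReal.ofReal_toReal (measure_ne_top Pp _)]
    exact ENNReal.ofReal_le_ofReal hlow

end Product

end Kernel

/-! ### Truncated estimates -/

section Truncation

variable {p k : ℕ} {D : Set (Euc p)} {ε M L : ℝ} {h g : Euc p → ℝ}

/-- A strictly positive smooth function is truncated to a density with support `D`. -/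
lemma isDensityOn_truncate (hD : IsCompact D) (hg : ContDiff ℝ (k : WithTop ℕ∞) g)
    (hpos : ∀ z ∈ D, 0 < g z) (hI : 0 < ∫ z in D, g z) : IsDensityOn D k (truncate D g) where
  nonneg z := Set.indicator_nonneg (fun z hz => div_nonneg (hpos z hz).le hI.le) z
  integrable := by
    rw [truncate, integrable_indicator_iff hD.measurableSet]
    exact ((hg.continuous.continuousOn.integrableOn_compact hD).div_const _)
  integral_one := by
    rw [truncate, integral_indicator hD.measurableSet, integral_div, div_self hI.ne']
  support_eq := by
    ext z
    rw [truncate, Set.support_indicator, Set.mem_inter_iff, Function.mem_support]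
    exact ⟨fun h => h.1, fun h => ⟨h, (div_pos (hpos z h) hI).ne'⟩⟩
  contDiffOn := (hg.contDiffOn.div_const (∫ z in D, g z)).congr fun z hz =>
    Set.indicator_of_mem hz _

lemma setIntegral_abs_sub_le {τ : ℝ} (hD : IsCompact D) (hgc : Continuous g)
    (hhc : ContinuousOn h D) (hτ : ∀ z ∈ D, |g z - h z| ≤ τ) :
    ∫ z in D, |g z - h z| ≤ τ * volume.real D := by
  have h1 : IntegrableOn (fun z => |g z - h z|) D volume :=
    ((hgc.continuousOn.sub hhc).abs).integrableOn_compact hD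
  calc ∫ z in D, |g z - h z| ≤ ∫ _z in D, τ :=
        setIntegral_mono_on h1 (integrableOn_const hD.measure_lt_top.ne) hD.measurableSet hτ
    _ = τ * volume.real D := by simp [mul_comm]

/-- The mass of h on D is at least V/M, and closeness keeps that of g at least V/(2M), so both
normalizations are stable. The error of the normalizing constant gives the integral term. -/
lemma abs_truncate_sub_le (hD : IsCompact D) (hV : 0 < volume.real D) (hM : 0 < M)
    (hbd : ∀ z ∈ D, 1 / M ≤ h z ∧ h z ≤ M) (hhc : ContinuousOn h D) (hgc : Continuous g)
    {τ : ℝ} (hτM : τ ≤ 1 / (2 * M)) (hτ : ∀ z ∈ D, |g z - h z| ≤ τ) :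
    0 < ∫ z in D, g z ∧
    ∀ z ∈ D, |truncate D g z - truncate D h z| ≤ 2 * M / volume.real D * |g z - h z| +
        2 * M ^ 3 / volume.real D ^ 2 * ∫ z in D, |g z - h z| := by
  set V := volume.real D
  set δ := ∫ z in D, |g z - h z|
  set I := ∫ z in D, h z
  set J := ∫ z in D, g z
  have hgI : IntegrableOn g D volume := hgc.continuousOn.integrableOn_compact hD
  have hhI : IntegrableOn h D volume := hhc.integrableOn_compact hD
  have hδ0 : 0 ≤ δ := integral_nonneg fun z => abs_nonneg _
  have hδ : δ ≤ τ * V := setIntegral_abs_sub_le hD hgc hhc hτ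
  have hI : V / M ≤ I := by
    calc V / M = ∫ _z in D, 1 / M := by simp [V, measureReal_def, div_eq_mul_inv]
      _ ≤ I := setIntegral_mono_on (integrableOn_const hD.measure_lt_top.ne) hhI
        hD.measurableSet fun z hz => (hbd z hz).1
  have hJI : |J - I| ≤ δ := by
    rw [← integral_sub hgI hhI]
    exact abs_integral_le_integral_abs
  have hVM : V / M = 2 * (V / (2 * M)) := by field_simp
  have hJ : V / (2 * M) ≤ J := by
    have h1 : τ * V ≤ V / (2 * M) := by
      calc τ * V ≤ 1 / (2 * M) * V := by gcongr
        _ = _ := by ring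
    linarith [(abs_le.1 hJI).1]
  have hVM0 : 0 < V / (2 * M) := by positivity
  have hJ0 : 0 < J := hVM0.trans_le hJ
  have hI0 : 0 < I := lt_of_lt_of_le (by positivity) hI
  refine ⟨hJ0, fun z hz => ?_⟩
  rw [truncate, truncate, Set.indicator_of_mem hz, Set.indicator_of_mem hz]
  have h1 : g z / J - h z / I = (g z - h z) * (1 / J) + h z * (1 / I) * (1 / J) * (I - J) := by
    field_simp
    ring
  have hJinv : 1 / J ≤ 2 * M / V := by
    calc 1 / J ≤ 1 / (V / (2 * M)) := one_div_le_one_div_of_le hVM0 hJ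
      _ = 2 * M / V := by field_simp
  have hIinv : 1 / I ≤ M / V := by
    calc 1 / I ≤ 1 / (V / M) := one_div_le_one_div_of_le (by positivity) hI
      _ = M / V := by field_simp
  have hh0 : 0 ≤ h z := le_trans (by positivity) (hbd z hz).1
  rw [h1]
  refine (abs_add_le _ _).trans (add_le_add ?_ ?_)
  · rw [abs_mul, abs_of_pos (one_div_pos.2 hJ0), mul_comm]
    gcongr
  · rw [abs_mul, abs_of_nonneg (by positivity), abs_sub_comm]
    calc h z * (1 / I) * (1 / J) * |J - I| ≤ M * (M / V) * (2 * M / V) * δ := by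
          gcongr
          exact (hbd z hz).2
      _ = _ := by ring

/-- Truncation of an estimate that is uniformly close to `h` on `D`. -/
lemma exists_truncate_mem_supNhd (hD : IsCompact D) (hV : 0 < volume.real D) (hM : 0 < M)
    {F : Set (Euc p → ℝ)} {η : ℝ} (hη : 0 < η) :
    ∃ τ C : ℝ, 0 < τ ∧ 0 ≤ C ∧ ∀ h g : Euc p → ℝ, (∀ z ∈ D, 1 / M ≤ h z ∧ h z ≤ M) →
      ContinuousOn h D → ContDiff ℝ (k : WithTop ℕ∞) g → truncate D h ∈ F →
      (∀ z ∈ D, |g z - h z| ≤ τ) →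
      truncate D g ∈ supNhd D k F η ∧
        eLpNorm (truncate D h - truncate D g) 2 volume ^ 2 ≤
          ENNReal.ofReal C * ∫⁻ z in D, ENNReal.ofReal ((g z - h z) ^ 2) := by
  set V := volume.real D with hVdef
  set A := 2 * M / V with hA
  set B := 2 * M ^ 3 / V ^ 2 with hB
  have hA0 : 0 < A := by positivity
  have hB0 : 0 < B := by positivity
  -- The first bound keeps g positive on D, so that its truncation has support exactly D; the second
  -- makes A τ + B τ V at most η. The constant C comes from squaring the two-term bound and
  -- integrating over D.
  refine ⟨min (1 / (2 * M)) (η / (A + B * V)), 2 * A ^ 2 + 2 * B ^ 2 * V ^ 2, by positivity,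
    by positivity, fun h g hbd hhc hg hF hτ => ?_⟩
  set τ := min (1 / (2 * M)) (η / (A + B * V)) with hτdef
  have hgc := hg.continuous
  obtain ⟨hJ, hle⟩ := abs_truncate_sub_le hD hV hM hbd hhc hgc (min_le_left _ _) hτ
  have hδ := setIntegral_abs_sub_le hD hgc hhc hτ
  have hpos : ∀ z ∈ D, 0 < g z := by
    intro z hz
    have h1 := (abs_le.1 ((hτ z hz).trans (min_le_left _ _))).1
    have h2 := (hbd z hz).1
    have h3 : 1 / M = 2 * (1 / (2 * M)) := by field_simp
    have h4 : 0 < 1 / (2 * M) := by positivity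
    linarith
  have hcont : ContinuousOn (fun z => g z - h z) D := hgc.continuousOn.sub hhc
  refine ⟨⟨isDensityOn_truncate hD hg hpos hJ, truncate D h, hF, fun z hz => ?_⟩, ?_⟩
  · calc |truncate D g z - truncate D h z| ≤ A * |g z - h z| + B * ∫ z in D, |g z - h z| := hle z hz
      _ ≤ A * τ + B * (τ * V) := by
          gcongr
          exact hτ z hz
      _ = τ * (A + B * V) := by ring
      _ ≤ η / (A + B * V) * (A + B * V) := by gcongr; exact min_le_right _ _
      _ = η := by field_simp
  · have hsq : IntegrableOn (fun z => (g z - h z) ^ 2) D volume :=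
      (hcont.pow 2).integrableOn_compact hD
    set S := ∫ z in D, (g z - h z) ^ 2 with hS
    have hS0 : 0 ≤ S := integral_nonneg fun z => sq_nonneg _
    -- Cauchy–Schwarz on D, read off from the nonnegativity of the variance of |g − h|.
    have hCS : (∫ z in D, |g z - h z|) ^ 2 ≤ V * S := by
      set δ := ∫ z in D, |g z - h z| with hδdef
      have habs : IntegrableOn (fun z => |g z - h z|) D volume := hcont.abs.integrableOn_compact hD
      have h1 : 0 ≤ ∫ z in D, (|g z - h z| - δ / V) ^ 2 := integral_nonneg fun z => sq_nonneg _
      have h2 : ∀ z, (|g z - h z| - δ / V) ^ 2 =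
          (g z - h z) ^ 2 - 2 * (δ / V) * |g z - h z| + (δ / V) ^ 2 := fun z => by
        rw [sub_sq, sq_abs]; ring
      simp_rw [h2] at h1
      have h3 : IntegrableOn (fun z => (g z - h z) ^ 2 - 2 * (δ / V) * |g z - h z|) D volume :=
        hsq.sub (habs.const_mul _)
      rw [integral_add h3 (integrableOn_const hD.measure_lt_top.ne),
        integral_sub hsq (habs.const_mul _), integral_const_mul, ← hδdef, ← hS] at h1
      simp only [integral_const, smul_eq_mul, measureReal_restrict_apply_univ] at h1
      rw [← hVdef] at h1
      have h4 : S - 2 * (δ / V) * δ + V * (δ / V) ^ 2 = S - δ ^ 2 / V := by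
        field_simp
        ring
      rw [h4, sub_nonneg, div_le_iff₀ hV] at h1
      linarith
    have hpt : ∀ z ∈ D, (truncate D h z - truncate D g z) ^ 2 ≤
        2 * A ^ 2 * (g z - h z) ^ 2 + 2 * B ^ 2 * (V * S) := by
      intro z hz
      have h1 := hle z hz
      have h2 : (truncate D h z - truncate D g z) ^ 2 =
          |truncate D g z - truncate D h z| ^ 2 := by rw [sq_abs]; ring
      have h0 := abs_nonneg (truncate D g z - truncate D h z)
      rw [h2]
      calc |truncate D g z - truncate D h z| ^ 2
          ≤ (A * |g z - h z| + B * ∫ z in D, |g z - h z|) ^ 2 := pow_le_pow_left₀ h0 h1 2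
        _ ≤ 2 * A ^ 2 * |g z - h z| ^ 2 + 2 * B ^ 2 * (∫ z in D, |g z - h z|) ^ 2 := by
            nlinarith [sq_nonneg (A * |g z - h z| - B * ∫ z in D, |g z - h z|)]
        _ ≤ _ := by rw [sq_abs]; gcongr
    have h1 : eLpNorm (truncate D h - truncate D g) 2 volume ^ 2 =
        ∫⁻ z in D, ENNReal.ofReal ((truncate D h z - truncate D g z) ^ 2) := by
      rw [← lintegral_indicator hD.measurableSet]
      have h5 := eLpNorm_nnreal_pow_eq_lintegral (f := truncate D h - truncate D g) (μ := volume)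
        (p := 2) two_ne_zero
      norm_num at h5
      rw [h5]
      refine lintegral_congr fun z => ?_
      by_cases hz : z ∈ D
      · rw [Set.indicator_of_mem hz, ← ofReal_norm, ← ENNReal.ofReal_pow (norm_nonneg _),
          Real.norm_eq_abs, sq_abs]
      · simp [hz, truncate]
    have h6 : IntegrableOn (fun z => 2 * A ^ 2 * (g z - h z) ^ 2 + 2 * B ^ 2 * (V * S)) D volume :=
      (hsq.const_mul _).add (integrableOn_const hD.measure_lt_top.ne)
    rw [h1, ← ofReal_integral_eq_lintegral_ofReal hsq (ae_of_all _ fun z => sq_nonneg _),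
      ← ENNReal.ofReal_mul (by positivity), ← hS]
    calc ∫⁻ z in D, ENNReal.ofReal ((truncate D h z - truncate D g z) ^ 2)
        ≤ ∫⁻ z in D, ENNReal.ofReal (2 * A ^ 2 * (g z - h z) ^ 2 + 2 * B ^ 2 * (V * S)) :=
          setLIntegral_mono' hD.measurableSet fun z hz => ENNReal.ofReal_le_ofReal (hpt z hz)
      _ = ENNReal.ofReal (∫ z in D, (2 * A ^ 2 * (g z - h z) ^ 2 + 2 * B ^ 2 * (V * S))) :=
          (ofReal_integral_eq_lintegral_ofReal h6 (ae_of_all _ fun z => by positivity)).symm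
      _ = _ := by
          congr 1
          rw [integral_add (hsq.const_mul _) (integrableOn_const hD.measure_lt_top.ne),
            integral_const_mul, ← hS]
          simp only [integral_const, smul_eq_mul, measureReal_restrict_apply_univ]
          rw [← hVdef]
          ring

end Truncation

/-! ### Errors of the density estimates on `D` -/

section Deterministic

variable {p k : ℕ} {D : Set (Euc p)} {ε M L : ℝ} {h κ : Euc p → ℝ}

/-- One factor b⁻¹ comes from the scaled argument and b^(-p) from the normalization. -/
lemma abs_kdeFin_sub_le {Λ b : ℝ} (hΛ : ∀ u v, |κ u - κ v| ≤ Λ * ‖u - v‖) (hb : 0 < b) {N : ℕ}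
    (hN : 1 ≤ N) (y : Fin N → Euc p) (z w : Euc p) :
    |kdeFin κ b y z - kdeFin κ b y w| ≤ Λ / b ^ (p + 1) * ‖z - w‖ := by
  have hN' : (0 : ℝ) < N := by exact_mod_cast hN
  rw [kdeFin, kdeFin, ← mul_sub, ← Finset.sum_sub_distrib, abs_mul, abs_of_pos (by positivity)]
  have h1 : |∑ j, (κ (b⁻¹ • (z - y j)) - κ (b⁻¹ • (w - y j)))| ≤ N * (Λ * (b⁻¹ * ‖z - w‖)) := by
    refine (Finset.abs_sum_le_sum_abs _ _).trans ?_
    calc ∑ j, |κ (b⁻¹ • (z - y j)) - κ (b⁻¹ • (w - y j))|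
        ≤ ∑ _j : Fin N, Λ * (b⁻¹ * ‖z - w‖) := Finset.sum_le_sum fun j _ => by
          refine (hΛ _ _).trans_eq ?_
          rw [← smul_sub, sub_sub_sub_cancel_right, norm_smul, Real.norm_of_nonneg (by positivity)]
      _ = _ := by simp
  calc _ ≤ 1 / (N * b ^ p) * (N * (Λ * (b⁻¹ * ‖z - w‖))) := by gcongr
    _ = _ := by
      field_simp
      ring

lemma K1.exists_lipschitz (hκ : K1 k κ) (hk : 1 ≤ k) :
    ∃ Λ, 0 ≤ Λ ∧ ∀ u v, |κ u - κ v| ≤ Λ * ‖u - v‖ := by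
  obtain ⟨C, hC⟩ := hκ.contDiff.lipschitzWith_of_hasCompactSupport hκ.compactSupport
    (by exact_mod_cast (by omega : k ≠ 0))
  exact ⟨C, C.2, fun u v => by simpa [dist_eq_norm] using hC.dist_le_mul u v⟩

/-- A large error at one point spreads to a ball. -/
lemma ball_subset_setOf_lt {Λ b τ r : ℝ} (hΛ : ∀ u v, |κ u - κ v| ≤ Λ * ‖u - v‖) (hΛ0 : 0 ≤ Λ)
    (hb : 0 < b) (hk : 1 ≤ k) (hε : 0 < ε) (hh : IsUntruncated D k ε M L h) (hrε : r ≤ ε / 2)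
    (hr : r * (Λ / b ^ (p + 1) + L) ≤ τ) {N : ℕ} (hN : 1 ≤ N) (y : Fin N → Euc p) {z : Euc p}
    (hz : z ∈ D) (hlt : 2 * τ < |kdeFin κ b y z - h z|) :
    Metric.ball z r ⊆ {w | τ < |kdeFin κ b y w - h w|} ∩ Metric.thickening (ε / 2) D := by
  have hzε : z ∈ Metric.thickening (ε / 2) D := Metric.self_subset_thickening (half_pos hε) D hz
  have hsub := Metric.ball_subset_closedBall.trans (closedBall_subset_thickening hzε hrε)
  intro w hw
  refine ⟨?_, Metric.mem_thickening_iff.2 ⟨z, hz, (Metric.mem_ball.1 hw).trans_le hrε⟩⟩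
  have hL : 0 ≤ L := hh.nonneg_const hk (hsub hw)
  have h1 := hh.abs_sub_le hk hsub hw
  have h2 := abs_kdeFin_sub_le hΛ hb hN y z w
  have hwr : ‖w - z‖ ≤ r := by rw [← dist_eq_norm]; exact (Metric.mem_ball.1 hw).le
  have h3 : (Λ / b ^ (p + 1) + L) * ‖w - z‖ ≤ τ := by
    refine le_trans ?_ hr
    rw [mul_comm]
    gcongr
  rw [norm_sub_rev] at h2
  have h4 : |kdeFin κ b y z - h z| ≤ |kdeFin κ b y w - h w| +
      (|kdeFin κ b y z - kdeFin κ b y w| + |h w - h z|) := by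
    have : kdeFin κ b y z - h z = (kdeFin κ b y w - h w) +
      ((kdeFin κ b y z - kdeFin κ b y w) + (h w - h z)) := by ring
    rw [this]
    exact (abs_add_le _ _).trans (by gcongr; exact abs_add_le _ _)
  rw [Set.mem_ofPred_eq]
  linarith

end Deterministic

section Sampling

variable {p k : ℕ} {D : Set (Euc p)} {ε M L : ℝ} {κ : Euc p → ℝ} {Ω : Type*}
  {𝓐 : MeasurableSpace Ω} [mΩ : MeasurableSpace Ω] {P : Measure Ω}
  {h : ℕ → Ω → Euc p → ℝ} {N : ℕ → ℕ → ℕ} {Z : ℕ → ℕ → ℕ → Ω → Euc p} {n i : ℕ}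

lemma IsSamplingGiven.measurable_prod (hS : IsSamplingGiven 𝓐 P h N Z)
    {Γ : Euc p × ℝ × (Fin (N n i) → Euc p) → ℝ≥0∞} (hΓ : Measurable Γ) :
    Measurable fun y : Ω × Euc p => Γ (y.2, h i y.1 y.2, fun j => Z n i j y.1) := by
  have hh : Measurable fun y : Ω × Euc p => h i y.1 y.2 :=
    (hS.measurable_density i).mono (sup_le_sup (MeasurableSpace.comap_mono hS.le) le_rfl) le_rfl
  have hZ : Measurable fun y : Ω × Euc p => fun j : Fin (N n i) => Z n i j y.1 :=
    measurable_pi_lambda _ fun j => (hS.measurable_obs n i j).comp measurable_fst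
  exact hΓ.comp (measurable_snd.prodMk (hh.prodMk hZ))

/-- Tonelli puts the expectation inside, so a bound at each fixed point suffices. -/
lemma IsSamplingGiven.lintegral_lintegral_le [IsProbabilityMeasure P]
    (hS : IsSamplingGiven 𝓐 P h N Z) (hh : ∀ i ω, IsUntruncated D k ε M L (h i ω)) (hin : i < n)
    {Γ : Euc p × ℝ × (Fin (N n i) → Euc p) → ℝ≥0∞} (hΓ : Measurable Γ) {T : Set (Euc p)}
    (hT : MeasurableSet T) {c : ℝ≥0∞}
    (hc : ∀ z ∈ T, ∀ ω,
      ∫⁻ y, Γ (z, h i ω z, y) ∂Measure.pi (fun _ => densityMeasure (h i ω)) ≤ c) :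
    ∫⁻ ω, (∫⁻ z in T, Γ (z, h i ω z, fun j => Z n i j ω)) ∂P ≤ c * volume T := by
  rw [lintegral_lintegral_swap (hS.measurable_prod hΓ).aemeasurable]
  calc _ ≤ ∫⁻ _z in T, c := setLIntegral_mono' hT fun z hz =>
        hS.lintegral_le (fun i ω => (hh i ω).nonneg) (fun i ω => (hh i ω).integrable)
          (fun i ω => (hh i ω).integral_one) hin z (hΓ.comp measurable_prodMk_left)
          (hc z hz)
    _ = _ := by simp

lemma measurable_kdeFin (hκ : Continuous κ) (b : ℝ) (m : ℕ) :
    Measurable fun y : Euc p × ℝ × (Fin m → Euc p) => kdeFin κ b y.2.2 y.1 - y.2.1 := by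
  have : Continuous fun y : Euc p × ℝ × (Fin m → Euc p) => kdeFin κ b y.2.2 y.1 - y.2.1 := by
    unfold kdeFin
    fun_prop
  exact this.measurable

/-- Integrated squared error of the estimate of the `i`-th density. -/
def kdeISE (D : Set (Euc p)) (κ : Euc p → ℝ) (b : ℕ → ℝ) (h : ℕ → Ω → Euc p → ℝ)
    (N : ℕ → ℕ → ℕ) (Z : ℕ → ℕ → ℕ → Ω → Euc p) (n i : ℕ) (ω : Ω) : ℝ≥0∞ :=
  ∫⁻ z in D, ENNReal.ofReal
    ((kde κ (b (N n i)) (N n i) (fun j => Z n i j ω) z - h i ω z) ^ 2)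

lemma IsSamplingGiven.measurable_kdeISE (hS : IsSamplingGiven 𝓐 P h N Z) (hκ : Continuous κ)
    (b : ℕ → ℝ) (n i : ℕ) : Measurable (kdeISE D κ b h N Z n i) := by
  have hΓ : Measurable fun y : Euc p × ℝ × (Fin (N n i) → Euc p) =>
      ENNReal.ofReal ((kdeFin κ (b (N n i)) y.2.2 y.1 - y.2.1) ^ 2) :=
    ((measurable_kdeFin hκ _ _).pow_const 2).ennreal_ofReal
  unfold kdeISE
  simp_rw [kde_eq_kdeFin]
  exact (hS.measurable_prod hΓ).lintegral_prod_right'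

lemma IsSamplingGiven.lintegral_kdeISE_le [IsProbabilityMeasure P]
    (hS : IsSamplingGiven 𝓐 P h N Z) (hh : ∀ i ω, IsUntruncated D k ε M L (h i ω)) (hin : i < n)
    (hD : IsCompact D) (hε : 0 < ε) (hk : 2 ≤ k) (hκ : K1 k κ) {K ρ : ℝ} (hB : KernelBound κ K ρ)
    {b : ℕ → ℝ} (hb : 0 < b (N n i)) (hbρ : b (N n i) * ρ ≤ ε / 2) (hN : 1 ≤ N n i) :
    ∫⁻ ω, kdeISE D κ b h N Z n i ω ∂P ≤
      ENNReal.ofReal (2 * (K * M) / (N n i * b (N n i) ^ p) +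
        2 * (L * ρ ^ 2) ^ 2 * b (N n i) ^ 4) * volume D := by
  unfold kdeISE
  simp_rw [kde_eq_kdeFin]
  refine hS.lintegral_lintegral_le hh hin (Γ := fun y =>
      ENNReal.ofReal ((kdeFin κ (b (N n i)) y.2.2 y.1 - y.2.1) ^ 2))
    ((measurable_kdeFin hκ.contDiff.continuous _ _).pow_const 2).ennreal_ofReal
    hD.measurableSet fun z hz ω => ?_
  exact lintegral_kdeFin_sub_sq_le hκ hB (hh i ω) hk hb hbρ
    (Metric.self_subset_thickening (half_pos hε) D hz) hN

/-- Probability of a large sup error on `D`. -/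
lemma IsSamplingGiven.measure_exists_lt_le [IsProbabilityMeasure P]
    (hS : IsSamplingGiven 𝓐 P h N Z) (hh : ∀ i ω, IsUntruncated D k ε M L (h i ω)) (hin : i < n)
    (hε : 0 < ε) (hM : 0 < M) (hk : 2 ≤ k) (hκ : K1 k κ) {K ρ : ℝ}
    (hB : KernelBound κ K ρ) {Λ : ℝ} (hΛ : ∀ u v, |κ u - κ v| ≤ Λ * ‖u - v‖) (hΛ0 : 0 ≤ Λ)
    {b : ℝ} (hb : 0 < b) (hbρ : b * ρ ≤ ε / 2) (hN : 1 ≤ N n i) {τ r : ℝ}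
    (hτ : 0 < τ) (hbτ : L * ρ ^ 2 * b ^ 2 ≤ τ / 2) (hr0 : 0 < r) (hrε : r ≤ ε / 2)
    (hr : r * (Λ / b ^ (p + 1) + L) ≤ τ) :
    P {ω | ∃ z ∈ D, 2 * τ < |kde κ b (N n i) (fun j => Z n i j ω) z - h i ω z|} ≤
      ENNReal.ofReal (2 * Real.exp (-(min (1 / K) (τ / (4 * (K * M))) * τ / 4) * (N n i * b ^ p)))
        * volume (Metric.thickening (ε / 2) D) / volume (Metric.ball (0 : Euc p) r) := by
  set T := Metric.thickening (ε / 2) D with hTdef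
  have hT : MeasurableSet T := Metric.isOpen_thickening.measurableSet
  set U : Set (Euc p × ℝ × (Fin (N n i) → Euc p)) := {y | τ < |kdeFin κ b y.2.2 y.1 - y.2.1|}
    with hU
  have hUm : MeasurableSet U :=
    measurableSet_lt measurable_const (measurable_kdeFin hκ.contDiff.continuous _ _).abs
  set Γ : Euc p × ℝ × (Fin (N n i) → Euc p) → ℝ≥0∞ := U.indicator 1 with hΓ
  have hΓm : Measurable Γ := measurable_one.indicator hUm
  -- The volume, inside the neighbourhood T, of the set where the error exceeds τ. An error above 2τ
  -- at one point of D forces it to be at least the volume of a ball of radius r. Markov's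
  -- inequality for `Y` replaces a covering argument, and the event itself need not be shown
  -- measurable.
  set Y : Ω → ℝ≥0∞ := fun ω => ∫⁻ z in T, Γ (z, h i ω z, fun j => Z n i j ω) with hY
  have hYm : Measurable Y := (hS.measurable_prod hΓm).lintegral_prod_right'
  have hYle : ∫⁻ ω, Y ω ∂P ≤ ENNReal.ofReal (2 * Real.exp
      (-(min (1 / K) (τ / (4 * (K * M))) * τ / 4) * (N n i * b ^ p))) * volume T := hS.lintegral_lintegral_le hh hin hΓm hT fun z hz ω => by
    have h1 : ∀ y : Fin (N n i) → Euc p, Γ (z, h i ω z, y) =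
        {y | τ < |kdeFin κ b y z - h i ω z|}.indicator 1 y := fun y => rfl
    simp_rw [h1]
    rw [lintegral_indicator_one (by
      have h2 := (measurable_kdeFin hκ.contDiff.continuous b (N n i)).comp
        ((measurable_prodMk_left (x := z)).comp (measurable_prodMk_left (x := h i ω z)))
      exact measurableSet_lt measurable_const h2.abs)]
    exact measure_kdeFin_sub_gt_le hκ hB hM (hh i ω) hk hb hbρ hz hN hτ hbτ
  have hv0 : volume (Metric.ball (0 : Euc p) r) ≠ 0 := (Metric.measure_ball_pos _ _ hr0).ne'
  have hvt : volume (Metric.ball (0 : Euc p) r) ≠ ∞ := measure_ball_lt_top.ne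
  calc P {ω | ∃ z ∈ D, 2 * τ < |kde κ b (N n i) (fun j => Z n i j ω) z - h i ω z|}
      ≤ P {ω | volume (Metric.ball (0 : Euc p) r) ≤ Y ω} := by
        refine measure_mono fun ω hω => ?_
        obtain ⟨z, hz, hlt⟩ := hω
        rw [kde_eq_kdeFin] at hlt
        have hsub := ball_subset_setOf_lt hΛ hΛ0 hb (one_le_two.trans hk) hε (hh i ω) hrε hr hN
          (fun j : Fin (N n i) => Z n i j ω) hz hlt
        have h1 : ∀ w, Γ (w, h i ω w, fun j => Z n i j ω) =
          {w | τ < |kdeFin κ b (fun j : Fin (N n i) => Z n i j ω) w - h i ω w|}.indicator 1 w :=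
            fun w => rfl
        have hm : MeasurableSet
            {w | τ < |kdeFin κ b (fun j : Fin (N n i) => Z n i j ω) w - h i ω w|} := by
          have hw : Measurable fun w => h i ω w :=
            ((hS.measurable_density i).mono (sup_le_sup (MeasurableSpace.comap_mono hS.le) le_rfl)
              le_rfl).comp measurable_prodMk_left
          exact (measurable_id.prodMk (hw.prodMk measurable_const)) hUm
        have hYω : Y ω = volume.restrict T
            {w | τ < |kdeFin κ b (fun j : Fin (N n i) => Z n i j ω) w - h i ω w|} :=
          (lintegral_congr h1).trans (lintegral_indicator_one hm)
        rw [Set.mem_ofPred_eq, hYω, Measure.restrict_apply hm,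
          ← Measure.addHaar_ball_center volume z r]
        exact measure_mono hsub
    _ ≤ (∫⁻ ω, Y ω ∂P) / volume (Metric.ball (0 : Euc p) r) :=
        meas_ge_le_lintegral_div hYm.aemeasurable hv0 hvt
    _ ≤ _ := by gcongr

end Sampling

/-! ### Rates of the density estimates -/

section Rates

/-- The balance of variance and squared bias: 1/(l b^p) and b⁴ have the same order exactly when l
b^(p+4) stays between positive constants. -/
lemma bandwidth_bounds {p : ℕ} {b : ℕ → ℝ} (hb : ∀ l, 0 < b l)
    (hΘ : b =Θ[atTop] fun l : ℕ => (l : ℝ) ^ (-(1 / ((p : ℝ) + 4)) : ℝ)) :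
    ∃ c₁ c₂ : ℝ, 0 < c₁ ∧ 0 < c₂ ∧
      ∀ᶠ l : ℕ in atTop, c₁ ≤ l * b l ^ (p + 4) ∧ l * b l ^ (p + 4) ≤ c₂ := by
  obtain ⟨C₂, hC₂, h₂⟩ := hΘ.1.exists_pos
  obtain ⟨C₁, hC₁, h₁⟩ := hΘ.2.exists_pos
  refine ⟨(C₁⁻¹) ^ (p + 4), C₂ ^ (p + 4), by positivity, by positivity, ?_⟩
  filter_upwards [h₁.bound, h₂.bound, eventually_ge_atTop 1] with l hl₁ hl₂ hl
  have hl' : (0 : ℝ) < l := by exact_mod_cast hl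
  set w : ℝ := (l : ℝ) ^ (-(1 / ((p : ℝ) + 4)) : ℝ) with hw
  have hw0 : 0 < w := by positivity
  rw [Real.norm_of_nonneg hw0.le, Real.norm_of_nonneg (hb l).le] at hl₁ hl₂
  have hwp : l * w ^ (p + 4) = 1 := by
    have : ((p : ℝ) + 4) ≠ 0 := by positivity
    rw [hw, ← Real.rpow_natCast, ← Real.rpow_mul hl'.le]
    push_cast
    rw [neg_mul, one_div_mul_cancel this, Real.rpow_neg_one, mul_inv_cancel₀ hl'.ne']
  constructor
  · calc (C₁⁻¹) ^ (p + 4) = l * (C₁⁻¹ * w) ^ (p + 4) := by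
          rw [mul_pow, mul_left_comm, hwp, mul_one]
      _ ≤ l * b l ^ (p + 4) := by
          gcongr
          rwa [inv_mul_le_iff₀ hC₁]
  · calc l * b l ^ (p + 4) ≤ l * (C₂ * w) ^ (p + 4) := by
          gcongr
          exact (hb l).le
      _ = C₂ ^ (p + 4) := by rw [mul_pow, mul_left_comm, hwp, mul_one]

/-- Rates of the bandwidths for sample sizes of order at least `n ^ ((p + 4) / 4)`. -/
lemma exists_bandwidth_rate {p : ℕ} {b : ℕ → ℝ} (hb : ∀ l, 0 < b l)
    (hΘ : b =Θ[atTop] fun l : ℕ => (l : ℝ) ^ (-(1 / ((p : ℝ) + 4)) : ℝ)) {c : ℝ} (hc : 0 < c) :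
    ∃ c₁ C : ℝ, 0 < c₁ ∧ 0 < C ∧ ∀ᶠ n : ℕ in atTop, ∀ l : ℕ,
      c * (n : ℝ) ^ (((p : ℝ) + 4) / 4) ≤ l →
        1 ≤ l ∧ c₁ / b l ^ 4 ≤ l * b l ^ p ∧ b l ^ 4 ≤ C / n := by
  obtain ⟨c₁, c₂, hc₁, hc₂, hev⟩ := bandwidth_bounds hb hΘ
  obtain ⟨l₀, hl₀⟩ := eventually_atTop.1 hev
  have hp4 : (0 : ℝ) < (p : ℝ) + 4 := by positivity
  -- C results from l b^(p+4) ≤ c₂ and the lower bound on l, raised to the power 4/(p+4).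
  refine ⟨c₁, (c₂ / c) ^ (4 / ((p : ℝ) + 4)), hc₁, by positivity, ?_⟩
  have ht : Tendsto (fun n : ℕ => c * (n : ℝ) ^ (((p : ℝ) + 4) / 4)) atTop atTop :=
    ((tendsto_rpow_atTop (by positivity)).comp tendsto_natCast_atTop_atTop).const_mul_atTop hc
  filter_upwards [ht.eventually_ge_atTop ((max l₀ 1 : ℕ) : ℝ), eventually_ge_atTop 1]
    with n hn hn1 l hl
  have hl1 : max l₀ 1 ≤ l := by exact_mod_cast hn.trans hl
  obtain ⟨h1, h2⟩ := hl₀ l ((le_max_left _ _).trans hl1)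
  have hbl := hb l
  have hn' : (0 : ℝ) < n := by exact_mod_cast hn1
  have hl' : (0 : ℝ) < l := by exact_mod_cast (le_max_right l₀ 1).trans hl1
  refine ⟨(le_max_right _ _).trans hl1, ?_, ?_⟩
  · rw [div_le_iff₀ (by positivity), mul_assoc, ← pow_add]
    exact h1
  · have h3 : b l ^ (p + 4) ≤ c₂ / c * (n : ℝ) ^ (-(((p : ℝ) + 4) / 4)) := by
      rw [Real.rpow_neg hn'.le, ← div_eq_mul_inv, div_div, le_div_iff₀ (by positivity)]
      calc _ ≤ b l ^ (p + 4) * l := by gcongr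
        _ ≤ c₂ := by rwa [mul_comm]
    have h4 : b l ^ 4 = (b l ^ (p + 4)) ^ (4 / ((p : ℝ) + 4)) := by
      rw [← Real.rpow_natCast, ← Real.rpow_natCast, ← Real.rpow_mul hbl.le]
      congr 1
      push_cast
      field_simp
    rw [h4]
    calc _ ≤ (c₂ / c * (n : ℝ) ^ (-(((p : ℝ) + 4) / 4))) ^ (4 / ((p : ℝ) + 4)) := by
          gcongr
      _ = _ := by
          rw [Real.mul_rpow (by positivity) (by positivity), ← Real.rpow_mul hn'.le,
            div_eq_mul_inv _ (n : ℝ), ← Real.rpow_neg_one (n : ℝ)]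
          congr 2
          field_simp

/-- An exponential in 1/b beats every power of b; for b ≤ 1 the exponent 1/b⁴ is replaced by the
smaller 1/b. -/
lemma exists_forall_mul_exp_neg_div_le {A γ : ℝ} (hA : 0 ≤ A) (hγ : 0 < γ) (m : ℕ) :
    ∃ δ : ℝ, 0 < δ ∧ ∀ b : ℝ, 0 < b → b < δ → A * Real.exp (-(γ / b ^ 4)) ≤ b ^ m := by
  have h1 := (Real.tendsto_pow_mul_exp_neg_atTop_nhds_zero m).eventually_lt_const
    (show (0 : ℝ) < γ ^ m / (A + 1) by positivity)
  obtain ⟨X, hX⟩ := eventually_atTop.1 h1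
  set X' := max X 1
  have hX' : 0 < X' := lt_of_lt_of_le one_pos (le_max_right _ _)
  refine ⟨min 1 (γ / X'), by positivity, fun b hb hbδ => ?_⟩
  have hb1 : b ≤ 1 := (hbδ.trans_le (min_le_left _ _)).le
  have hx : X ≤ γ / b := by
    refine (le_max_left X 1).trans ?_
    rw [le_div_iff₀ hb]
    have := hbδ.trans_le (min_le_right _ _)
    rw [lt_div_iff₀ hX'] at this
    linarith
  have h2 := (hX _ hx).le
  have h3 : Real.exp (-(γ / b ^ 4)) ≤ Real.exp (-(γ / b)) := by
    refine Real.exp_le_exp.2 (neg_le_neg ?_)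
    gcongr
    exact pow_le_of_le_one hb.le hb1 (by norm_num)
  rw [div_pow, div_mul_eq_mul_div, div_le_div_iff₀ (by positivity) (by positivity)] at h2
  have h4 : Real.exp (-(γ / b)) * (A + 1) ≤ b ^ m := by
    refine le_of_mul_le_mul_left ?_ (pow_pos hγ m)
    linarith
  calc A * Real.exp (-(γ / b ^ 4)) ≤ (A + 1) * Real.exp (-(γ / b)) := by gcongr; linarith
    _ ≤ b ^ m := by linarith

variable {p k : ℕ} {D : Set (Euc p)} {ε M L : ℝ} {κ : Euc p → ℝ} {Ω : Type*}
  {𝓐 : MeasurableSpace Ω} [mΩ : MeasurableSpace Ω] {P : Measure Ω} [IsProbabilityMeasure P]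
  {h : ℕ → Ω → Euc p → ℝ} {N : ℕ → ℕ → ℕ} {Z : ℕ → ℕ → ℕ → Ω → Euc p} {b : ℕ → ℝ}

/-- Variance and squared bias are both bounded by multiples of b⁴, and the sample sizes make b⁴ at
most a constant over n, uniformly in i. -/
theorem IsSamplingGiven.exists_lintegral_kdeISE_le (hS : IsSamplingGiven 𝓐 P h N Z)
    (hh : ∀ i ω, IsUntruncated D k ε M L (h i ω)) (hD : IsCompact D) (hε : 0 < ε) (hM : 0 < M)
    (hk : 2 ≤ k) (hκ : K1 k κ) (hb : ∀ l, 0 < b l)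
    (hΘ : b =Θ[atTop] fun l : ℕ => (l : ℝ) ^ (-(1 / ((p : ℝ) + 4)) : ℝ))
    (hN : ∃ c : ℝ, 0 < c ∧ ∀ᶠ n : ℕ in atTop, ∀ i : ℕ, i < n →
      c * (n : ℝ) ^ (((p : ℝ) + 4) / 4) ≤ (N n i : ℝ)) :
    ∃ v : ℝ, 0 ≤ v ∧ ∀ᶠ n : ℕ in atTop, ∀ i < n,
      ∫⁻ ω, kdeISE D κ b h N Z n i ω ∂P ≤ ENNReal.ofReal (v / n) := by
  obtain ⟨c, hc, hN⟩ := hN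
  obtain ⟨K, ρ, hB⟩ := hκ.exists_kernelBound
  have hK := hB.pos
  have hρ := hB.radius_pos
  obtain ⟨c₁, C, hc₁, hC, hrate⟩ := exists_bandwidth_rate hb hΘ hc
  have hCn : Tendsto (fun n : ℕ => C / (n : ℝ)) atTop (𝓝 0) := tendsto_const_div_atTop_nhds_zero_nat C
  refine ⟨(2 * (K * M) / c₁ + 2 * (L * ρ ^ 2) ^ 2) * C * volume.real D, by positivity, ?_⟩
  filter_upwards [hN, hrate, hCn.eventually_lt_const (show 0 < (ε / 2 / ρ) ^ 4 by positivity)]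
    with n hn hrn hCn i hi
  obtain ⟨hN1, hlb, hb4⟩ := hrn _ (hn i hi)
  have hbi := hb (N n i)
  have hbρ : b (N n i) * ρ ≤ ε / 2 := by
    rw [← le_div_iff₀ hρ]
    exact (lt_of_pow_lt_pow_left₀ 4 (by positivity) (hb4.trans_lt hCn)).le
  refine (hS.lintegral_kdeISE_le hh hi hD hε hk hκ hB hbi hbρ hN1).trans ?_
  rw [← ENNReal.ofReal_toReal hD.measure_lt_top.ne, ← ENNReal.ofReal_mul (by positivity)]
  refine ENNReal.ofReal_le_ofReal ?_
  have h1 : 2 * (K * M) / (N n i * b (N n i) ^ p) ≤ 2 * (K * M) / c₁ * b (N n i) ^ 4 := by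
    calc _ ≤ 2 * (K * M) / (c₁ / b (N n i) ^ 4) := by gcongr
      _ = _ := by field_simp
  calc _ ≤ (2 * (K * M) / c₁ * b (N n i) ^ 4 + 2 * (L * ρ ^ 2) ^ 2 * b (N n i) ^ 4) *
        (volume D).toReal := by gcongr
    _ = (2 * (K * M) / c₁ + 2 * (L * ρ ^ 2) ^ 2) * b (N n i) ^ 4 * (volume D).toReal := by ring
    _ ≤ (2 * (K * M) / c₁ + 2 * (L * ρ ^ 2) ^ 2) * (C / n) * (volume D).toReal := by gcongr
    _ = _ := by rw [measureReal_def]; ring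

/-- With probability tending to one, all estimates are uniformly close to the densities. -/
theorem IsSamplingGiven.tendsto_measure_exists_lt (hS : IsSamplingGiven 𝓐 P h N Z)
    (hh : ∀ i ω, IsUntruncated D k ε M L (h i ω)) (hD : IsCompact D) (hε : 0 < ε) (hM : 0 < M)
    (hk : 2 ≤ k) (hκ : K1 k κ) (hb : ∀ l, 0 < b l)
    (hΘ : b =Θ[atTop] fun l : ℕ => (l : ℝ) ^ (-(1 / ((p : ℝ) + 4)) : ℝ))
    (hN : ∃ c : ℝ, 0 < c ∧ ∀ᶠ n : ℕ in atTop, ∀ i : ℕ, i < n →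
      c * (n : ℝ) ^ (((p : ℝ) + 4) / 4) ≤ (N n i : ℝ)) {τ : ℝ} (hτ : 0 < τ) :
    Tendsto (fun n : ℕ => P {ω | ∃ i < n, ∃ z ∈ D,
      τ < |kde κ (b (N n i)) (N n i) (fun j => Z n i j ω) z - h i ω z|}) atTop (𝓝 0) := by
  obtain ⟨c, hc, hN⟩ := hN
  obtain ⟨K, ρ, hB⟩ := hκ.exists_kernelBound
  obtain ⟨Λ, hΛ0, hΛ⟩ := hκ.exists_lipschitz (one_le_two.trans hk)
  have hK := hB.pos
  have hρ := hB.radius_pos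
  obtain ⟨c₁, C, hc₁, hC, hrate⟩ := exists_bandwidth_rate hb hΘ hc
  set T := Metric.thickening (ε / 2) D with hT
  have hTfin : volume T ≠ ∞ := hD.isBounded.thickening.measure_lt_top.ne
  set β := (volume (Metric.ball (0 : Euc p) 1)).toReal with hβ
  have hβ0 : 0 < β := ENNReal.toReal_pos (Metric.measure_ball_pos _ _ one_pos).ne'
    measure_ball_lt_top.ne
  -- The balls have radius a b^(p+1), which shrinks as fast as the Lipschitz constant of the
  -- estimate grows, so the error drops by at most τ/2 across them.
  set a := min (ε / 2) (τ / 2 / (Λ + |L| + 1)) with ha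
  have hden : 0 < Λ + |L| + 1 := by positivity
  have ha0 : 0 < a := by positivity
  set γ := min (1 / K) (τ / 2 / (4 * (K * M))) * (τ / 2) / 4 with hγ
  have hγ0 : 0 < γ := by positivity
  set A := 2 * (volume T).toReal / (a ^ p * β) with hA
  -- The power (p+1)p pays for dividing by the ball volume. The remaining b⁸ is at most (C/n)², so
  -- the union over n indices still leaves C²/n.
  obtain ⟨δ, hδ, hexp⟩ := exists_forall_mul_exp_neg_div_le (A := A) (by positivity)
    (mul_pos hγ0 hc₁) (8 + (p + 1) * p)
  set δ' := min (min 1 δ) (min (ε / 2 / ρ) (τ / 4 / ((|L| + 1) * ρ ^ 2))) with hδ'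
  have hδ'0 : 0 < δ' := by positivity
  have hCn : Tendsto (fun n : ℕ => C / (n : ℝ)) atTop (𝓝 0) := tendsto_const_div_atTop_nhds_zero_nat C
  have hbound : ∀ᶠ n : ℕ in atTop, P {ω | ∃ i < n, ∃ z ∈ D,
      τ < |kde κ (b (N n i)) (N n i) (fun j => Z n i j ω) z - h i ω z|} ≤
        ENNReal.ofReal (C ^ 2 / n) := by
    filter_upwards [hN, hrate, hCn.eventually_lt_const (pow_pos hδ'0 4), eventually_ge_atTop 1]
      with n hn hrn hCn hn1
    have hn' : (0 : ℝ) < n := by exact_mod_cast hn1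
    have hi : ∀ i < n, P {ω | ∃ z ∈ D,
        τ < |kde κ (b (N n i)) (N n i) (fun j => Z n i j ω) z - h i ω z|} ≤
          ENNReal.ofReal ((C / n) ^ 2) := by
      intro i hi
      obtain ⟨hN1, hlb, hb4⟩ := hrn _ (hn i hi)
      have hbi := hb (N n i)
      set β' := b (N n i) with hβ'
      have hbδ' : β' < δ' := lt_of_pow_lt_pow_left₀ 4 hδ'0.le (hb4.trans_lt hCn)
      have hb1 : β' ≤ 1 := (hbδ'.trans_le ((min_le_left _ _).trans (min_le_left _ _))).le
      have hbδ : β' < δ := hbδ'.trans_le ((min_le_left _ _).trans (min_le_right _ _))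
      have hbρ : β' * ρ ≤ ε / 2 := by
        rw [← le_div_iff₀ hρ]
        exact (hbδ'.trans_le ((min_le_right _ _).trans (min_le_left _ _))).le
      have hbτ : L * ρ ^ 2 * β' ^ 2 ≤ τ / 2 / 2 := by
        have h1 : β' ≤ τ / 4 / ((|L| + 1) * ρ ^ 2) :=
          (hbδ'.trans_le ((min_le_right _ _).trans (min_le_right _ _))).le
        rw [le_div_iff₀ (by positivity)] at h1
        have h2 : L ≤ |L| + 1 := (le_abs_self L).trans (by linarith)
        calc L * ρ ^ 2 * β' ^ 2 ≤ (|L| + 1) * ρ ^ 2 * β' := by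
              gcongr
              exact pow_le_of_le_one hbi.le hb1 two_ne_zero
          _ ≤ τ / 2 / 2 := by linarith
      have hbp1 : β' ^ (p + 1) ≤ 1 := pow_le_one₀ hbi.le hb1
      have hr0 : 0 < a * β' ^ (p + 1) := by positivity
      have hrε : a * β' ^ (p + 1) ≤ ε / 2 :=
        (mul_le_of_le_one_right ha0.le hbp1).trans (min_le_left _ _)
      have hr : a * β' ^ (p + 1) * (Λ / β' ^ (p + 1) + L) ≤ τ / 2 := by
        have h1 : a * β' ^ (p + 1) * (Λ / β' ^ (p + 1) + L) = a * (Λ + L * β' ^ (p + 1)) := by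
          field_simp
        have h2 : L * β' ^ (p + 1) ≤ |L| := by
          calc L * β' ^ (p + 1) ≤ |L| * β' ^ (p + 1) := by gcongr; exact le_abs_self L
            _ ≤ |L| := mul_le_of_le_one_right (abs_nonneg L) hbp1
        rw [h1]
        calc a * (Λ + L * β' ^ (p + 1)) ≤ τ / 2 / (Λ + |L| + 1) * (Λ + |L| + 1) := by
              have h3 : Λ + L * β' ^ (p + 1) ≤ Λ + |L| + 1 := by linarith
              calc _ ≤ a * (Λ + |L| + 1) := by gcongr
                _ ≤ _ := by gcongr; exact min_le_right _ _
          _ = τ / 2 := by field_simp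
      have hmain := hS.measure_exists_lt_le hh hi hε hM hk hκ hB hΛ hΛ0 hbi hbρ hN1
        (half_pos hτ) hbτ hr0 hrε hr
      rw [mul_div_cancel₀ τ two_ne_zero] at hmain
      refine hmain.trans ?_
      have hball : volume (Metric.ball (0 : Euc p) (a * β' ^ (p + 1))) =
          ENNReal.ofReal ((a * β' ^ (p + 1)) ^ p * β) := by
        rw [Measure.addHaar_ball_of_pos _ _ hr0, ENNReal.ofReal_mul (by positivity), hβ,
          ENNReal.ofReal_toReal measure_ball_lt_top.ne]
        simp
      rw [hball, ← ENNReal.ofReal_toReal hTfin, ← ENNReal.ofReal_mul (by positivity),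
        ← ENNReal.ofReal_div_of_pos (by positivity)]
      refine ENNReal.ofReal_le_ofReal ?_
      have hE : Real.exp (-γ * (N n i * β' ^ p)) ≤ Real.exp (-(γ * c₁ / β' ^ 4)) := by
        refine Real.exp_le_exp.2 ?_
        rw [neg_mul, neg_le_neg_iff, mul_div_assoc]
        gcongr
      have h1 := hexp β' hbi hbδ
      rw [div_le_iff₀ (by positivity)]
      have h2 : 2 * Real.exp (-(γ * c₁ / β' ^ 4)) * (volume T).toReal ≤
          β' ^ 8 * ((a * β' ^ (p + 1)) ^ p * β) := by
        calc _ = A * Real.exp (-(γ * c₁ / β' ^ 4)) * (a ^ p * β) := by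
              rw [hA]
              field_simp
          _ ≤ β' ^ (8 + (p + 1) * p) * (a ^ p * β) := by gcongr
          _ = _ := by
            rw [pow_add, pow_mul, mul_pow]
            ring
      calc _ ≤ 2 * Real.exp (-(γ * c₁ / β' ^ 4)) * (volume T).toReal := by gcongr
        _ ≤ _ := h2
        _ ≤ (C / n) ^ 2 * ((a * β' ^ (p + 1)) ^ p * β) := by
          gcongr
          calc β' ^ 8 = (β' ^ 4) ^ 2 := by ring
            _ ≤ _ := by gcongr
    calc _ ≤ P (⋃ i ∈ Finset.range n, {ω | ∃ z ∈ D,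
        τ < |kde κ (b (N n i)) (N n i) (fun j => Z n i j ω) z - h i ω z|}) := by
          refine measure_mono fun ω ⟨i, hin, hz⟩ => ?_
          simp only [Set.mem_iUnion]
          exact ⟨i, Finset.mem_range.2 hin, hz⟩
      _ ≤ ∑ i ∈ Finset.range n, P {ω | ∃ z ∈ D,
        τ < |kde κ (b (N n i)) (N n i) (fun j => Z n i j ω) z - h i ω z|} :=
          measure_biUnion_finset_le _ _
      _ ≤ ∑ _i ∈ Finset.range n, ENNReal.ofReal ((C / n) ^ 2) :=
          Finset.sum_le_sum fun i hin => hi i (Finset.mem_range.1 hin)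
      _ = ENNReal.ofReal (C ^ 2 / n) := by
          rw [Finset.sum_const, Finset.card_range, nsmul_eq_mul, ← ENNReal.ofReal_natCast,
            ← ENNReal.ofReal_mul hn'.le]
          congr 1
          field_simp
  refine tendsto_of_tendsto_of_tendsto_of_le_of_le' tendsto_const_nhds ?_
    (Eventually.of_forall fun _ => zero_le) hbound
  rw [← ENNReal.ofReal_zero]
  exact (ENNReal.continuous_ofReal.tendsto 0).comp (tendsto_const_div_atTop_nhds_zero_nat (C ^ 2))

end Rates

/-! ### Assembly of the rates -/

/-- The root-n rate uniform on balls gives both claims: a single x lies in the ball of radius ‖x‖,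
and n^(-1/2) ≤ n^(-1/(2+ε)) for n ≥ 1. -/
lemma rates_of_forall_isBigOp_iSup {q : ℕ} {Ω : Type*} [MeasurableSpace Ω] {P : Measure Ω}
    {Y : ℕ → Ω → Euc q → ℝ≥0∞}
    (h : ∀ B : ℝ, IsBigOp P (fun n ω => ⨆ x ∈ Metric.closedBall (0 : Euc q) B, Y n ω x)
      (fun n => (n : ℝ) ^ (-(1 / 2) : ℝ))) :
    (∀ x, IsBigOp P (fun n ω => Y n ω x) (fun n => (n : ℝ) ^ (-(1 / 2) : ℝ))) ∧
    (∀ B : ℝ, 0 < B → ∀ ε : ℝ, 0 < ε →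
      IsBigOp P (fun n ω => ⨆ x ∈ Metric.closedBall (0 : Euc q) B, Y n ω x)
        (fun n => (n : ℝ) ^ (-(1 / (2 + ε)) : ℝ))) := by
  refine ⟨fun x => IsBigOp.mono (B := fun n ω => Y n ω x) (h ‖x‖) fun n ω => ?_,
    fun B _ ε hε => (h B).mono_rate ?_⟩
  · have hx : x ∈ Metric.closedBall (0 : Euc q) ‖x‖ := mem_closedBall_zero_iff.2 le_rfl
    exact le_iSup₂_of_le x hx le_rfl
  · filter_upwards [eventually_ge_atTop 1] with n hn
    refine Real.rpow_le_rpow_of_exponent_le (by exact_mod_cast hn) (neg_le_neg ?_)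
    exact one_div_le_one_div_of_le two_pos (by linarith)

lemma isFrechetClass {p : ℕ} {ψ : Transform p} {F : Set (Euc p → ℝ)} {R : ℝ} (hR : 0 ≤ R)
    (hS : SlicesIn ψ F R) (hT0 : T0 ψ F) (hA1 : A1 ψ F) (hne : F.Nonempty) :
    IsFrechetClass ψ F R where
  radius_nonneg := hR
  slices := hS
  injOn := hS.quantileEmb_injOn hT0
  isClosed := hS.quantileImage_eq ▸ hA1.1
  convex := hS.quantileImage_eq ▸ hA1.2
  nonempty := hne

/-- Consistency of the density estimates on `D`, uniformly over the sample. -/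
theorem IsSampling.kde_rates {p k : ℕ} {D : Set (Euc p)} {ε M L : ℝ} {κ : Euc p → ℝ} {Ω : Type*}
    [mΩ : MeasurableSpace Ω] {P : Measure Ω} [IsProbabilityMeasure P]
    {h : ℕ → Ω → Euc p → ℝ} {N : ℕ → ℕ → ℕ} {Z : ℕ → ℕ → ℕ → Ω → Euc p} {b : ℕ → ℝ}
    (hS : IsSampling P h N Z) (hh : ∀ i ω, IsUntruncated D k ε M L (h i ω)) (hD : IsCompact D)
    (hε : 0 < ε) (hM : 0 < M) (hk : 2 ≤ k) (hκ : K1 k κ) (hb : ∀ l, 0 < b l)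
    (hΘ : b =Θ[atTop] fun l : ℕ => (l : ℝ) ^ (-(1 / ((p : ℝ) + 4)) : ℝ))
    (hN : ∃ c : ℝ, 0 < c ∧ ∀ᶠ n : ℕ in atTop, ∀ i : ℕ, i < n →
      c * (n : ℝ) ^ (((p : ℝ) + 4) / 4) ≤ (N n i : ℝ)) :
    (∀ n i, Measurable (kdeISE D κ b h N Z n i)) ∧
    (∃ v : ℝ, 0 ≤ v ∧ ∀ᶠ n : ℕ in atTop, ∀ i < n,
      ∫⁻ ω, kdeISE D κ b h N Z n i ω ∂P ≤ ENNReal.ofReal (v / n)) ∧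
    ∀ τ : ℝ, 0 < τ → Tendsto (fun n : ℕ => P {ω | ∃ i < n, ∃ z ∈ D,
      τ < |kde κ (b (N n i)) (N n i) (fun j => Z n i j ω) z - h i ω z|}) atTop (𝓝 0) := by
  obtain ⟨𝓐, hS⟩ := hS
  exact ⟨IsSamplingGiven.measurable_kdeISE (mΩ := mΩ) hS hκ.contDiff.continuous b,
    IsSamplingGiven.exists_lintegral_kdeISE_le (mΩ := mΩ) hS hh hD hε hM hk hκ hb hΘ hN,
    fun τ hτ => IsSamplingGiven.tendsto_measure_exists_lt (mΩ := mΩ) hS hh hD hε hM hk hκ hb hΘ hN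
      hτ⟩

lemma subset_supNhd {p k : ℕ} {D : Set (Euc p)} {F : Set (Euc p → ℝ)} {η : ℝ} (hη : 0 ≤ η)
    (hF : ∀ f ∈ F, IsDensityOn D k f) : F ⊆ supNhd D k F η := fun f hf =>
  ⟨hF f hf, f, hf, fun z _ => by simpa using hη⟩

lemma K1.contDiff_kde {p k : ℕ} {κ : Euc p → ℝ} (hκ : K1 k κ) (b : ℝ) (N : ℕ) (Z : ℕ → Euc p) :
    ContDiff ℝ (k : WithTop ℕ∞) (kde κ b N Z) := by
  unfold kde
  refine contDiff_const.mul (ContDiff.sum fun j _ => hκ.contDiff.comp ?_)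
  fun_prop

lemma IsDensityOn.volume_pos {p k : ℕ} {D : Set (Euc p)} (hD : IsCompact D) {f : Euc p → ℝ}
    (hf : IsDensityOn D k f) : 0 < volume.real D := by
  refine ENNReal.toReal_pos (fun h0 => ?_) hD.measure_lt_top.ne
  have h1 : f =ᵐ[volume] 0 := by
    rw [Filter.EventuallyEq, ae_iff]
    exact measure_mono_null (fun z hz => by rw [← hf.support_eq]; exact hz) h0
  have h2 := hf.integral_one
  rw [integral_congr_ae h1] at h2
  simp at h2

end SAW

end

/-! ### The main theorem -/

open SAW in
theorem theorem2 {p q : ℕ} (hp : 1 ≤ p)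
    -- (D1)
    (D : Set (Euc p)) (hDcompact : IsCompact D) (hDconvex : Convex ℝ D)
    -- (F1), (F2)
    (k : ℕ) (F : Set (Euc p → ℝ)) (hF1 : F1 D k F) (hF2 : (p : ℝ) / 2 < k)
    -- slicing transform with (T0), (T1), (T2), and (A1)
    (ψ : Transform p) (hψ : IsSlicingOn ψ F)
    (hT0 : T0 ψ F) (hT1 : T1 ψ F) (hT2 : T2 ψ F) (hA1 : A1 ψ F)
    -- the random pair `(X, f)` and independent copies of it
    {Ω : Type*} [MeasurableSpace Ω] (P : Measure Ω) [IsProbabilityMeasure P]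
    (X : Ω → Euc q) (f : Ω → F) (Xs : ℕ → Ω → Euc q) (fs : ℕ → Ω → F)
    (hident : ∀ i, IdentDistrib (fun ω => (Xs i ω, fs i ω)) (fun ω => (X ω, f ω)) P P)
    (hindep : iIndepFun (fun i ω => (Xs i ω, fs i ω)) P)
    (hX : MemLp X 4 P) (hVar : (covMatrix P X).PosDef) :
    let M : Euc q → (Euc p → ℝ) → ℝ := popObjective P ψ X (fun ω => (f ω : Euc p → ℝ))
    let Mcheck : ℕ → Ω → Euc q → (Euc p → ℝ) → ℝ := fun n ω =>
      sampleObjective ψ n (fun i => Xs i ω) (fun i => (fs i ω : Euc p → ℝ))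
    let m : Euc q → Euc p → ℝ := fun x => argmin F (M x)
    let mcheck : ℕ → Ω → Euc q → Euc p → ℝ := fun n ω x => argmin F (Mcheck n ω x)
    -- the minimizers exist and are unique
    (∀ x, ∃! g, IsMinimizer F (M x) g) ∧
    (∀ n, 1 ≤ n → ∀ ω x, ∃! g, IsMinimizer F (Mcheck n ω x) g) ∧
    -- rates for fully observed distributions
    (∀ x, IsBigOp P (fun n ω => ENNReal.ofReal (dSW ψ (m x) (mcheck n ω x)))
      (fun n => (n : ℝ) ^ (-(1 / 2) : ℝ))) ∧
    (∀ B : ℝ, 0 < B → ∀ ε : ℝ, 0 < ε →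
      IsBigOp P (fun n ω => ⨆ x ∈ Metric.closedBall (0 : Euc q) B,
          ENNReal.ofReal (dSW ψ (m x) (mcheck n ω x)))
        (fun n => (n : ℝ) ^ (-(1 / (2 + ε)) : ℝ))) ∧
    -- estimated densities
    (∀ (η : ℝ), 0 < η →
      -- the slicing transform and (T1) extend to densities close to `F` in sup norm
      IsSlicingOn ψ (supNhd D k F η) → G1bounds ψ (supNhd D k F η) → T1 ψ (supNhd D k F η) →
      -- (F1′)
      ∀ (h : ℕ → Ω → Euc p → ℝ) (ε₀ M₀ L : ℝ), 0 < ε₀ → 0 < M₀ →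
      (∀ i ω, IsUntruncated D k ε₀ M₀ L (h i ω)) →
      (∀ i ω, (fs i ω : Euc p → ℝ) = truncate D (h i ω)) →
      -- the observations, (P1)
      ∀ (N : ℕ → ℕ → ℕ) (Z : ℕ → ℕ → ℕ → Ω → Euc p),
      IsSampling P h N Z →
      (∃ c : ℝ, 0 < c ∧ ∀ᶠ n : ℕ in atTop, ∀ i : ℕ, i < n → c * (n : ℝ) ^ (((p : ℝ) + 4) / 4) ≤ (N n i : ℝ)) →
      -- (K1), (K2), bandwidth
      ∀ (κ : Euc p → ℝ), K1 k κ → K2 κ →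
      ∀ (b : ℕ → ℝ), (∀ l, 0 < b l) →
      (b =Θ[atTop] fun l : ℕ => (l : ℝ) ^ (-(1 / ((p : ℝ) + 4)) : ℝ)) →
      let fhat : ℕ → ℕ → Ω → Euc p → ℝ := fun n i ω =>
        truncate D (kde κ (b (N n i)) (N n i) (fun j => Z n i j ω))
      let Mhat : ℕ → Ω → Euc q → (Euc p → ℝ) → ℝ := fun n ω =>
        sampleObjective ψ n (fun i => Xs i ω) (fun i => fhat n i ω)
      let mhat : ℕ → Ω → Euc q → Euc p → ℝ := fun n ω x => argmin F (Mhat n ω x)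
      Tendsto (fun n => P {ω | ¬ ∀ x, ∃! g, IsMinimizer F (Mhat n ω x) g}) atTop (𝓝 0) ∧
      (∀ x, IsBigOp P (fun n ω => ENNReal.ofReal (dSW ψ (m x) (mhat n ω x)))
        (fun n => (n : ℝ) ^ (-(1 / 2) : ℝ))) ∧
      (∀ B : ℝ, 0 < B → ∀ ε : ℝ, 0 < ε →
        IsBigOp P (fun n ω => ⨆ x ∈ Metric.closedBall (0 : Euc q) B,
            ENNReal.ofReal (dSW ψ (m x) (mhat n ω x)))
          (fun n => (n : ℝ) ^ (-(1 / (2 + ε)) : ℝ)))) := by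
  intro M Mcheck m mcheck
  obtain ⟨hk, hdens, -, -⟩ := hF1
  obtain ⟨ω₀⟩ := nonempty_of_isProbabilityMeasure P
  obtain ⟨R, hR, hS⟩ := hψ.exists_slicesIn
  have hF : IsFrechetClass ψ F R := isFrechetClass hR hS hT0 hA1 ⟨f ω₀, (f ω₀).2⟩
  borelize ↥(Lp ℝ 2 (quantileMeasure p))
  have hΦ : Measurable fun f : F => quantileEmb ψ (f : Euc p → ℝ) :=
    measurable_quantileEmb hS hT1 hDcompact (fun f hf => (hdens f hf).contDiffOn.continuousOn)
      fun f hf => (hdens f hf).support_eq.le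
  have hV : AEStronglyMeasurable (fun ω => quantileEmb ψ (f ω : Euc p → ℝ)) P :=
    (hΦ.comp_aemeasurable (hident 0).aemeasurable_snd.snd).aestronglyMeasurable
  -- Fully observed distributions are the case of zero approximation error, with the whole space as
  -- good event.
  have hcheck := rates_of_forall_isBigOp_iSup fun B =>
    hF.isBigOp_dSW_argmin hS hΦ hident hindep hX hVar (G := fun _ => Set.univ)
      (fhat := fun _ i ω => fs i ω) (Q := fun _ _ _ => 0) (by simp) le_rfl
      (Eventually.of_forall fun n ω _ i _ => ⟨(fs i ω).2, by simp⟩) (fun _ _ => aemeasurable_const)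
      le_rfl (Eventually.of_forall fun n i _ => by simp) B
  refine ⟨fun x => (hF.population (hX.mono_exponent (by norm_num)) hV x).1,
    fun n hn ω x => (hF.sample hS hn _ (fun i _ => (fs i ω).2) x).1, hcheck.1, hcheck.2, ?_⟩
  intro η hη hψη hG1 hT1η h ε₀ M₀ L hε₀ hM₀ hh hfs N Z hsamp hN κ hκ hK2 b hb hΘ fhat Mhat mhat
  obtain ⟨R', -, hS'⟩ := hψη.exists_slicesIn
  obtain ⟨K, hK, hlip⟩ := hS'.exists_lipschitz hT1η hG1
  obtain ⟨τ, C, hτ, hC, htrunc⟩ := exists_truncate_mem_supNhd (k := k) hDcompact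
    ((hdens _ (f ω₀).2).volume_pos hDcompact) hM₀ (F := F) hη
  obtain ⟨hISEm, ⟨v, hv, hISE⟩, hsup⟩ := hsamp.kde_rates hh hDcompact hε₀ hM₀ hk hκ hb hΘ hN
  have hsub := subset_supNhd hη.le hdens
  -- On this event every estimate is τ-close on D, so every truncated estimate belongs to the sup
  -- neighbourhood, where (T1) and (G1) are available.
  set G : ℕ → Set Ω := fun n => {ω | ∀ i < n, ∀ z ∈ D,
    |kde κ (b (N n i)) (N n i) (fun j => Z n i j ω) z - h i ω z| ≤ τ} with hGdef
  have hG : Tendsto (fun n => P (G n)ᶜ) atTop (𝓝 0) := by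
    convert hsup τ hτ using 3 with n
    ext ω
    simp [hGdef]
  have hgood : ∀ n, ∀ ω ∈ G n, ∀ i < n, fhat n i ω ∈ supNhd D k F η ∧
      ENNReal.ofReal (‖quantileEmb ψ (fs i ω : Euc p → ℝ) - quantileEmb ψ (fhat n i ω)‖ ^ 2) ≤
        ENNReal.ofReal (K * C) * kdeISE D κ b h N Z n i ω := by
    intro n ω hω i hi
    have hD : D ⊆ Metric.thickening ε₀ D := Metric.self_subset_thickening hε₀ D
    obtain ⟨h1, h2⟩ := htrunc (h i ω) _ (fun z hz => (hh i ω).bounds z (hD hz))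
      ((hh i ω).contDiffOn.continuousOn.mono hD)
      (hκ.contDiff_kde (b (N n i)) (N n i) fun j => Z n i j ω) (hfs i ω ▸ (fs i ω).2) (hω i hi)
    refine ⟨h1, (hlip _ (hsub (fs i ω).2) _ h1).trans ?_⟩
    rw [ENNReal.ofReal_mul hK, mul_assoc, hfs i ω]
    exact mul_le_mul_right h2 _
  have hhat := rates_of_forall_isBigOp_iSup fun B =>
    hF.isBigOp_dSW_argmin hS' hΦ hident hindep hX hVar hG (mul_nonneg hK hC)
      (Eventually.of_forall hgood)
      (fun n i => (hISEm n i).aemeasurable) hv hISE B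
  refine ⟨?_, hhat.1, hhat.2⟩
  refine tendsto_of_tendsto_of_tendsto_of_le_of_le' tendsto_const_nhds hG
    (Eventually.of_forall fun _ => zero_le) ?_
  filter_upwards [eventually_ge_atTop 1] with n hn
  -- On the good event the projection argument applies for all x simultaneously, so failure of
  -- existence or uniqueness is confined to its complement.
  refine measure_mono fun ω hω hωG => hω fun x => ?_
  exact (hF.sample hS' hn _ (fun i hi => (hgood n ω hωG i hi).1) x).1
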